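/- Let $d\ge 0$ be an integer and $\alpha\in(0,1)$. For finite measures $\lambda,\mu$ on $\mathbb R^d$ let $\Pi(\lambda,\mu)$ be the set of measures on $\mathbb R^d\times\mathbb R^d$ with marginals $\lambda$ and $\mu$, and $$OT(\lambda,\mu)=\inf_{\pi\in\Pi(\lambda,\mu)}\int|x-y|^2\,d\pi .$$ For $\varepsilon>0$, an entropic minimiser at scale $\varepsilon$ is a $\pi_\varepsilon\in\Pi(\lambda,\mu)$ that minimises $$\pi\mapsto\int|x-y|^2\,d\pi+\varepsilon^2\int\log\Big(\frac{d\pi}{d(\lambda\otimes\mu)}\Big)\,d\pi$$ over $\Pi(\lambda,\mu)$, the minimum being finite. Write $B_R$ for the open ball of radius $R$ around $0$, $\Lambda=\tfrac{11}{4}$, $$\#_R=(B_R\times\mathbb R^d)\cup(\mathbb R^d\times B_R),\qquad P_R=(B_R\times B_{\Lambda R})\cup(B_{\Lambda R}\times B_R),$$ $$E(\pi,R)=\frac1{R^{d+2}}\int_{\#_R}|x-y|^2\,d\pi,\qquad D_{\lambda,\mu}(R)=R^{2\alpha}\big([\lambda]_{\alpha,R}^2+[\mu]_{\alpha,R}^2\big)+|\lambda(0)-\mu(0)|^2,$$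 where measures and their continuous densities are denoted by the same letter and $[\cdot]_{\alpha,R}$ is the $\alpha$-Hölder seminorm on $B_R$. For a symmetric positive definite matrix $A\in\mathbb R^{d\times d}$, $b\in\mathbb R^d$ and $\gamma,\kappa>0$ put $\mathsf s=(A,b,\gamma,\kappa)$, $Q_1(x)=A^{-1}x$, $Q_2(y)=\gamma A(y-b)$, $Q=(Q_1,Q_2)$, and $$\lambda_{\mathsf s}=\kappa(Q_1)_\#\lambda,\qquad \mu_{\mathsf s}=\kappa(Q_2)_\#\mu,\qquad \pi_{\mathsf s}=\kappa\,Q_\#\pi .$$ Let $K,G\subset(0,\infty)$ be compact, and for $a>0$ let $\mathscr S_a$ be the set of all such $\mathsf s$ with $\det A\ge a$, $\gamma\in G$, $\kappa\in K$. Let $\theta>1$. Then there is a function $C_1=C_1(\delta,R,\lambda(0),\mu(0))\in\mathbb R$ (depending otherwise only on $d,\alpha,\theta,K,G$), increasing in $R\in(0,\infty)$, such that for all $c_0>0$ and $a>0$ there is $\eta>0$ with the following property. Let $R>0$ and $0<\varepsilon\le\eta R$, let $\lambda,\mu$ be finite measures on $\mathbb R^d$ with nonnegative densities that are $\alpha$-Hölder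 continuous on every ball and bounded below by $c_0$ on $B_R$, and let $\pi_\varepsilon\in\Pi(\lambda,\mu)$ be an entropic minimiser at scale $\varepsilon$. (1) If $E(\pi_\varepsilon,\theta R)+D_{\lambda,\mu}(\theta R)\le\eta$, then for every $\delta\in(0,1)$ $$\int_{\#_R}|x-y|^2\,d\pi_\varepsilon\le \pi_\varepsilon(P_R)\,OT(\bar\lambda,\bar\mu)+C_1\,\pi_\varepsilon(\#_{\Lambda R})\,\varepsilon^2+\delta\int_{\#_{2R}}|x-y|^2\,d\pi_\varepsilon ,$$ where $\bar\lambda,\bar\mu$ are the marginals of $\pi_\varepsilon$ restricted to $P_R$, divided by $\pi_\varepsilon(P_R)$. (2) For every $\mathsf s\in\mathscr S_a$ with $E(\pi_{\varepsilon,\mathsf s},\theta R)+D_{\lambda_{\mathsf s},\mu_{\mathsf s}}(\theta R)\le\eta$, where $\pi_{\varepsilon,\mathsf s}=(\pi_\varepsilon)_{\mathsf s}$, and every $\delta\in(0,1)$, $$\int_{\#_R}|x-y|^2\,d\pi_{\varepsilon,\mathsf s}\le \pi_{\varepsilon,\mathsf s}(P_R)\,OT(\bar\lambda_{\mathsf s},\bar\mu_{\mathsf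 s})+C_1\,\pi_{\varepsilon,\mathsf s}(\#_{\Lambda R})\,\varepsilon^2+\delta\int_{\#_{2R}}|x-y|^2\,d\pi_{\varepsilon,\mathsf s},$$ with the same $C_1=C_1(\delta,R,\lambda(0),\mu(0))$, where $\bar\lambda_{\mathsf s},\bar\mu_{\mathsf s}$ are the normalised marginals of $\pi_{\varepsilon,\mathsf s}$ restricted to $P_R$. -/

import Mathlib

open MeasureTheory Set
open scoped NNReal ENNReal

noncomputable section

namespace EntropicOT

/-- `ℝ^d` with the Euclidean norm. -/
abbrev Pt (d : ℕ) : Type := EuclideanSpace ℝ (Fin d)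

/-- `Π(lam, mu)`: the measures on `ℝ^d × ℝ^d` with marginals `lam` and `mu`. -/
def couplings {d : ℕ} (lam mu : Measure (Pt d)) : Set (Measure (Pt d × Pt d)) :=
  {p | p.map Prod.fst = lam ∧ p.map Prod.snd = mu}

/-- The quadratic optimal transport cost `OT(lam, mu)`, with values in `[0, ∞]`. -/
def OT {d : ℕ} (lam mu : Measure (Pt d)) : ℝ≥0∞ :=
  ⨅ p ∈ couplings lam mu, ∫⁻ z, ‖z.1 - z.2‖ₑ ^ 2 ∂p

/-- Both terms of the entropic cost of `p` are finite. -/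
structure HasFiniteCost {d : ℕ} (lam mu : Measure (Pt d)) (p : Measure (Pt d × Pt d)) :
    Prop where
  ac : p ≪ lam.prod mu
  quad : Integrable (fun z : Pt d × Pt d => ‖z.1 - z.2‖ ^ 2) p
  entropy : Integrable (llr p (lam.prod mu)) p

/-- The entropic cost
`∫ |x - y|² dp + ε² ∫ log (dp / d(lam ⊗ mu)) dp`; meaningful for plans of finite cost, and for
finite `lam`, `mu` all other plans have cost `+∞`. -/
def entropicCost {d : ℕ} (ε : ℝ) (lam mu : Measure (Pt d)) (p : Measure (Pt d × Pt d)) : ℝ :=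
  ∫ z, ‖z.1 - z.2‖ ^ 2 ∂p + ε ^ 2 * ∫ z, llr p (lam.prod mu) z ∂p

/-- `p` minimises the entropic cost at scale `ε` over `Π(lam, mu)`, with finite minimum. -/
structure IsEntropicMinimiser {d : ℕ} (ε : ℝ) (lam mu : Measure (Pt d))
    (p : Measure (Pt d × Pt d)) : Prop where
  mem : p ∈ couplings lam mu
  finite : HasFiniteCost lam mu p
  le : ∀ q ∈ couplings lam mu, HasFiniteCost lam mu q →
    entropicCost ε lam mu p ≤ entropicCost ε lam mu q

/-- `f` is a nonnegative density of `lam` which is `α`-Hölder continuous on every ball. -/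
structure IsHolderDensity {d : ℕ} (α : ℝ≥0) (f : Pt d → ℝ) (lam : Measure (Pt d)) : Prop where
  nonneg : ∀ x, 0 ≤ f x
  holder : ∀ r : ℝ, ∃ C : ℝ≥0, HolderOnWith C α f (Metric.ball 0 r)
  eq_withDensity : lam = volume.withDensity (fun x => ENNReal.ofReal (f x))

/-- `#_R = (B_R × ℝ^d) ∪ (ℝ^d × B_R)`. -/
def cross (d : ℕ) (R : ℝ) : Set (Pt d × Pt d) :=
  (Metric.ball 0 R ×ˢ univ) ∪ (univ ×ˢ Metric.ball 0 R)

/-- `P_R = (B_R × B_{ΛR}) ∪ (B_{ΛR} × B_R)`. -/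
def pset (d : ℕ) (L R : ℝ) : Set (Pt d × Pt d) :=
  (Metric.ball 0 R ×ˢ Metric.ball 0 (L * R)) ∪ (Metric.ball 0 (L * R) ×ˢ Metric.ball 0 R)

/-- `∫_{#_R} |x - y|² dp`. -/
def crossCost {d : ℕ} (p : Measure (Pt d × Pt d)) (R : ℝ) : ℝ≥0∞ :=
  ∫⁻ z in cross d R, ‖z.1 - z.2‖ₑ ^ 2 ∂p

/-- `E(p, R) = R^{-(d+2)} ∫_{#_R} |x - y|² dp`. -/
def energy {d : ℕ} (p : Measure (Pt d × Pt d)) (R : ℝ) : ℝ≥0∞ :=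
  (ENNReal.ofReal (R ^ (d + 2)))⁻¹ * crossCost p R

/-- The Hölder seminorm `[f]_{α,R}` of `f` on `B_R`, with values in `[0, ∞]`. -/
def holderSeminorm {d : ℕ} (α : ℝ≥0) (f : Pt d → ℝ) (R : ℝ) : ℝ≥0∞ :=
  eHolderNorm α (fun x : Metric.ball (0 : Pt d) R => f x)

/-- `D(R) = R^{2α} ([f]_{α,R}² + [g]_{α,R}²) + |f(0) - g(0)|²` for densities `f`, `g`. -/
def dataD {d : ℕ} (α : ℝ≥0) (f g : Pt d → ℝ) (R : ℝ) : ℝ≥0∞ :=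
  ENNReal.ofReal (R ^ (2 * (α : ℝ))) * (holderSeminorm α f R ^ 2 + holderSeminorm α g R ^ 2)
    + ENNReal.ofReal (|f 0 - g 0| ^ 2)

/-- The first marginal of `p` restricted to `S`, normalised to mass one. -/
def normFst {d : ℕ} (p : Measure (Pt d × Pt d)) (S : Set (Pt d × Pt d)) : Measure (Pt d) :=
  (p S)⁻¹ • (p.restrict S).map Prod.fst

/-- The second marginal of `p` restricted to `S`, normalised to mass one. -/
def normSnd {d : ℕ} (p : Measure (Pt d × Pt d)) (S : Set (Pt d × Pt d)) : Measure (Pt d) :=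
  (p S)⁻¹ • (p.restrict S).map Prod.snd

/-- The local almost quasi-minimality bound
`∫_{#_R} |x-y|² dp ≤ p(P_R) OT(λ̄, μ̄) + C p(#_{ΛR}) ε² + δ ∫_{#_{2R}} |x-y|² dp`,
with `λ̄, μ̄` the normalised marginals of `p` restricted to `P_R`. -/
def QuasiMinBound {d : ℕ} (L C ε δ R : ℝ) (p : Measure (Pt d × Pt d)) : Prop :=
  crossCost p R ≤
    p (pset d L R) * OT (normFst p (pset d L R)) (normSnd p (pset d L R))
      + ENNReal.ofReal (C * ε ^ 2) * p (cross d (L * R))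
      + ENNReal.ofReal δ * crossCost p (2 * R)

/-- The parameters `(A, b, γ, κ)` of an affine rescaling. -/
structure Rescaling (d : ℕ) where
  A : Matrix (Fin d) (Fin d) ℝ
  b : Pt d
  γ : ℝ
  κ : ℝ

/-- Admissible rescalings: `A` symmetric positive definite with `det A ≥ a`, `γ ∈ G`, `κ ∈ K`;
`b` is arbitrary. -/
def admissible (d : ℕ) (a : ℝ) (K G : Set ℝ) : Set (Rescaling d) :=
  {s | s.A.PosDef ∧ a ≤ s.A.det ∧ s.γ ∈ G ∧ s.κ ∈ K}

namespace Rescaling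

variable {d : ℕ}

/-- `Q₁(x) = A⁻¹ x`. -/
def Q₁ (s : Rescaling d) (x : Pt d) : Pt d := Matrix.toEuclideanCLM (𝕜 := ℝ) s.A⁻¹ x

/-- `Q₂(y) = γ A (y - b)`. -/
def Q₂ (s : Rescaling d) (y : Pt d) : Pt d :=
  s.γ • Matrix.toEuclideanCLM (𝕜 := ℝ) s.A (y - s.b)

/-- `λ_s = κ (Q₁)_# λ`. -/
def fstMeasure (s : Rescaling d) (lam : Measure (Pt d)) : Measure (Pt d) :=
  ENNReal.ofReal s.κ • lam.map s.Q₁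

/-- `μ_s = κ (Q₂)_# μ`. -/
def sndMeasure (s : Rescaling d) (mu : Measure (Pt d)) : Measure (Pt d) :=
  ENNReal.ofReal s.κ • mu.map s.Q₂

/-- `π_s = κ (Q₁, Q₂)_# π`, a coupling of `λ_s` and `μ_s`. -/
def plan (s : Rescaling d) (p : Measure (Pt d × Pt d)) : Measure (Pt d × Pt d) :=
  ENNReal.ofReal s.κ • p.map (Prod.map s.Q₁ s.Q₂)

/-- The density of `λ_s`, if `λ` has density `f`. -/
def fstDensity (s : Rescaling d) (f : Pt d → ℝ) (x : Pt d) : ℝ :=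
  s.κ * s.A.det * f (Matrix.toEuclideanCLM (𝕜 := ℝ) s.A x)

/-- The density of `μ_s`, if `μ` has density `g`. -/
def sndDensity (s : Rescaling d) (g : Pt d → ℝ) (y : Pt d) : ℝ :=
  s.κ * (s.γ ^ d * s.A.det)⁻¹ * g (s.γ⁻¹ • Matrix.toEuclideanCLM (𝕜 := ℝ) s.A⁻¹ y + s.b)

lemma det_toEuclideanCLM (M : Matrix (Fin d) (Fin d) ℝ) :
    LinearMap.det (Matrix.toEuclideanCLM (𝕜 := ℝ) M : Pt d →ₗ[ℝ] Pt d) = M.det := by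
  rw [Matrix.coe_toEuclideanCLM_eq_toEuclideanLin]
  change LinearMap.det (Matrix.toLpLin 2 2 M) = M.det
  rw [Matrix.toLpLin_eq_toLin, LinearMap.det_toLin]

lemma toEuclideanCLM_cancel {M N : Matrix (Fin d) (Fin d) ℝ} (h : M * N = 1) (x : Pt d) :
    Matrix.toEuclideanCLM (𝕜 := ℝ) M (Matrix.toEuclideanCLM (𝕜 := ℝ) N x) = x := by
  have := congrArg (fun T : Pt d →L[ℝ] Pt d => T x)
    (map_mul (Matrix.toEuclideanCLM (n := Fin d) (𝕜 := ℝ)) M N)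
  simp only [h, map_one] at this
  simpa using this.symm

lemma measurable_Q₁ (s : Rescaling d) : Measurable s.Q₁ := by
  unfold Q₁; fun_prop

lemma measurable_Q₂ (s : Rescaling d) : Measurable s.Q₂ := by
  unfold Q₂; fun_prop

lemma map_withDensity_of_leftInverse {T T' : Pt d → Pt d} (hT : Measurable T)
    (hT' : Measurable T') (h : ∀ x, T' (T x) = x) {F : Pt d → ℝ≥0∞} (hF : Measurable F)
    (m : Measure (Pt d)) :
    (m.withDensity F).map T = (m.map T).withDensity (fun x => F (T' x)) := by
  ext S hS
  rw [Measure.map_apply hT hS, withDensity_apply _ (hT hS), withDensity_apply _ hS,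
    setLIntegral_map (f := fun x => F (T' x)) hS (hF.comp hT') hT]
  simp [h]

lemma fstMeasure_eq_withDensity (s : Rescaling d) (hA : s.A.PosDef) (hκ : 0 ≤ s.κ)
    {f : Pt d → ℝ} (hf : Measurable f) :
    s.fstMeasure (volume.withDensity fun x => ENNReal.ofReal (f x))
      = volume.withDensity fun x => ENNReal.ofReal (s.fstDensity f x) := by
  have hd : 0 < s.A.det := hA.det_pos
  have hu : IsUnit s.A.det := hd.ne'.isUnit
  have hmap : (volume : Measure (Pt d)).map s.Q₁ = ENNReal.ofReal s.A.det • volume := by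
    have h := Measure.map_linearMap_addHaar_eq_smul_addHaar (volume : Measure (Pt d))
      (f := (Matrix.toEuclideanCLM (𝕜 := ℝ) s.A⁻¹ : Pt d →ₗ[ℝ] Pt d))
      (by rw [det_toEuclideanCLM, Matrix.det_nonsing_inv]; simp [hd.ne'])
    rw [det_toEuclideanCLM, Matrix.det_nonsing_inv] at h
    have h2 : s.Q₁ = (Matrix.toEuclideanCLM (𝕜 := ℝ) s.A⁻¹ : Pt d →ₗ[ℝ] Pt d) := by
      ext1 x; simp [Q₁]
    rw [h2, h]
    simp [abs_of_pos hd]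
  rw [fstMeasure, map_withDensity_of_leftInverse (T' := Matrix.toEuclideanCLM (𝕜 := ℝ) s.A)
    s.measurable_Q₁ (by fun_prop)
    (fun x => toEuclideanCLM_cancel (Matrix.mul_nonsing_inv _ hu) x)
    (by fun_prop), hmap, withDensity_smul_measure, smul_smul,
    ← withDensity_smul _ (by fun_prop)]
  congr 1
  ext x
  simp [fstDensity, ENNReal.ofReal_mul (mul_nonneg hκ hd.le), ENNReal.ofReal_mul hκ]

lemma sndMeasure_eq_withDensity (s : Rescaling d) (hA : s.A.PosDef) (hγ : 0 < s.γ)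
    (hκ : 0 ≤ s.κ) {g : Pt d → ℝ} (hg : Measurable g) :
    s.sndMeasure (volume.withDensity fun x => ENNReal.ofReal (g x))
      = volume.withDensity fun x => ENNReal.ofReal (s.sndDensity g x) := by
  have hd : 0 < s.A.det := hA.det_pos
  have hu : IsUnit s.A.det := hd.ne'.isUnit
  have hD : 0 < s.γ ^ d * s.A.det := by positivity
  have hmap : (volume : Measure (Pt d)).map s.Q₂
      = ENNReal.ofReal (s.γ ^ d * s.A.det)⁻¹ • volume := by
    have hdet : LinearMap.det (s.γ • (Matrix.toEuclideanCLM (𝕜 := ℝ) s.A : Pt d →ₗ[ℝ] Pt d))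
        = s.γ ^ d * s.A.det := by
      rw [LinearMap.det_smul, det_toEuclideanCLM]; simp
    have h := Measure.map_linearMap_addHaar_eq_smul_addHaar (volume : Measure (Pt d))
      (f := s.γ • (Matrix.toEuclideanCLM (𝕜 := ℝ) s.A : Pt d →ₗ[ℝ] Pt d))
      (by rw [hdet]; exact hD.ne')
    rw [hdet, abs_of_pos (inv_pos.2 hD)] at h
    rw [← h]
    have h2 : s.Q₂ = (s.γ • (Matrix.toEuclideanCLM (𝕜 := ℝ) s.A : Pt d →ₗ[ℝ] Pt d))
        ∘ fun y => y - s.b := by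
      ext1 y; simp [Q₂]
    have h3 : Measurable (s.γ • (Matrix.toEuclideanCLM (𝕜 := ℝ) s.A : Pt d →ₗ[ℝ] Pt d)) :=
      (LinearMap.continuous_of_finiteDimensional _).measurable
    rw [h2, ← Measure.map_map h3 (by fun_prop), (measurePreserving_sub_right volume s.b).map_eq]
  rw [sndMeasure, map_withDensity_of_leftInverse
    (T' := fun y => s.γ⁻¹ • Matrix.toEuclideanCLM (𝕜 := ℝ) s.A⁻¹ y + s.b)
    s.measurable_Q₂ (by fun_prop)
    (fun x => by
      simp only [Q₂, map_smul]
      rw [toEuclideanCLM_cancel (Matrix.nonsing_inv_mul _ hu), smul_smul,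
        inv_mul_cancel₀ hγ.ne', one_smul, sub_add_cancel])
    (by fun_prop), hmap, withDensity_smul_measure, smul_smul,
    ← withDensity_smul _ (by fun_prop)]
  congr 1
  ext x
  simp only [sndDensity, Pi.smul_apply, smul_eq_mul]
  rw [ENNReal.ofReal_mul (by positivity), ENNReal.ofReal_mul hκ]

lemma plan_mem_couplings (s : Rescaling d) {lam mu : Measure (Pt d)}
    {p : Measure (Pt d × Pt d)} (hp : p ∈ couplings lam mu) :
    s.plan p ∈ couplings (s.fstMeasure lam) (s.sndMeasure mu) := by
  have h1 := s.measurable_Q₁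
  have h2 := s.measurable_Q₂
  obtain ⟨rfl, rfl⟩ := hp
  constructor
  · rw [plan, fstMeasure, Measure.map_smul, Measure.map_map (by fun_prop) (by fun_prop),
      Measure.map_map (by fun_prop) (by fun_prop)]
    rfl
  · rw [plan, sndMeasure, Measure.map_smul, Measure.map_map (by fun_prop) (by fun_prop),
      Measure.map_map (by fun_prop) (by fun_prop)]
    rfl

end Rescaling

end EntropicOT

end

/-! Minimality enters only through perturbations of bounded support that leave both marginals
unchanged (`LocMin`). In this form it survives affine rescaling: |x - y|² equals γ⁻¹ |Q₁x - Q₂y|²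
plus a function of x plus a function of y, and the last two integrate to zero against such a
perturbation (`LocMin.map`, `LocMin.rescale`). The rescaled plan itself may have infinite quadratic
cost, so global minimality would be the wrong notion to transport. Thus (2) is the estimate of (1)
for a local minimiser at scale √γ ε. A dilation by R, with mass divided by λ(0) R^d, reduces both to
R = 1 and densities between 1/2 and 2 (`quasiMinBound_ball`). The constant found there depends only
on d, θ and δ; the lower bounds on the densities enter only the smallness threshold.

At unit scale #_1 is covered by P_1 and two sets of long pairs, which start in B_1 and end outside
B_{11/4}, or conversely.

Long pairs. Moving mass from two pairs (x,y), (x',y') to (x,y'), (x',y) gives ρ(x,y) ρ(x',y') ≤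
ρ(x,y') ρ(x',y) exp(2⟨x-x', y-y'⟩/ε²) almost everywhere (`LocMin.exchange`). Small energy supplies
many short pairs (x',y') near the point at distance s from x in the direction of y, and for these
the exponent is at most -s|x-y|/ε². The exponential beats the factor |x-y|², and integration bounds
the cost of the long pairs by O(ε⁴), hence O(ε²), times a local mass (`lintegral_longSet_le`).

The set P_1. Given a coupling q of the marginals of the restricted plan, replace the restriction by
an approximation of q that is a multiple of a product measure on each product of two cubes of side ε
(`block`). This has almost the cost of q (`lintegral_cost_le`) and entropy at most log(ε^{-d}) times
its mass, plus lower order (`exists_block_density`). The entropy removed is bounded below by Gibbs'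
inequality against a heat kernel of width ε/√δ (`neg_entropy_pset_le`): this yields the same
multiple of log(ε^{-d}), up to |log δ| terms, and a transport term of weight δ/ε². In the comparison
(`LocMin.block_bound`) the logarithms of ε cancel and an error ε² times mass plus δ times cost
remains. -/

noncomputable section

namespace EntropicOT

/-! ### Measures with a real density -/

section Density

variable {X Y : Type*} [MeasurableSpace X] [MeasurableSpace Y]

/-- The measure with real density `a` with respect to `ν`. -/
def den (ν : Measure X) (a : X → ℝ) : Measure X :=
  ν.withDensity fun z => ENNReal.ofReal (a z)

lemma integral_den {ν : Measure X} {a : X → ℝ} (ha : Measurable a) (h0 : ∀ z, 0 ≤ a z)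
    (F : X → ℝ) : ∫ z, F z ∂(den ν a) = ∫ z, F z * a z ∂ν := by
  rw [den, integral_withDensity_eq_integral_toReal_smul (by fun_prop) (by simp)]
  simp [ENNReal.toReal_ofReal, h0, mul_comm]

lemma integrable_den {ν : Measure X} {a : X → ℝ} (ha : Measurable a) (h0 : ∀ z, 0 ≤ a z)
    (F : X → ℝ) : Integrable F (den ν a) ↔ Integrable (fun z => F z * a z) ν := by
  rw [den, integrable_withDensity_iff (by fun_prop) (by simp)]
  simp [ENNReal.toReal_ofReal, h0]

lemma den_add {ν : Measure X} {a b : X → ℝ} (ha : Measurable a) (h0 : ∀ z, 0 ≤ a z)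
    (h1 : ∀ z, 0 ≤ b z) : den ν (fun z => a z + b z) = den ν a + den ν b := by
  rw [den, den, den, ← withDensity_add_left (by fun_prop)]
  congr 1
  ext z
  simp [ENNReal.ofReal_add, h0, h1]

lemma integral_comp_den {ν : Measure X} {a : X → ℝ} (ha : Measurable a) (h0 : ∀ z, 0 ≤ a z)
    {T : X → Y} (hT : Measurable T) {F : Y → ℝ} (hF : Measurable F) :
    ∫ y, F y ∂((den ν a).map T) = ∫ z, F (T z) * a z ∂ν := by
  rw [integral_map hT.aemeasurable hF.aestronglyMeasurable, integral_den ha h0]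

end Density

/-- `ρ` is the density of a plan which minimises the entropic cost with squared scale `h`
among all plans that agree with it outside a bounded set. -/
structure LocMin {d : ℕ} (h : ℝ) (lam mu : Measure (Pt d)) (ρ : Pt d × Pt d → ℝ) : Prop where
  meas : Measurable ρ
  nonneg : ∀ z, 0 ≤ ρ z
  integrable : Integrable ρ (lam.prod mu)
  entropy : Integrable (fun z => ρ z * Real.log (ρ z)) (lam.prod mu)
  le : ∀ a b : Pt d × Pt d → ℝ, Measurable a → Measurable b → (∀ z, 0 ≤ a z) →
    (∀ z, a z ≤ ρ z) → (∀ z, 0 ≤ b z) → (∃ r : ℝ, ∀ z, r < ‖z‖ → a z = 0 ∧ b z = 0) →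
    Integrable b (lam.prod mu) →
    (den (lam.prod mu) a).map Prod.fst = (den (lam.prod mu) b).map Prod.fst →
    (den (lam.prod mu) a).map Prod.snd = (den (lam.prod mu) b).map Prod.snd →
    Integrable (fun z => (ρ z - a z + b z) * Real.log (ρ z - a z + b z)
      - ρ z * Real.log (ρ z)) (lam.prod mu) →
    0 ≤ ∫ z, ‖z.1 - z.2‖ ^ 2 * (b z - a z) ∂(lam.prod mu)
      + h * ∫ z, ((ρ z - a z + b z) * Real.log (ρ z - a z + b z)
        - ρ z * Real.log (ρ z)) ∂(lam.prod mu)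

section

variable {d : ℕ}

lemma integrable_mul_of_bounded_support {ν : Measure (Pt d × Pt d)} {b : Pt d × Pt d → ℝ}
    (hb : Integrable b ν) {r : ℝ} (hr : ∀ z, r < ‖z‖ → b z = 0) {F : Pt d × Pt d → ℝ}
    (hF : Continuous F) : Integrable (fun z => F z * b z) ν := by
  obtain ⟨C, hC⟩ := (isCompact_closedBall (0 : Pt d × Pt d) r).exists_bound_of_continuousOn
    hF.continuousOn
  refine Integrable.mono' (hb.norm.const_mul C)
    (hF.measurable.aestronglyMeasurable.mul hb.aestronglyMeasurable) (ae_of_all _ fun z => ?_)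
  rw [norm_mul]
  by_cases hz : r < ‖z‖
  · simp [hr z hz]
  · exact mul_le_mul_of_nonneg_right (hC z (by simpa using hz)) (norm_nonneg _)

lemma llr_den_ae {ν : Measure (Pt d × Pt d)} [IsFiniteMeasure ν] {σ : Pt d × Pt d → ℝ}
    (hσ : Measurable σ) (h0 : ∀ z, 0 ≤ σ z) :
    llr (den ν σ) ν =ᵐ[ν] fun z => Real.log (σ z) := by
  filter_upwards [Measure.rnDeriv_withDensity ν
    (f := fun z => ENNReal.ofReal (σ z)) (by fun_prop)] with z hz
  rw [llr, den, hz, ENNReal.toReal_ofReal (h0 z)]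

lemma den_absolutelyContinuous (ν : Measure (Pt d × Pt d)) (σ : Pt d × Pt d → ℝ) :
    den ν σ ≪ ν := withDensity_absolutelyContinuous _ _

lemma integral_llr_den {ν : Measure (Pt d × Pt d)} [IsFiniteMeasure ν] {σ : Pt d × Pt d → ℝ}
    (hσ : Measurable σ) (h0 : ∀ z, 0 ≤ σ z) :
    ∫ z, llr (den ν σ) ν z ∂(den ν σ) = ∫ z, σ z * Real.log (σ z) ∂ν := by
  rw [integral_congr_ae ((den_absolutelyContinuous ν σ).ae_le (llr_den_ae hσ h0)),
    integral_den hσ h0]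
  simp [mul_comm]

lemma integrable_llr_den {ν : Measure (Pt d × Pt d)} [IsFiniteMeasure ν] {σ : Pt d × Pt d → ℝ}
    (hσ : Measurable σ) (h0 : ∀ z, 0 ≤ σ z) :
    Integrable (llr (den ν σ) ν) (den ν σ) ↔ Integrable (fun z => σ z * Real.log (σ z)) ν := by
  rw [integrable_congr ((den_absolutelyContinuous ν σ).ae_le (llr_den_ae hσ h0)),
    integrable_den hσ h0]
  simp [mul_comm]

/-- Test minimality with ρ - a + b. Both parts of the cost differ from those of ρ by integrable
quantities, so the global comparison reduces to one between differences, which no longer mentions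
the total cost. -/
lemma IsEntropicMinimiser.exists_locMin {ε : ℝ} {lam mu : Measure (Pt d)} [IsFiniteMeasure lam]
    [IsFiniteMeasure mu] {p : Measure (Pt d × Pt d)} (hp : IsEntropicMinimiser ε lam mu p) :
    ∃ ρ, LocMin (ε ^ 2) lam mu ρ ∧ p = den (lam.prod mu) ρ := by
  have hpfin : IsFiniteMeasure p := by
    constructor
    have h1 : p univ = lam univ := by
      rw [← hp.mem.1, Measure.map_apply measurable_fst MeasurableSet.univ, preimage_univ]
    rw [h1]
    exact measure_lt_top _ _
  set ν := lam.prod mu with hν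
  set ρ : Pt d × Pt d → ℝ := fun z => (p.rnDeriv ν z).toReal with hρ
  have hm : Measurable ρ := (Measure.measurable_rnDeriv p ν).ennreal_toReal
  have h0 : ∀ z, 0 ≤ ρ z := fun z => ENNReal.toReal_nonneg
  have hpρ : p = den ν ρ := by
    rw [den]
    conv_lhs => rw [← Measure.withDensity_rnDeriv_eq p ν hp.finite.ac]
    refine withDensity_congr_ae ?_
    filter_upwards [Measure.rnDeriv_lt_top p ν] with z hz
    rw [ENNReal.ofReal_toReal hz.ne]
  have hρint : Integrable ρ ν := Measure.integrable_toReal_rnDeriv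
  have hent : Integrable (fun z => ρ z * Real.log (ρ z)) ν := by
    rw [← integrable_llr_den hm h0, ← hpρ]
    exact hp.finite.entropy
  have hquad : Integrable (fun z => ‖z.1 - z.2‖ ^ 2 * ρ z) ν := by
    rw [← integrable_den hm h0 (fun z => ‖z.1 - z.2‖ ^ 2), ← hpρ]
    exact hp.finite.quad
  refine ⟨ρ, ⟨hm, h0, hρint, hent, ?_⟩, hpρ⟩
  rintro a b ha hb ha0 haρ hb0 ⟨r, hr⟩ hbint hfst hsnd hφ
  have haint : Integrable a ν := hρint.mono' ha.aestronglyMeasurable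
    (ae_of_all _ fun z => by rw [Real.norm_of_nonneg (ha0 z)]; exact haρ z)
  set σ : Pt d × Pt d → ℝ := fun z => ρ z - a z + b z with hσ
  have hσm : Measurable σ := by fun_prop
  have hσ0 : ∀ z, 0 ≤ σ z := fun z => by
    have := haρ z; have := hb0 z; simp only [hσ]; linarith
  have hra0 : ∀ z, 0 ≤ ρ z - a z := fun z => sub_nonneg.2 (haρ z)
  have hdσ : den ν σ = den ν (fun z => ρ z - a z) + den ν b := den_add (by fun_prop) hra0 hb0
  have hdρ : den ν ρ = den ν (fun z => ρ z - a z) + den ν a := by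
    rw [← den_add (by fun_prop) hra0 ha0]
    congr 1; ext z; ring
  have hmarg : ∀ T : Pt d × Pt d → Pt d, Measurable T →
      (den ν a).map T = (den ν b).map T → (den ν σ).map T = p.map T := by
    intro T hT h
    rw [hpρ, hdσ, hdρ, Measure.map_add _ _ hT, Measure.map_add _ _ hT, h]
  have hcab : Integrable (fun z : Pt d × Pt d => ‖z.1 - z.2‖ ^ 2 * (b z - a z)) ν :=
    integrable_mul_of_bounded_support (r := r) (hbint.sub haint)
      (fun z hz => by simp [(hr z hz).1, (hr z hz).2]) (by fun_prop)
  have hcσ : Integrable (fun z => ‖z.1 - z.2‖ ^ 2 * σ z) ν := by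
    refine (hquad.add hcab).congr (ae_of_all _ fun z => ?_)
    simp only [Pi.add_apply, hσ]; ring
  have hφσ : Integrable (fun z => σ z * Real.log (σ z)) ν := by
    refine (hφ.add hent).congr (ae_of_all _ fun z => ?_)
    simp only [Pi.add_apply, hσ]; ring
  have hcost := hp.le (den ν σ)
    ⟨(hmarg _ measurable_fst hfst).trans hp.mem.1, (hmarg _ measurable_snd hsnd).trans hp.mem.2⟩
    ⟨den_absolutelyContinuous _ _, (integrable_den hσm hσ0 _).2 hcσ,
      (integrable_llr_den hσm hσ0).2 hφσ⟩
  simp only [entropicCost] at hcost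
  rw [← hν, integral_den hσm hσ0, integral_llr_den hσm hσ0, hpρ, integral_den hm h0,
    integral_llr_den hm h0] at hcost
  have e1 : ∫ z, ‖z.1 - z.2‖ ^ 2 * (b z - a z) ∂ν
      = ∫ z, ‖z.1 - z.2‖ ^ 2 * σ z ∂ν - ∫ z, ‖z.1 - z.2‖ ^ 2 * ρ z ∂ν := by
    rw [← integral_sub hcσ hquad]
    congr 1; ext z; simp only [hσ]; ring
  rw [e1, integral_sub hφσ hent]
  linarith

end

/-! ### Local minimality under changes of variables -/

section Transform

variable {d : ℕ}

lemma withDensity_map_measurableEquiv {X Y : Type*} [MeasurableSpace X] [MeasurableSpace Y]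
    (ν : Measure X) (E : X ≃ᵐ Y) (F : Y → ℝ≥0∞) :
    (ν.map E).withDensity F = (ν.withDensity (F ∘ E)).map E := by
  ext S hS
  rw [withDensity_apply _ hS, E.map_apply, withDensity_apply _ (E.measurable hS),
    E.restrict_map, lintegral_map_equiv]
  rfl

lemma prod_smul_map (lam mu : Measure (Pt d)) [IsFiniteMeasure lam] [IsFiniteMeasure mu]
    (e₁ e₂ : Pt d ≃ₜ Pt d) {κ : ℝ} (hκ : 0 < κ) :
    (ENNReal.ofReal κ • lam.map e₁).prod (ENNReal.ofReal κ • mu.map e₂)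
      = ENNReal.ofReal (κ ^ 2) • (lam.prod mu).map (e₁.prodCongr e₂).toMeasurableEquiv := by
  have : (⇑(e₁.prodCongr e₂).toMeasurableEquiv : Pt d × Pt d → Pt d × Pt d)
      = Prod.map e₁ e₂ := rfl
  rw [this, ← Measure.map_prod_map _ _ e₁.measurable e₂.measurable, Measure.prod_smul_left,
    Measure.prod_smul_right, smul_smul, ← ENNReal.ofReal_mul hκ.le, sq]

/-- The reference product measure scales by κ² and the plan by κ only, whence the factor κ⁻¹ in the
density. -/
lemma den_smul_map (ν : Measure (Pt d × Pt d)) (E : Pt d × Pt d ≃ᵐ Pt d × Pt d) {κ : ℝ}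
    (hκ : 0 < κ) {a : Pt d × Pt d → ℝ} (ha : Measurable a) :
    den (ENNReal.ofReal (κ ^ 2) • ν.map E) (fun z => κ⁻¹ * a (E.symm z))
      = ENNReal.ofReal κ • (den ν a).map E := by
  have h1 : (fun z => ENNReal.ofReal (κ⁻¹ * a (E.symm z)))
      = ENNReal.ofReal κ⁻¹ • fun z => ENNReal.ofReal (a (E.symm z)) := by
    ext z
    simp [ENNReal.ofReal_mul (inv_nonneg.2 hκ.le)]
  have h2 : (fun z => ENNReal.ofReal (a (E.symm z))) ∘ E = fun z => ENNReal.ofReal (a z) := by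
    funext z
    simp
  have h3 : κ ^ 2 * κ⁻¹ = κ := by field_simp
  rw [den, withDensity_smul_measure, h1, withDensity_smul _ (by fun_prop), smul_smul,
    ← ENNReal.ofReal_mul (by positivity), withDensity_map_measurableEquiv, den, h2, h3]

/-- The terms U(x) and V(y) integrate to zero against b - a because the marginals agree, and the
bounded support makes these integrals finite. The factor κ⁻¹ changes t log t only by a multiple of
t, which disappears because the masses agree. -/
lemma LocMin.map {h : ℝ} {lam mu : Measure (Pt d)} [IsFiniteMeasure lam] [IsFiniteMeasure mu]
    {ρ : Pt d × Pt d → ℝ} (H : LocMin h lam mu ρ) (e₁ e₂ : Pt d ≃ₜ Pt d) {κ τ : ℝ}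
    (hκ : 0 < κ) (hτ : 0 < τ) {U V : Pt d → ℝ} (hU : Continuous U) (hV : Continuous V)
    (hc : ∀ x y, ‖x - y‖ ^ 2 = τ * ‖e₁ x - e₂ y‖ ^ 2 + U x + V y) :
    LocMin (h / τ) (ENNReal.ofReal κ • lam.map e₁) (ENNReal.ofReal κ • mu.map e₂)
      (fun z => κ⁻¹ * ρ (e₁.symm z.1, e₂.symm z.2)) := by
  set E := (e₁.prodCongr e₂).toMeasurableEquiv with hE
  set ν := lam.prod mu with hν
  have hEcont : Continuous E := (e₁.prodCongr e₂).continuous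
  have hEscont : Continuous E.symm := (e₁.prodCongr e₂).symm.continuous
  have hEs : ∀ z, (e₁.symm z.1, e₂.symm z.2) = E.symm z := fun z => rfl
  have hν' := prod_smul_map lam mu e₁ e₂ hκ
  rw [← hE, ← hν] at hν'
  have hint : ∀ G : Pt d × Pt d → ℝ,
      ∫ z, G z ∂(ENNReal.ofReal (κ ^ 2) • ν.map E) = κ ^ 2 * ∫ z, G (E z) ∂ν := by
    intro G
    rw [integral_smul_measure, integral_map_equiv, ENNReal.toReal_ofReal (by positivity),
      smul_eq_mul]
  have hintble : ∀ G : Pt d × Pt d → ℝ,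
      Integrable G (ENNReal.ofReal (κ ^ 2) • ν.map E) ↔ Integrable (fun z => G (E z)) ν := by
    intro G
    rw [integrable_smul_measure (by simpa using by positivity) (by simp), integrable_map_equiv]
    rfl
  have hφ : ∀ u : ℝ, 0 ≤ u → (κ⁻¹ * u) * Real.log (κ⁻¹ * u)
      = κ⁻¹ * (u * Real.log u) - κ⁻¹ * Real.log κ * u := by
    intro u hu
    rcases hu.eq_or_lt with rfl | hu
    · simp
    · rw [Real.log_mul (by positivity) hu.ne', Real.log_inv]; ring
  simp only [hEs]
  refine ⟨?_, ?_, ?_, ?_, ?_⟩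
  · exact measurable_const.mul (H.meas.comp E.symm.measurable)
  · exact fun z => mul_nonneg (by positivity) (H.nonneg _)
  · rw [hν', hintble]
    simpa using H.integrable.const_mul κ⁻¹
  · rw [hν', hintble]
    refine ((H.entropy.const_mul κ⁻¹).sub (H.integrable.const_mul (κ⁻¹ * Real.log κ))).congr
      (ae_of_all _ fun z => ?_)
    simp [hφ _ (H.nonneg z)]
  rw [hν']
  rintro a b ha hb ha0 haρ hb0 ⟨r, hr⟩ hbint hfst hsnd hent
  rw [hintble] at hbint hent
  have hEm : Measurable E := E.measurable
  have hρa : ∀ z, κ * a (E z) ≤ ρ z := fun z => by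
    have := haρ (E z)
    rw [E.symm_apply_apply] at this
    calc κ * a (E z) ≤ κ * (κ⁻¹ * ρ z) := by gcongr
      _ = ρ z := by field_simp
  -- Bounded support is preserved: the inverse homeomorphism is bounded on compact balls.
  obtain ⟨r', hr'⟩ : ∃ r' : ℝ, ∀ z, r' < ‖z‖ → r < ‖E z‖ := by
    obtain ⟨C, hC⟩ := (isCompact_closedBall (0 : Pt d × Pt d) r).exists_bound_of_continuousOn
      hEscont.continuousOn
    refine ⟨C, fun z hz => ?_⟩
    by_contra! hcon
    have := hC (E z) (by simpa using hcon)
    rw [E.symm_apply_apply] at this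
    linarith
  have hden : ∀ a : Pt d × Pt d → ℝ, Measurable a →
      ENNReal.ofReal κ • (den ν fun z => κ * a (E z)).map E
        = den (ENNReal.ofReal (κ ^ 2) • ν.map E) a := by
    intro a ha
    rw [← den_smul_map ν E hκ (by fun_prop)]
    congr 1
    ext z
    simp [hκ.ne']
  have hmarg : ∀ (T : Pt d × Pt d → Pt d) (e : Pt d ≃ₜ Pt d), Measurable T →
      (∀ z, T z = e.symm (T (E z))) →
      (den (ENNReal.ofReal (κ ^ 2) • ν.map E) a).map T
        = (den (ENNReal.ofReal (κ ^ 2) • ν.map E) b).map T →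
      (den ν fun z => κ * a (E z)).map T = (den ν fun z => κ * b (E z)).map T := by
    intro T e hT hTe hab
    have key : ∀ a : Pt d × Pt d → ℝ, Measurable a → (den ν fun z => κ * a (E z)).map T
        = (ENNReal.ofReal κ)⁻¹ • ((den (ENNReal.ofReal (κ ^ 2) • ν.map E) a).map T).map e.symm := by
      intro a ha
      rw [← hden a ha, Measure.map_smul, Measure.map_smul, smul_smul,
        ENNReal.inv_mul_cancel (by simpa using hκ) (by simp), one_smul,
        Measure.map_map hT hEm, Measure.map_map e.symm.measurable (hT.comp hEm)]
      congr 1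
      ext1 z
      exact hTe z
    rw [key a ha, key b hb, hab]
  have hf := hmarg Prod.fst e₁ measurable_fst (fun z => by simp [hE]) hfst
  have hs := hmarg Prod.snd e₂ measurable_snd (fun z => by simp [hE]) hsnd
  have hb0' : ∀ z, 0 ≤ κ * b (E z) := fun z => mul_nonneg hκ.le (hb0 _)
  have ha0' : ∀ z, 0 ≤ κ * a (E z) := fun z => mul_nonneg hκ.le (ha0 _)
  have hbi : Integrable (fun z => κ * b (E z)) ν := hbint.const_mul κ
  have hai : Integrable (fun z => κ * a (E z)) ν :=
    H.integrable.mono' (measurable_const.mul (ha.comp hEm)).aestronglyMeasurable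
      (ae_of_all _ fun z => by rw [Real.norm_of_nonneg (ha0' z)]; exact hρa z)
  have hsupp : ∀ z, r' < ‖z‖ → κ * a (E z) = 0 ∧ κ * b (E z) = 0 := fun z hz => by
    simp [(hr _ (hr' z hz)).1, (hr _ (hr' z hz)).2]
  have hzero : ∀ (T : Pt d × Pt d → Pt d) (F : Pt d → ℝ), Continuous T → Continuous F →
      (den ν fun z => κ * a (E z)).map T = (den ν fun z => κ * b (E z)).map T →
      ∫ z, F (T z) * (κ * b (E z) - κ * a (E z)) ∂ν = 0 := by
    intro T F hT hF hab
    have hFT : Continuous fun z => F (T z) := by fun_prop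
    have h1 := integral_comp_den (ν := ν) (a := fun z => κ * a (E z)) (by fun_prop) ha0'
      hT.measurable hF.measurable
    have h2 := integral_comp_den (ν := ν) (a := fun z => κ * b (E z)) (by fun_prop) hb0'
      hT.measurable hF.measurable
    simp_rw [mul_sub (F _)]
    rw [integral_sub (integrable_mul_of_bounded_support hbi (fun z hz => (hsupp z hz).2) hFT)
      (integrable_mul_of_bounded_support hai (fun z hz => (hsupp z hz).1) hFT), ← h1, ← h2, hab,
      sub_self]
  -- Pulling κ out of the logarithm leaves log κ times the perturbation, whose integral is zero by
  -- `hmass`.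
  have hφ2 : ∀ z, (ρ z - κ * a (E z) + κ * b (E z)) * Real.log (ρ z - κ * a (E z) + κ * b (E z))
        - ρ z * Real.log (ρ z)
      = κ * ((κ⁻¹ * ρ z - a (E z) + b (E z)) * Real.log (κ⁻¹ * ρ z - a (E z) + b (E z))
        - κ⁻¹ * ρ z * Real.log (κ⁻¹ * ρ z)) + Real.log κ * (κ * b (E z) - κ * a (E z)) := by
    intro z
    have e : κ⁻¹ * ρ z - a (E z) + b (E z) = κ⁻¹ * (ρ z - κ * a (E z) + κ * b (E z)) := by
      field_simp
    rw [e, hφ _ (H.nonneg z), hφ _ (by linarith [hρa z, hb0' z])]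
    field_simp
    ring
  have hent' : Integrable (fun z => (κ⁻¹ * ρ z - a (E z) + b (E z))
      * Real.log (κ⁻¹ * ρ z - a (E z) + b (E z))
        - κ⁻¹ * ρ z * Real.log (κ⁻¹ * ρ z)) ν := by
    simpa using hent
  have hmass : ∫ z, (κ * b (E z) - κ * a (E z)) ∂ν = 0 := by
    simpa using hzero Prod.fst (fun _ => 1) continuous_fst continuous_const hf
  have hdab : Integrable (fun z => κ * b (E z) - κ * a (E z)) ν := hbi.sub hai
  have main := H.le (fun z => κ * a (E z)) (fun z => κ * b (E z)) (by fun_prop) (by fun_prop)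
    ha0' hρa hb0' ⟨r', hsupp⟩ hbi hf hs (by
      simp_rw [hφ2]
      exact (hent'.const_mul κ).add (hdab.const_mul _))
  simp_rw [hφ2] at main
  rw [← hν, integral_add (hent'.const_mul κ) (hdab.const_mul _), integral_const_mul,
    integral_const_mul, hmass, mul_zero, add_zero] at main
  have hcost : ∫ z, ‖z.1 - z.2‖ ^ 2 * (κ * b (E z) - κ * a (E z)) ∂ν
      = τ * κ * ∫ z, ‖(E z).1 - (E z).2‖ ^ 2 * (b (E z) - a (E z)) ∂ν := by
    have e : ∀ z : Pt d × Pt d, ‖z.1 - z.2‖ ^ 2 * (κ * b (E z) - κ * a (E z))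
        = τ * κ * (‖(E z).1 - (E z).2‖ ^ 2 * (b (E z) - a (E z)))
          + U z.1 * (κ * b (E z) - κ * a (E z)) + V z.2 * (κ * b (E z) - κ * a (E z)) := by
      intro z
      have hE1 : (E z).1 = e₁ z.1 := rfl
      have hE2 : (E z).2 = e₂ z.2 := rfl
      rw [hc, hE1, hE2]; ring
    have hi : ∀ F : Pt d × Pt d → ℝ, Continuous F →
        Integrable (fun z => F z * (κ * b (E z) - κ * a (E z))) ν := fun F hF =>
      integrable_mul_of_bounded_support (r := r') (hbi.sub hai)
        (fun z hz => by simp only [Pi.sub_apply]; rw [(hsupp z hz).1, (hsupp z hz).2, sub_zero]) hF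
    have hi0 : Integrable (fun z => τ * κ * (‖(E z).1 - (E z).2‖ ^ 2 * (b (E z) - a (E z)))) ν := by
      refine ((hi (fun z => ‖(E z).1 - (E z).2‖ ^ 2) (by fun_prop)).const_mul τ).congr
        (ae_of_all _ fun z => ?_)
      ring
    simp_rw [e]
    have hiU := hi (fun z => U z.1) (by fun_prop)
    have hiV := hi (fun z => V z.2) (by fun_prop)
    have hi0U : Integrable (fun z => τ * κ * (‖(E z).1 - (E z).2‖ ^ 2 * (b (E z) - a (E z)))
        + U z.1 * (κ * b (E z) - κ * a (E z))) ν := hi0.add hiU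
    rw [integral_add hi0U hiV, integral_add hi0 hiU,
      hzero Prod.fst U continuous_fst hU hf, hzero Prod.snd V continuous_snd hV hs,
      integral_const_mul, add_zero, add_zero]
  rw [hcost] at main
  rw [hint, hint]
  simp only [E.symm_apply_apply]
  set I := ∫ z, ‖(E z).1 - (E z).2‖ ^ 2 * (b (E z) - a (E z)) ∂ν
  set J := ∫ z, ((κ⁻¹ * ρ z - a (E z) + b (E z)) * Real.log (κ⁻¹ * ρ z - a (E z) + b (E z))
        - κ⁻¹ * ρ z * Real.log (κ⁻¹ * ρ z)) ∂ν
  have : κ ^ 2 * I + h / τ * (κ ^ 2 * J) = (τ * κ * I + h * (κ * J)) * (κ / τ) := by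
    field_simp
  rw [this]
  exact mul_nonneg main (by positivity)

end Transform

/-! ### The exchange inequality -/

/-- The graph of the convex function t log t lies above its tangent at v. -/
lemma mul_log_sub_mul_log_le {u v : ℝ} (hu : 0 ≤ u) (hv : 0 < v) :
    v * Real.log v - u * Real.log u ≤ (v - u) * (Real.log v + 1) := by
  rcases hu.eq_or_lt with rfl | hu
  · simp; nlinarith
  · have h := Real.log_le_sub_one_of_pos (div_pos hv hu)
    rw [Real.log_div hv.ne' hu.ne'] at h
    have h2 := mul_le_mul_of_nonneg_left h hu.le
    have h3 : u * (v / u - 1) = v - u := by field_simp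
    rw [h3] at h2
    linarith

section Exchange

variable {d : ℕ}

/-- Exchange the second points of two pairs. -/
def exch (w : (Pt d × Pt d) × (Pt d × Pt d)) : (Pt d × Pt d) × (Pt d × Pt d) :=
  ((w.1.1, w.2.2), (w.2.1, w.1.2))

@[fun_prop]
lemma measurable_exch : Measurable (exch (d := d)) := by unfold exch; fun_prop

/-- The four coordinates are independent, so interchanging the two y-variables is a matter of
Fubini. -/
lemma lintegral_exch (lam mu : Measure (Pt d)) [IsFiniteMeasure lam] [IsFiniteMeasure mu]
    {F : (Pt d × Pt d) × (Pt d × Pt d) → ℝ≥0∞} (hF : Measurable F) :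
    ∫⁻ w, F (exch w) ∂((lam.prod mu).prod (lam.prod mu))
      = ∫⁻ w, F w ∂((lam.prod mu).prod (lam.prod mu)) := by
  have expand : ∀ G : (Pt d × Pt d) × (Pt d × Pt d) → ℝ≥0∞, Measurable G →
      ∫⁻ w, G w ∂((lam.prod mu).prod (lam.prod mu))
        = ∫⁻ x, ∫⁻ y, ∫⁻ x', ∫⁻ y', G ((x, y), (x', y')) ∂mu ∂lam ∂mu ∂lam := by
    intro G hG
    rw [lintegral_prod _ hG.aemeasurable,
      lintegral_prod _ (Measurable.lintegral_prod_right' hG).aemeasurable]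
    refine lintegral_congr fun x => lintegral_congr fun y => ?_
    rw [lintegral_prod _ (by fun_prop)]
  rw [expand (fun w => F (exch w)) (hF.comp measurable_exch), expand _ hF]
  refine lintegral_congr fun x => ?_
  simp only [exch]
  have m3 : ∀ f : (Pt d × Pt d) × Pt d → ℝ≥0∞, Measurable f →
      Measurable fun q : Pt d × Pt d => ∫⁻ y, f (q, y) ∂mu := fun f hf =>
    Measurable.lintegral_prod_right' hf
  have L := lintegral_lintegral_swap (μ := mu) (ν := lam)
    (f := fun y x' => ∫⁻ y', F ((x, y'), (x', y)) ∂mu)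
    (m3 (fun q => F ((x, q.2), (q.1.2, q.1.1))) (by fun_prop)).aemeasurable
  have R := lintegral_lintegral_swap (μ := mu) (ν := lam)
    (f := fun y x' => ∫⁻ y', F ((x, y), (x', y')) ∂mu)
    (m3 (fun q => F ((x, q.1.1), (q.1.2, q.2))) (by fun_prop)).aemeasurable
  rw [L, R]
  refine lintegral_congr fun x' => ?_
  rw [lintegral_lintegral_swap (by fun_prop)]

lemma measurePreserving_exch (lam mu : Measure (Pt d)) [IsFiniteMeasure lam] [IsFiniteMeasure mu] :
    MeasurePreserving (exch (d := d)) ((lam.prod mu).prod (lam.prod mu))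
      ((lam.prod mu).prod (lam.prod mu)) := by
  refine ⟨measurable_exch, Measure.ext_of_lintegral _ fun F hF => ?_⟩
  rw [lintegral_map hF measurable_exch, lintegral_exch lam mu hF]

/-- The sum of the measures of the two sections of `V` at `z`. -/
def secSum (ν : Measure (Pt d × Pt d)) (V : Set ((Pt d × Pt d) × (Pt d × Pt d)))
    (z : Pt d × Pt d) : ℝ :=
  ν.real (Prod.mk z ⁻¹' V) + ν.real ((fun z' => (z', z)) ⁻¹' V)

variable {ν : Measure (Pt d × Pt d)}
  {V : Set ((Pt d × Pt d) × (Pt d × Pt d))}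

lemma secSum_nonneg (z : Pt d × Pt d) : 0 ≤ secSum ν V z := by
  unfold secSum; positivity

lemma secSum_le [IsFiniteMeasure ν] (z : Pt d × Pt d) : secSum ν V z ≤ 2 * ν.real univ := by
  have h1 : ν.real (Prod.mk z ⁻¹' V) ≤ ν.real univ := measureReal_mono (subset_univ _)
  have h2 : ν.real ((fun z' => (z', z)) ⁻¹' V) ≤ ν.real univ := measureReal_mono (subset_univ _)
  unfold secSum; linarith

lemma measurable_secSum [IsFiniteMeasure ν] (hV : MeasurableSet V) : Measurable (secSum ν V) :=
  (measurable_measure_prodMk_left hV).ennreal_toReal.add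
    (measurable_measure_prodMk_right hV).ennreal_toReal

lemma secSum_eq_zero {z : Pt d × Pt d} (h1 : ∀ z', (z, z') ∉ V) (h2 : ∀ z', (z', z) ∉ V) :
    secSum ν V z = 0 := by
  have e1 : Prod.mk z ⁻¹' V = ∅ := by ext z'; simpa using h1 z'
  have e2 : (fun z' => (z', z)) ⁻¹' V = ∅ := by ext z'; simpa using h2 z'
  simp [secSum, e1, e2]

/-- By Fubini the section measures are densities of the two projections of ν ⊗ ν restricted to V. A
set of pairs of points thus produces both the density to be removed and, through `exch`, the density
to be added. -/
lemma den_secSum [IsFiniteMeasure ν] (hV : MeasurableSet V) :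
    den ν (secSum ν V)
      = ((ν.prod ν).restrict V).map Prod.fst + ((ν.prod ν).restrict V).map Prod.snd := by
  have h := den_add (ν := ν) (a := fun z => ν.real (Prod.mk z ⁻¹' V))
    (b := fun z => ν.real ((fun z' => (z', z)) ⁻¹' V))
    (measurable_measure_prodMk_left hV).ennreal_toReal
    (fun z => measureReal_nonneg) (fun z => measureReal_nonneg)
  refine h.trans ?_
  congr 1
  · ext S hS
    rw [den, withDensity_apply _ hS, Measure.map_apply measurable_fst hS,
      Measure.restrict_apply (measurable_fst hS),
      Measure.prod_apply ((measurable_fst hS).inter hV), ← lintegral_indicator hS]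
    refine lintegral_congr fun z => ?_
    by_cases hz : z ∈ S
    · rw [indicator_of_mem hz, ofReal_measureReal]
      congr 1; ext z'; simp [hz]
    · simp only [hz, not_false_eq_true, indicator_of_notMem]
      rw [eq_comm, measure_eq_zero_iff_ae_notMem]
      simp [hz]
  · ext S hS
    rw [den, withDensity_apply _ hS, Measure.map_apply measurable_snd hS,
      Measure.restrict_apply (measurable_snd hS),
      Measure.prod_apply_symm ((measurable_snd hS).inter hV), ← lintegral_indicator hS]
    refine lintegral_congr fun z => ?_
    by_cases hz : z ∈ S
    · rw [indicator_of_mem hz, ofReal_measureReal]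
      congr 1; ext z'; simp [hz]
    · simp only [hz, not_false_eq_true, indicator_of_notMem]
      rw [eq_comm, measure_eq_zero_iff_ae_notMem]
      simp [hz]

lemma den_const_mul {X : Type*} [MeasurableSpace X] (ν : Measure X) {t : ℝ} (ht : 0 ≤ t)
    {a : X → ℝ} (ha : Measurable a) :
    den ν (fun z => t * a z) = ENNReal.ofReal t • den ν a := by
  rw [den, den, ← withDensity_smul _ (by fun_prop)]
  congr 1
  ext z
  simp [ENNReal.ofReal_mul ht]

/-- Otherwise moving a little mass from the pairs in this set to their exchanges would keep the
marginals and lower the cost. The shifts by τ in `Gp` and `Gm` dominate the change of the logarithm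
along the perturbation; the bounds by n give bounded support and integrability. -/
lemma LocMin.exchange_null {h : ℝ} (hh : 0 < h) {lam mu : Measure (Pt d)} [IsFiniteMeasure lam]
    [IsFiniteMeasure mu] {ρ : Pt d × Pt d → ℝ} (H : LocMin h lam mu ρ) {τ : ℝ} (hτ : 0 < τ)
    (n : ℝ) (Gp Gm : Pt d × Pt d → ℝ)
    (hGp : Gp = fun z => ‖z.1 - z.2‖ ^ 2 + h * (Real.log (ρ z + τ) + 1))
    (hGm : Gm = fun z => ‖z.1 - z.2‖ ^ 2 + h * (Real.log (ρ z - τ) + 1)) :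
    ((lam.prod mu).prod (lam.prod mu))
      {w | ‖w‖ ≤ n ∧ 2 * τ < ρ w.1 ∧ 2 * τ < ρ w.2 ∧ ρ w.1 ≤ n ∧ ρ w.2 ≤ n ∧ ρ (exch w).1 ≤ n ∧
        ρ (exch w).2 ≤ n ∧ Gp (exch w).1 + Gp (exch w).2 - Gm w.1 - Gm w.2 < 0} = 0 := by
  set ν := lam.prod mu with hν
  have hρ := H.meas
  have hGpm : Measurable Gp := by rw [hGp]; fun_prop
  have hGmm : Measurable Gm := by rw [hGm]; fun_prop
  set V := {w : (Pt d × Pt d) × (Pt d × Pt d) | ‖w‖ ≤ n ∧ 2 * τ < ρ w.1 ∧ 2 * τ < ρ w.2 ∧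
    ρ w.1 ≤ n ∧ ρ w.2 ≤ n ∧ ρ (exch w).1 ≤ n ∧
        ρ (exch w).2 ≤ n ∧ Gp (exch w).1 + Gp (exch w).2 - Gm w.1 - Gm w.2 < 0} with hVdef
  have hV : MeasurableSet V := by
    rw [hVdef]
    simp only [ofPred_and]
    refine MeasurableSet.inter ?_ (MeasurableSet.inter ?_ (MeasurableSet.inter ?_
      (MeasurableSet.inter ?_ (MeasurableSet.inter ?_ (MeasurableSet.inter ?_
      (MeasurableSet.inter ?_ ?_))))))
    · exact measurableSet_le (by fun_prop) (by fun_prop)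
    · exact measurableSet_lt (by fun_prop) (by fun_prop)
    · exact measurableSet_lt (by fun_prop) (by fun_prop)
    · exact measurableSet_le (by fun_prop) (by fun_prop)
    · exact measurableSet_le (by fun_prop) (by fun_prop)
    · exact measurableSet_le (by fun_prop) (by fun_prop)
    · exact measurableSet_le (by fun_prop) (by fun_prop)
    · exact measurableSet_lt (by fun_prop) (by fun_prop)
  have hV' : MeasurableSet (exch ⁻¹' V) := measurable_exch hV
  set m := (ν.prod ν).restrict V with hm
  set a := secSum ν V with ha
  set b := secSum ν (exch ⁻¹' V) with hb
  have ham : Measurable a := measurable_secSum hV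
  have hbm : Measurable b := measurable_secSum hV'
  have ha0 : ∀ z, 0 ≤ a z := fun z => secSum_nonneg z
  have hb0 : ∀ z, 0 ≤ b z := fun z => secSum_nonneg z
  set B : ℝ := 2 * ν.real univ + 1 with hB
  have hBpos : 0 < B := by positivity
  have haB : ∀ z, a z ≤ B := fun z => (secSum_le z).trans (by rw [hB]; linarith)
  have hbB : ∀ z, b z ≤ B := fun z => (secSum_le z).trans (by rw [hB]; linarith)
  -- B bounds both section sums, so with this t the density changes by at most τ in either
  -- direction.
  obtain ⟨t, ht, htB⟩ : ∃ t : ℝ, 0 < t ∧ t * B = τ := ⟨τ / B, by positivity, by field_simp⟩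
  have hta : ∀ z, t * a z ≤ τ := fun z => by rw [← htB]; gcongr; exact haB z
  have htb : ∀ z, t * b z ≤ τ := fun z => by rw [← htB]; gcongr; exact hbB z
  have hdena : den ν a = m.map Prod.fst + m.map Prod.snd := den_secSum hV
  have hdenb : den ν b = m.map (fun w => (exch w).1) + m.map (fun w => (exch w).2) := by
    rw [hb, den_secSum hV']
    have : (ν.prod ν).restrict (exch ⁻¹' V) = m.map exch := by
      have := (measurePreserving_exch lam mu).restrict_preimage (s := exch ⁻¹' V) hV'
      exact this.map_eq.symm
    rw [this, Measure.map_map measurable_fst measurable_exch,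
      Measure.map_map measurable_snd measurable_exch]
    rfl
  -- where the competitor differs from `ρ`
  have hapos : ∀ z, a z ≠ 0 → ‖z‖ ≤ n ∧ 2 * τ < ρ z ∧ ρ z ≤ n := by
    intro z hz
    by_contra hcon
    refine hz (secSum_eq_zero (fun z' hzV => hcon ?_) (fun z' hzV => hcon ?_))
    · exact ⟨(norm_fst_le (z, z')).trans hzV.1, hzV.2.1, hzV.2.2.2.1⟩
    · exact ⟨(norm_snd_le (z', z)).trans hzV.1, hzV.2.2.1, hzV.2.2.2.2.1⟩
  have hbpos : ∀ z, b z ≠ 0 → ‖z‖ ≤ n ∧ ρ z ≤ n := by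
    intro z hz
    by_contra hcon
    have hnorm : ∀ w : (Pt d × Pt d) × (Pt d × Pt d), ‖w‖ ≤ ‖exch w‖ := fun w => by
      simp only [exch, Prod.norm_def]
      refine sup_le (sup_le ?_ ?_) (sup_le ?_ ?_) <;> simp
    refine hz (secSum_eq_zero (fun z' hzV => hcon ?_) (fun z' hzV => hcon ?_))
    · exact ⟨(norm_fst_le (z, z')).trans ((hnorm _).trans hzV.1), hzV.2.2.2.2.2.1⟩
    · exact ⟨(norm_snd_le (z', z)).trans ((hnorm _).trans hzV.1), hzV.2.2.2.2.2.2.1⟩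
  have haρ : ∀ z, t * a z ≤ ρ z := fun z => by
    by_cases hz : a z = 0
    · simpa [hz] using H.nonneg z
    · linarith [(hapos z hz).2.1, hta z]
  have hta0 : ∀ z, 0 ≤ t * a z := fun z => mul_nonneg ht.le (ha0 z)
  have htb0 : ∀ z, 0 ≤ t * b z := fun z => mul_nonneg ht.le (hb0 z)
  have hai : Integrable a ν := Integrable.of_bound ham.aestronglyMeasurable B
    (ae_of_all _ fun z => by rw [Real.norm_of_nonneg (ha0 z)]; exact haB z)
  have hbi : Integrable b ν := Integrable.of_bound hbm.aestronglyMeasurable B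
    (ae_of_all _ fun z => by rw [Real.norm_of_nonneg (hb0 z)]; exact hbB z)
  have hmarg : ∀ T : Pt d × Pt d → Pt d, Measurable T →
      (den ν a).map T = (den ν b).map T →
      (den ν fun z => t * a z).map T = (den ν fun z => t * b z).map T := by
    intro T hT h
    rw [den_const_mul ν ht.le ham, den_const_mul ν ht.le hbm, Measure.map_smul, Measure.map_smul, h]
  have hfst : (den ν a).map Prod.fst = (den ν b).map Prod.fst := by
    rw [hdena, hdenb, Measure.map_add _ _ measurable_fst, Measure.map_add _ _ measurable_fst,
      Measure.map_map (by fun_prop) (by fun_prop), Measure.map_map (by fun_prop) (by fun_prop),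
      Measure.map_map (by fun_prop) (by fun_prop), Measure.map_map (by fun_prop) (by fun_prop)]
    rfl
  have hsnd : (den ν a).map Prod.snd = (den ν b).map Prod.snd := by
    rw [hdena, hdenb, Measure.map_add _ _ measurable_snd, Measure.map_add _ _ measurable_snd,
      Measure.map_map (by fun_prop) (by fun_prop), Measure.map_map (by fun_prop) (by fun_prop),
      Measure.map_map (by fun_prop) (by fun_prop), Measure.map_map (by fun_prop) (by fun_prop),
      add_comm]
    rfl
  set D : Pt d × Pt d → ℝ := fun z => (ρ z - t * a z + t * b z)
    * Real.log (ρ z - t * a z + t * b z) - ρ z * Real.log (ρ z) with hD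
  have hDi : Integrable D ν := by
    obtain ⟨C, hC⟩ := (isCompact_Icc (a := (0 : ℝ)) (b := n + τ)).exists_bound_of_continuousOn
      Real.continuous_mul_log.continuousOn
    refine Integrable.of_bound (by rw [hD]; fun_prop) (|C| + |C|) (ae_of_all _ fun z => ?_)
    by_cases hz : a z = 0 ∧ b z = 0
    · simp only [hD, hz.1, hz.2, mul_zero, sub_zero, add_zero, sub_self, norm_zero]
      positivity
    · have hρn : ρ z ≤ n := by
        by_cases hz' : a z = 0
        · exact (hbpos z (fun h => hz ⟨hz', h⟩)).2
        · exact (hapos z hz').2.2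
      have h1 := (hC (ρ z - t * a z + t * b z)
        ⟨by linarith [haρ z, htb0 z], by linarith [hta0 z, htb z]⟩).trans (le_abs_self C)
      have h2 := (hC (ρ z) ⟨H.nonneg z, by linarith⟩).trans (le_abs_self C)
      exact (norm_sub_le _ _).trans (add_le_add h1 h2)
  set K : ℝ := (n + n) ^ 2 + h * (|Real.log τ| + |Real.log (n + τ)| + 1) with hK
  have hbound : ∀ (z : Pt d × Pt d) (u : ℝ), ‖z‖ ≤ n → τ ≤ u → u ≤ n + τ →
      ‖‖z.1 - z.2‖ ^ 2 + h * (Real.log u + 1)‖ ≤ K := by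
    intro z u hz h1 h2
    have h3 := Real.log_le_log hτ h1
    have h4 := Real.log_le_log (hτ.trans_le h1) h2
    have h5 : |Real.log u| ≤ |Real.log τ| + |Real.log (n + τ)| :=
      abs_le.2 ⟨by linarith [neg_abs_le (Real.log τ), abs_nonneg (Real.log (n + τ))],
        by linarith [le_abs_self (Real.log (n + τ)), abs_nonneg (Real.log τ)]⟩
    have h6 : ‖z.1 - z.2‖ ≤ n + n := (norm_sub_le _ _).trans
      (add_le_add ((norm_fst_le z).trans hz) ((norm_snd_le z).trans hz))
    refine (norm_add_le _ _).trans (add_le_add ?_ ?_)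
    · rw [norm_pow, norm_norm]
      gcongr
    · rw [norm_mul, Real.norm_of_nonneg hh.le]
      refine mul_le_mul_of_nonneg_left ((norm_add_le _ _).trans ?_) hh.le
      rw [norm_one, Real.norm_eq_abs]
      linarith
  have hGai : Integrable Gm (den ν a) := by
    rw [integrable_den ham ha0]
    refine (hai.const_mul K).mono' (hGmm.mul ham).aestronglyMeasurable (ae_of_all _ fun z => ?_)
    rw [norm_mul, Real.norm_of_nonneg (ha0 z)]
    by_cases hz : a z = 0
    · simp [hz]
    · obtain ⟨h1, h2, h3⟩ := hapos z hz
      rw [hGm]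
      exact mul_le_mul_of_nonneg_right (hbound z _ h1 (by linarith) (by linarith)) (ha0 z)
  have hGbi : Integrable Gp (den ν b) := by
    rw [integrable_den hbm hb0]
    refine (hbi.const_mul K).mono' (hGpm.mul hbm).aestronglyMeasurable (ae_of_all _ fun z => ?_)
    rw [norm_mul, Real.norm_of_nonneg (hb0 z)]
    by_cases hz : b z = 0
    · simp [hz]
    · obtain ⟨h1, h2⟩ := hbpos z hz
      rw [hGp]
      exact mul_le_mul_of_nonneg_right
        (hbound z _ h1 (by linarith [H.nonneg z]) (by linarith)) (hb0 z)
  have hGai' := (integrable_den ham ha0 Gm).1 hGai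
  have hGbi' := (integrable_den hbm hb0 Gp).1 hGbi
  have main := H.le (fun z => t * a z) (fun z => t * b z) (by fun_prop) (by fun_prop) hta0 haρ htb0
    ⟨n, fun z hz => ⟨by
        by_contra hcon
        exact absurd (hapos z (fun h => hcon (by rw [h, mul_zero]))).1 (not_le.2 hz), by
        by_contra hcon
        exact absurd (hbpos z (fun h => hcon (by rw [h, mul_zero]))).1 (not_le.2 hz)⟩⟩
    (hbi.const_mul t) (hmarg _ measurable_fst hfst) (hmarg _ measurable_snd hsnd) hDi
  -- Take the tangent at the perturbed density, then replace its logarithm by log(ρ + τ) where mass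
  -- is added and by log(ρ - τ) where it is removed.
  have hDle : ∀ z, ‖z.1 - z.2‖ ^ 2 * (t * b z - t * a z) + h * D z
      ≤ t * (Gp z * b z - Gm z * a z) := by
    intro z
    by_cases hz : a z = 0 ∧ b z = 0
    · simp [hD, hz.1, hz.2]
    have hv : 0 < ρ z - t * a z + t * b z := by
      by_cases hz' : a z = 0
      · have : 0 < t * b z :=
          mul_pos ht (lt_of_le_of_ne (hb0 z) (fun h => hz ⟨hz', h.symm⟩))
        linarith [haρ z]
      · linarith [(hapos z hz').2.1, hta z, htb0 z]
    have h1 := mul_log_sub_mul_log_le (H.nonneg z) hv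
    have h2 : t * b z * Real.log (ρ z - t * a z + t * b z) ≤ t * b z * Real.log (ρ z + τ) :=
      mul_le_mul_of_nonneg_left (Real.log_le_log hv (by linarith [hta0 z, htb z])) (htb0 z)
    have h3 : t * a z * Real.log (ρ z - τ) ≤ t * a z * Real.log (ρ z - t * a z + t * b z) := by
      by_cases hz' : a z = 0
      · simp [hz']
      · exact mul_le_mul_of_nonneg_left (Real.log_le_log (by linarith [(hapos z hz').2.1])
          (by linarith [hta z, htb0 z])) (hta0 z)
    have h4 : D z ≤ t * b z * (Real.log (ρ z + τ) + 1) - t * a z * (Real.log (ρ z - τ) + 1) := by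
      simp only [hD]
      linarith
    have h5 := mul_le_mul_of_nonneg_left h4 hh.le
    rw [hGp, hGm]
    simp only
    linarith
  have hci : Integrable (fun z : Pt d × Pt d => ‖z.1 - z.2‖ ^ 2 * (t * b z - t * a z)) ν :=
    integrable_mul_of_bounded_support (r := n) ((hbi.const_mul t).sub (hai.const_mul t))
      (fun z hz => by
        have h1 : a z = 0 := by
          by_contra hcon; exact absurd (hapos z hcon).1 (not_le.2 hz)
        have h2 : b z = 0 := by
          by_contra hcon; exact absurd (hbpos z hcon).1 (not_le.2 hz)
        simp [h1, h2]) (by fun_prop)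
  rw [← integral_const_mul, ← integral_add hci (hDi.const_mul h)] at main
  have main2 := main.trans (integral_mono (hci.add (hDi.const_mul h))
    ((hGbi'.sub hGai').const_mul t) hDle)
  rw [integral_const_mul] at main2
  have main3 := nonneg_of_mul_nonneg_right main2 ht
  simp only [Pi.sub_apply] at main3
  rw [integral_sub hGbi' hGai', ← integral_den ham ha0, ← integral_den hbm hb0] at main3
  rw [hdena] at hGai main3
  rw [hdenb] at hGbi main3
  obtain ⟨ia1, ia2⟩ := integrable_add_measure.1 hGai
  obtain ⟨ib1, ib2⟩ := integrable_add_measure.1 hGbi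
  have me1 : Measurable fun w : (Pt d × Pt d) × (Pt d × Pt d) => (exch w).1 := by fun_prop
  have me2 : Measurable fun w : (Pt d × Pt d) × (Pt d × Pt d) => (exch w).2 := by fun_prop
  rw [integral_add_measure ia1 ia2, integral_add_measure ib1 ib2,
    integral_map measurable_fst.aemeasurable hGmm.aestronglyMeasurable,
    integral_map measurable_snd.aemeasurable hGmm.aestronglyMeasurable,
    integral_map me1.aemeasurable hGpm.aestronglyMeasurable,
    integral_map me2.aemeasurable hGpm.aestronglyMeasurable] at main3
  have ja1 : Integrable (fun w => Gm w.1) m :=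
    (integrable_map_measure hGmm.aestronglyMeasurable measurable_fst.aemeasurable).1 ia1
  have ja2 : Integrable (fun w => Gm w.2) m :=
    (integrable_map_measure hGmm.aestronglyMeasurable measurable_snd.aemeasurable).1 ia2
  have jb1 : Integrable (fun w => Gp (exch w).1) m :=
    (integrable_map_measure hGpm.aestronglyMeasurable me1.aemeasurable).1 ib1
  have jb2 : Integrable (fun w => Gp (exch w).2) m :=
    (integrable_map_measure hGpm.aestronglyMeasurable me2.aemeasurable).1 ib2
  set Ψ : (Pt d × Pt d) × (Pt d × Pt d) → ℝ :=
    fun w => Gm w.1 + Gm w.2 - (Gp (exch w).1 + Gp (exch w).2) with hΨ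
  have hΨi : Integrable Ψ m := (ja1.add ja2).sub (jb1.add jb2)
  -- Minimality makes this integral nonpositive, while the integrand is positive at every point of
  -- V; hence V is null.
  have hΨint : ∫ w, Ψ w ∂m ≤ 0 := by
    have e : ∫ w, Ψ w ∂m = (∫ w, Gm w.1 ∂m + ∫ w, Gm w.2 ∂m)
        - (∫ w, Gp (exch w).1 ∂m + ∫ w, Gp (exch w).2 ∂m) := by
      rw [← integral_add ja1 ja2, ← integral_add jb1 jb2]
      exact integral_sub (ja1.add ja2) (jb1.add jb2)
    rw [e]
    linarith
  have hΨpos : ∀ᵐ w ∂m, 0 < Ψ w := by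
    filter_upwards [ae_restrict_mem hV] with w hw
    have := hw.2.2.2.2.2.2.2
    simp only [hΨ]
    linarith
  have hΨ0 := (integral_eq_zero_iff_of_nonneg_ae (hΨpos.mono fun w hw => hw.le) hΨi).1
    (le_antisymm hΨint (integral_nonneg_of_ae (hΨpos.mono fun w hw => hw.le)))
  have hfalse : ∀ᵐ w ∂m, False := by
    filter_upwards [hΨpos, hΨ0] with w h1 h2
    exact h1.ne' h2
  rw [ae_iff] at hfalse
  simpa [hm, Measure.restrict_apply_univ] using hfalse

/-- A strict violation of the inequality is stable under small τ. After taking logarithms it places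
w in one of the countably many null sets with τ = 1/(k+1) and natural n; the four squared distances
combine to 2⟨x-x', y-y'⟩. -/
lemma LocMin.exchange {h : ℝ} (hh : 0 < h) {lam mu : Measure (Pt d)} [IsFiniteMeasure lam]
    [IsFiniteMeasure mu] {ρ : Pt d × Pt d → ℝ} (H : LocMin h lam mu ρ) :
    ∀ᵐ w ∂((lam.prod mu).prod (lam.prod mu)), ρ w.1 * ρ w.2
      ≤ ρ (exch w).1 * ρ (exch w).2
        * Real.exp (2 * inner ℝ (w.1.1 - w.2.1) (w.1.2 - w.2.2) / h) := by
  have hnull := fun k n : ℕ => measure_eq_zero_iff_ae_notMem.1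
    (H.exchange_null hh (τ := 1 / ((k : ℝ) + 1)) (by positivity) n _ _ rfl rfl)
  have hall := ae_all_iff.2 fun k => ae_all_iff.2 (hnull k)
  filter_upwards [hall] with w hw
  by_contra! hcon
  set Δ := 2 * inner ℝ (w.1.1 - w.2.1) (w.1.2 - w.2.2) with hΔ
  have h0 : ∀ z, 0 ≤ ρ z := H.nonneg
  have hpos : 0 < ρ w.1 * ρ w.2 := lt_of_le_of_lt
    (mul_nonneg (mul_nonneg (h0 _) (h0 _)) (Real.exp_pos _).le) hcon
  have hpos1 : 0 < ρ w.1 := lt_of_le_of_ne (h0 _) fun h => by simp [← h] at hpos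
  have hpos2 : 0 < ρ w.2 := lt_of_le_of_ne (h0 _) fun h => by simp [← h] at hpos
  have ht := tendsto_one_div_add_atTop_nhds_zero_nat (𝕜 := ℝ)
  have e1 : ∀ᶠ τ in nhds (0 : ℝ), 2 * τ < ρ w.1 :=
    (continuous_const.mul continuous_id).tendsto' 0 0 (by simp) |>.eventually (gt_mem_nhds hpos1)
  have e2 : ∀ᶠ τ in nhds (0 : ℝ), 2 * τ < ρ w.2 :=
    (continuous_const.mul continuous_id).tendsto' 0 0 (by simp) |>.eventually (gt_mem_nhds hpos2)
  have e3 : ∀ᶠ τ in nhds (0 : ℝ), 0 < (ρ w.1 - τ) * (ρ w.2 - τ)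
      - (ρ (exch w).1 + τ) * (ρ (exch w).2 + τ) * Real.exp (Δ / h) := by
    have hc : Continuous fun τ : ℝ => (ρ w.1 - τ) * (ρ w.2 - τ)
      - (ρ (exch w).1 + τ) * (ρ (exch w).2 + τ) * Real.exp (Δ / h) := by fun_prop
    exact (hc.tendsto' 0 _ rfl).eventually (lt_mem_nhds (by simpa using hcon))
  obtain ⟨k, hk1, hk2, hk3⟩ :=
    ((ht.eventually e1).and ((ht.eventually e2).and (ht.eventually e3))).exists
  obtain ⟨n, hn⟩ := exists_nat_ge
    (max ‖w‖ (max (max (ρ w.1) (ρ w.2)) (max (ρ (exch w).1) (ρ (exch w).2))))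
  simp only [max_le_iff] at hn
  refine hw k n ⟨hn.1, hk1, hk2, hn.2.1.1, hn.2.1.2, hn.2.2.1, hn.2.2.2, ?_⟩
  set τ : ℝ := 1 / ((k : ℝ) + 1) with hτ
  have hτpos : 0 < τ := by positivity
  have p1 : 0 < ρ w.1 - τ := by linarith
  have p2 : 0 < ρ w.2 - τ := by linarith
  have p3 : 0 < ρ (exch w).1 + τ := by linarith [h0 (exch w).1]
  have p4 : 0 < ρ (exch w).2 + τ := by linarith [h0 (exch w).2]
  have hlog := Real.log_lt_log (by positivity) (sub_pos.1 hk3)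
  rw [Real.log_mul (by positivity) (Real.exp_pos _).ne', Real.log_mul p3.ne' p4.ne', Real.log_exp,
    Real.log_mul p1.ne' p2.ne'] at hlog
  have hlog' := mul_lt_mul_of_pos_left hlog hh
  have hΔh : h * (Real.log (ρ (exch w).1 + τ) + Real.log (ρ (exch w).2 + τ) + Δ / h)
      = h * (Real.log (ρ (exch w).1 + τ) + Real.log (ρ (exch w).2 + τ)) + Δ := by
    field_simp
  rw [hΔh] at hlog'
  have hcost : ‖(exch w).1.1 - (exch w).1.2‖ ^ 2 + ‖(exch w).2.1 - (exch w).2.2‖ ^ 2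
      - ‖w.1.1 - w.1.2‖ ^ 2 - ‖w.2.1 - w.2.2‖ ^ 2 = Δ := by
    simp only [exch, hΔ, norm_sub_sq_real, inner_sub_left, inner_sub_right]
    ring
  linarith

end Exchange

/-! ### Long trajectories -/

section Long

variable {d : ℕ}

/-- With e the unit vector from x to y and N = |y - x|, one has x' = x + se + u and y' = x' + v,
where u and v are shorter than s/10. The leading term of the inner product is -s(N - s). With the
errors it is at most -s(0.9 N - 1.12 s), which is below -sN/2 for N ≥ 7/4 and s ≤ 1/2. -/
lemma inner_exchange_le {x y x' y' : Pt d} {s : ℝ} (hs : 0 < s) (hs' : s ≤ 1 / 2)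
    (hD : 7 / 4 ≤ ‖y - x‖) (hx' : ‖x' - (x + (s / ‖y - x‖) • (y - x))‖ < s / 10)
    (hy' : ‖y' - x'‖ < s / 10) :
    2 * inner ℝ (x - x') (y - y') ≤ -(s * ‖y - x‖) := by
  set D := y - x with hDdef
  set N := ‖D‖ with hN
  have hNpos : 0 < N := by linarith
  set e := N⁻¹ • D with he
  have hDe : D = N • e := by rw [he, smul_smul, mul_inv_cancel₀ hNpos.ne', one_smul]
  have hen : ‖e‖ = 1 := by
    rw [he, norm_smul, norm_inv, Real.norm_of_nonneg hNpos.le, ← hN, inv_mul_cancel₀ hNpos.ne']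
  set u := x' - (x + (s / N) • D) with hu
  set v := y' - x' with hv
  have hse : (s / N) • D = s • e := by rw [he, smul_smul]; rfl
  have h1 : x - x' = -(s • e + u) := by rw [hu, hse]; abel
  have h2 : y - y' = (N - s) • e - u - v := by
    rw [sub_smul, ← hDe, ← hse, hu, hv, hDdef]; abel
  have hee : inner ℝ e e = (1 : ℝ) := by rw [real_inner_self_eq_norm_sq, hen, one_pow]
  have heu := abs_le.1 (abs_real_inner_le_norm e u)
  have hev := abs_le.1 (abs_real_inner_le_norm e v)
  have huv := abs_le.1 (abs_real_inner_le_norm u v)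
  rw [hen, one_mul] at heu hev
  have huu : inner ℝ u u = ‖u‖ ^ 2 := real_inner_self_eq_norm_sq u
  have hexp : inner ℝ (x - x') (y - y') = -(s * (N - s) - s * inner ℝ e u - s * inner ℝ e v
      + (N - s) * inner ℝ e u - ‖u‖ ^ 2 - inner ℝ u v) := by
    rw [h1, h2]
    simp only [inner_neg_left, inner_add_left, inner_sub_right, inner_smul_left, inner_smul_right,
      hee, huu, real_inner_comm e u]
    simp
    ring
  have hu0 := norm_nonneg u
  have hv0 := norm_nonneg v
  have b1 : ‖u‖ ^ 2 ≤ s / 10 * (s / 10) := by rw [sq]; gcongr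
  have b2 : inner ℝ u v ≤ s / 10 * (s / 10) := huv.2.trans (by gcongr)
  have b3 : s * inner ℝ e v ≤ s * (s / 10) := by gcongr; linarith
  have b4 : s * inner ℝ e u ≤ s * (s / 10) := by gcongr; linarith
  have b5 : (N - s) * -(s / 10) ≤ (N - s) * inner ℝ e u := by
    apply mul_le_mul_of_nonneg_left <;> linarith
  have b6 : s * s ≤ s * (1 / 2) := by gcongr
  have b7 : s * (7 / 4) ≤ s * N := by gcongr
  rw [hexp]
  nlinarith

/-- From exp τ ≥ τ²/2: the gain from the exchange outweighs the quadratic cost of arbitrarily long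
pairs. -/
lemma sq_mul_exp_le {s t h : ℝ} (hs : 0 < s) (ht : 0 ≤ t) (hh : 0 < h) :
    t ^ 2 * Real.exp (-(s * t) / h) ≤ 2 * (h / s) ^ 2 := by
  have h0 : 0 ≤ s * t / h := by positivity
  have h1 := Real.quadratic_le_exp_of_nonneg h0
  have h2 : (s * t / h) ^ 2 ≤ 2 * Real.exp (s * t / h) := by nlinarith
  have h3 : t ^ 2 = (s * t / h) ^ 2 * (h / s) ^ 2 := by field_simp
  rw [neg_div, Real.exp_neg]
  calc t ^ 2 * (Real.exp (s * t / h))⁻¹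
      = (s * t / h) ^ 2 * (Real.exp (s * t / h))⁻¹ * (h / s) ^ 2 := by
        rw [h3]; ring
    _ ≤ 2 * Real.exp (s * t / h) * (Real.exp (s * t / h))⁻¹ * (h / s) ^ 2 := by gcongr
    _ = 2 * (h / s) ^ 2 := by
        rw [mul_assoc 2, mul_inv_cancel₀ (Real.exp_pos _).ne', mul_one]

/-- The pairs whose first point lies in `B_1` and whose second point lies outside `B_{11/4}`. -/
def longSet (d : ℕ) : Set (Pt d × Pt d) :=
  Metric.ball 0 1 ×ˢ (Metric.ball 0 (11 / 4))ᶜ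

lemma measurableSet_longSet : MeasurableSet (longSet d) :=
  measurableSet_ball.prod measurableSet_ball.compl

lemma measurableSet_cross (R : ℝ) : MeasurableSet (cross d R) :=
  (measurableSet_ball.prod MeasurableSet.univ).union (MeasurableSet.univ.prod measurableSet_ball)

lemma measurableSet_pset (L R : ℝ) : MeasurableSet (pset d L R) :=
  (measurableSet_ball.prod measurableSet_ball).union (measurableSet_ball.prod measurableSet_ball)

lemma norm_sub_ge_of_mem_longSet {z : Pt d × Pt d} (hz : z ∈ longSet d) :
    7 / 4 ≤ ‖z.2 - z.1‖ := by
  have h1 : ‖z.1‖ < 1 := by simpa using hz.1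
  have h2 : 11 / 4 ≤ ‖z.2‖ := by simpa using hz.2
  have := norm_sub_norm_le z.2 z.1
  linarith

/-- The pairs of distance less than `s / 10` starting near the point at distance `s` from `z.1`
in the direction of `z.2`. -/
def nearSet (s : ℝ) : Set ((Pt d × Pt d) × (Pt d × Pt d)) :=
  {w | ‖w.2.1 - (w.1.1 + (s / ‖w.1.2 - w.1.1‖) • (w.1.2 - w.1.1))‖ < s / 10 ∧
    ‖w.2.2 - w.2.1‖ < s / 10}

lemma measurableSet_nearSet (s : ℝ) : MeasurableSet (nearSet (d := d) s) := by
  unfold nearSet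
  rw [ofPred_and]
  exact (measurableSet_lt (by fun_prop) (by fun_prop)).inter
    (measurableSet_lt (by fun_prop) (by fun_prop))

lemma center_mem {z : Pt d × Pt d} {s θ : ℝ} (hs : 0 < s) (hθ : 1 + 2 * s ≤ θ)
    (hz : z ∈ longSet d) :
    Metric.ball (z.1 + (s / ‖z.2 - z.1‖) • (z.2 - z.1)) (s / 10) ⊆ Metric.ball 0 θ := by
  intro x hx
  have hD := norm_sub_ge_of_mem_longSet hz
  have h1 : ‖z.1‖ < 1 := by simpa using hz.1
  have h2 : ‖(s / ‖z.2 - z.1‖) • (z.2 - z.1)‖ = s := by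
    rw [norm_smul, Real.norm_of_nonneg (by positivity)]
    field_simp
  rw [mem_ball_iff_norm] at hx
  rw [mem_ball_zero_iff]
  set c := z.1 + (s / ‖z.2 - z.1‖) • (z.2 - z.1)
  have h3 : ‖c‖ ≤ ‖z.1‖ + s := (norm_add_le _ _).trans (by rw [h2])
  have h4 : ‖x‖ ≤ ‖x - c‖ + ‖c‖ := by simpa using norm_add_le (x - c) c
  linarith

/-- At least half the volume of the small ball is the mass of pairs starting in it. By Chebyshev, at
most a quarter of that volume is lost to pairs of length s/10 or more. -/
lemma measure_nearSet_ge {lam : Measure (Pt d)} {p : Measure (Pt d × Pt d)} [IsFiniteMeasure p]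
    {s θ : ℝ} (hs : 0 < s) (hθ : 1 + 2 * s ≤ θ) (hfst : p.map Prod.fst = lam)
    (hlo : ∀ S ⊆ Metric.ball (0 : Pt d) θ, MeasurableSet S → volume S ≤ 2 * lam S)
    (hE : ENNReal.ofReal (100 / s ^ 2) * crossCost p θ
      ≤ volume (Metric.ball (0 : Pt d) (s / 10)) / 4)
    {z : Pt d × Pt d} (hz : z ∈ longSet d) :
    volume (Metric.ball (0 : Pt d) (s / 10)) / 4 ≤ p (Prod.mk z ⁻¹' nearSet s) := by
  set c := z.1 + (s / ‖z.2 - z.1‖) • (z.2 - z.1) with hc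
  set v := volume (Metric.ball (0 : Pt d) (s / 10)) with hv
  have hball := center_mem hs hθ hz
  rw [← hc] at hball
  have hvc : volume (Metric.ball c (s / 10)) = v := by
    rw [hv, Measure.addHaar_ball_center]
  have h1 : v ≤ 2 * p (Prod.fst ⁻¹' Metric.ball c (s / 10)) := by
    rw [← Measure.map_apply measurable_fst measurableSet_ball, hfst, ← hvc]
    exact hlo _ hball measurableSet_ball
  set F : Set (Pt d × Pt d) :=
    {z' | ENNReal.ofReal (s ^ 2 / 100) ≤ ‖z'.1 - z'.2‖ₑ ^ 2} with hF
  have h2 : p (Prod.fst ⁻¹' Metric.ball c (s / 10))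
      ≤ p (Prod.mk z ⁻¹' nearSet s) + (p.restrict (cross d θ)) F := by
    rw [Measure.restrict_apply (measurableSet_le (by fun_prop) (by fun_prop))]
    refine (measure_mono ?_).trans (measure_union_le _ _)
    intro z' hz'
    by_cases hfar : ‖z'.2 - z'.1‖ < s / 10
    · exact Or.inl ⟨mem_ball_iff_norm.1 hz', hfar⟩
    · refine Or.inr ⟨?_, Or.inl ⟨hball hz', mem_univ _⟩⟩
      rw [not_lt, norm_sub_rev] at hfar
      change ENNReal.ofReal (s ^ 2 / 100) ≤ ‖z'.1 - z'.2‖ₑ ^ 2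
      rw [← ofReal_norm, ← ENNReal.ofReal_pow (norm_nonneg _)]
      apply ENNReal.ofReal_le_ofReal
      calc s ^ 2 / 100 = (s / 10) ^ 2 := by ring
        _ ≤ _ := by gcongr
  have h3 : (p.restrict (cross d θ)) F ≤ v / 4 := by
    refine le_trans ?_ hE
    have := mul_meas_ge_le_lintegral₀ (μ := p.restrict (cross d θ))
      (f := fun z' => ‖z'.1 - z'.2‖ₑ ^ 2) (by fun_prop) (ENNReal.ofReal (s ^ 2 / 100))
    calc (p.restrict (cross d θ)) F
        = ENNReal.ofReal (100 / s ^ 2)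
          * (ENNReal.ofReal (s ^ 2 / 100) * (p.restrict (cross d θ)) F) := by
          rw [← mul_assoc, ← ENNReal.ofReal_mul (by positivity)]
          have : 100 / s ^ 2 * (s ^ 2 / 100) = 1 := by field_simp
          rw [this, ENNReal.ofReal_one, one_mul]
      _ ≤ _ := by gcongr; exact this
  have hvfin : v ≠ ∞ := measure_ball_lt_top.ne
  have hfin : p (Prod.mk z ⁻¹' nearSet s) ≠ ∞ := measure_ne_top _ _
  have h4 : v ≤ 2 * (p (Prod.mk z ⁻¹' nearSet s) + v / 4) := h1.trans (by gcongr; exact h2.trans (by gcongr))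
  clear_value v
  lift v to ℝ≥0 using hvfin
  generalize p (Prod.mk z ⁻¹' nearSet s) = q at *
  lift q to ℝ≥0 using hfin
  have e4 : (v : ℝ≥0∞) / 4 = ((v / 4 : ℝ≥0) : ℝ≥0∞) := by
    rw [ENNReal.coe_div (by norm_num)]; rfl
  rw [e4] at h4 ⊢
  norm_cast at h4 ⊢
  rw [← NNReal.coe_le_coe] at h4 ⊢
  push_cast at h4 ⊢
  linarith

lemma lintegral_den {X : Type*} [MeasurableSpace X] {ν : Measure X} {ρ : X → ℝ}
    (hρ : Measurable ρ) {F : X → ℝ≥0∞} (hF : Measurable F) :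
    ∫⁻ z, F z ∂(den ν ρ) = ∫⁻ z, F z * ENNReal.ofReal (ρ z) ∂ν := by
  rw [den, lintegral_withDensity_eq_lintegral_mul _ (by fun_prop) hF]
  simp [mul_comm]

/-- Integrate the exchange inequality over a long pair and a nearby short pair. On the left the
short pairs contribute at least v/4 for every long pair, v being the volume of the small ball. On
the right, since `exch` preserves the product measure, the bound decouples into masses of two balls.
-/
lemma lintegral_longSet_le {h : ℝ} (hh : 0 < h) {lam mu : Measure (Pt d)} [IsFiniteMeasure lam]
    [IsFiniteMeasure mu] {ρ : Pt d × Pt d → ℝ} (hρ : Measurable ρ) (hρ0 : ∀ z, 0 ≤ ρ z)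
    (hex : ∀ᵐ w ∂((lam.prod mu).prod (lam.prod mu)), ρ w.1 * ρ w.2
      ≤ ρ (exch w).1 * ρ (exch w).2
        * Real.exp (2 * inner ℝ (w.1.1 - w.2.1) (w.1.2 - w.2.2) / h))
    {s θ : ℝ} (hs : 0 < s) (hs' : s ≤ 1 / 2) (hθ : 1 + 2 * s ≤ θ)
    (hfst : (den (lam.prod mu) ρ).map Prod.fst = lam)
    (hlo : ∀ S ⊆ Metric.ball (0 : Pt d) θ, MeasurableSet S → volume S ≤ 2 * lam S)
    (hE : ENNReal.ofReal (100 / s ^ 2) * crossCost (den (lam.prod mu) ρ) θ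
      ≤ volume (Metric.ball (0 : Pt d) (s / 10)) / 4) :
    (∫⁻ z in longSet d, ‖z.1 - z.2‖ₑ ^ 2 ∂(den (lam.prod mu) ρ))
        * (volume (Metric.ball (0 : Pt d) (s / 10)) / 4)
      ≤ ENNReal.ofReal (2 * (h / s) ^ 2)
        * (lam (Metric.ball 0 1) * lam (Metric.ball 0 θ)) := by
  set ν := lam.prod mu with hν
  set p := den ν ρ with hp
  have hpfin : IsFiniteMeasure p := by
    constructor
    have h1 : p univ = lam univ := by
      rw [← hfst, Measure.map_apply measurable_fst MeasurableSet.univ, preimage_univ]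
    rw [h1]
    exact measure_lt_top _ _
  set r : Pt d × Pt d → ℝ≥0∞ := fun z => ENNReal.ofReal (ρ z) with hr
  have hrm : Measurable r := by fun_prop
  set W : Set ((Pt d × Pt d) × (Pt d × Pt d)) := (Prod.fst ⁻¹' longSet d) ∩ nearSet s with hW
  have hWm : MeasurableSet W :=
    (measurable_fst measurableSet_longSet).inter (measurableSet_nearSet s)
  have hlen : Measurable fun z : Pt d × Pt d => ‖z.1 - z.2‖ₑ ^ 2 := by fun_prop
  have hlm : Measurable fun z : Pt d × Pt d =>
      (longSet d).indicator (fun z => ‖z.1 - z.2‖ₑ ^ 2) z * ENNReal.ofReal (ρ z) :=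
    (hlen.indicator measurableSet_longSet).mul hrm
  have hlower : (∫⁻ z in longSet d, ‖z.1 - z.2‖ₑ ^ 2 ∂p)
        * (volume (Metric.ball (0 : Pt d) (s / 10)) / 4)
      ≤ ∫⁻ w, W.indicator (fun w => ‖w.1.1 - w.1.2‖ₑ ^ 2 * (r w.1 * r w.2)) w ∂(ν.prod ν) := by
    rw [lintegral_prod _ ((Measurable.indicator (by fun_prop) hWm).aemeasurable),
      ← lintegral_indicator measurableSet_longSet, lintegral_den hρ
        (hlen.indicator measurableSet_longSet), ← lintegral_mul_const _ hlm]
    refine lintegral_mono fun z => ?_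
    by_cases hz : z ∈ longSet d
    · have hsec : ∀ z', W.indicator (fun w => ‖w.1.1 - w.1.2‖ₑ ^ 2 * (r w.1 * r w.2)) (z, z')
          = ‖z.1 - z.2‖ₑ ^ 2 * r z * (Prod.mk z ⁻¹' nearSet s).indicator r z' := by
        intro z'
        by_cases hz' : (z, z') ∈ nearSet s
        · rw [indicator_of_mem (show (z, z') ∈ W from ⟨hz, hz'⟩), indicator_of_mem
            (show z' ∈ Prod.mk z ⁻¹' nearSet s from hz')]
          ring
        · rw [indicator_of_notMem (fun hw => hz' hw.2), indicator_of_notMem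
            (show z' ∉ Prod.mk z ⁻¹' nearSet s from hz'), mul_zero]
      simp_rw [hsec]
      have hsm : MeasurableSet (Prod.mk z ⁻¹' nearSet (d := d) s) :=
        measurable_prodMk_left (measurableSet_nearSet s)
      rw [lintegral_const_mul _ (hrm.indicator hsm), lintegral_indicator hsm,
        ← withDensity_apply _ hsm, indicator_of_mem hz]
      gcongr
      exact measure_nearSet_ge hs hθ hfst hlo hE hz
    · simp [hz]
  set C := ENNReal.ofReal (2 * (h / s) ^ 2) with hC
  set G : (Pt d × Pt d) × (Pt d × Pt d) → ℝ≥0∞ := fun w =>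
    (Prod.fst ⁻¹' Metric.ball 0 1).indicator r w.1
      * (Prod.fst ⁻¹' Metric.ball 0 θ).indicator r w.2 with hG
  have hb1 : MeasurableSet (Prod.fst ⁻¹' Metric.ball 0 1 : Set (Pt d × Pt d)) :=
    measurable_fst measurableSet_ball
  have hbθ : MeasurableSet (Prod.fst ⁻¹' Metric.ball 0 θ : Set (Pt d × Pt d)) :=
    measurable_fst measurableSet_ball
  have hGm : Measurable G :=
    ((hrm.indicator hb1).comp measurable_fst).mul ((hrm.indicator hbθ).comp measurable_snd)
  have hupper : ∫⁻ w, W.indicator (fun w => ‖w.1.1 - w.1.2‖ₑ ^ 2 * (r w.1 * r w.2)) w ∂(ν.prod ν)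
      ≤ ∫⁻ w, C * G (exch w) ∂(ν.prod ν) := by
    refine lintegral_mono_ae ?_
    filter_upwards [hex] with w hw
    by_cases hwW : w ∈ W
    · rw [indicator_of_mem hwW]
      have hD := norm_sub_ge_of_mem_longSet hwW.1
      have hin := inner_exchange_le hs hs' hD hwW.2.1 hwW.2.2
      have m1 : (exch w).1 ∈ (Prod.fst ⁻¹' Metric.ball 0 1 : Set (Pt d × Pt d)) := hwW.1.1
      have m2 : (exch w).2 ∈ (Prod.fst ⁻¹' Metric.ball 0 θ : Set (Pt d × Pt d)) :=
        center_mem hs hθ hwW.1 (mem_ball_iff_norm.2 hwW.2.1)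
      simp only [hG]
      rw [indicator_of_mem m1, indicator_of_mem m2]
      simp only [hr, hC]
      rw [← ENNReal.ofReal_mul (hρ0 _), ← ENNReal.ofReal_mul (hρ0 _),
        ← ENNReal.ofReal_mul (by positivity), ← ofReal_norm, ← ENNReal.ofReal_pow (norm_nonneg _),
        ← ENNReal.ofReal_mul (by positivity)]
      apply ENNReal.ofReal_le_ofReal
      rw [norm_sub_rev]
      set t := ‖w.1.2 - w.1.1‖
      have hσ : 0 ≤ ρ (exch w).1 * ρ (exch w).2 := mul_nonneg (hρ0 _) (hρ0 _)
      calc t ^ 2 * (ρ w.1 * ρ w.2)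
          ≤ t ^ 2 * (ρ (exch w).1 * ρ (exch w).2 * Real.exp (-(s * t) / h)) := by
            refine mul_le_mul_of_nonneg_left (hw.trans ?_) (by positivity)
            gcongr
        _ = (t ^ 2 * Real.exp (-(s * t) / h)) * (ρ (exch w).1 * ρ (exch w).2) := by ring
        _ ≤ _ := mul_le_mul_of_nonneg_right (sq_mul_exp_le hs (norm_nonneg _) hh) hσ
    · rw [indicator_of_notMem hwW]
      exact zero_le
  refine hlower.trans (hupper.trans ?_)
  have hGe : Measurable fun w => G (exch w) := hGm.comp measurable_exch
  rw [lintegral_const_mul _ hGe, lintegral_exch lam mu hGm,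
    lintegral_prod_mul (hrm.indicator hb1).aemeasurable (hrm.indicator hbθ).aemeasurable,
    lintegral_indicator hb1, lintegral_indicator hbθ, ← withDensity_apply _ hb1,
    ← withDensity_apply _ hbθ]
  have hmeas : ∀ R : ℝ, lam (Metric.ball 0 R) = p (Prod.fst ⁻¹' Metric.ball 0 R) := fun R => by
    rw [← hfst, Measure.map_apply measurable_fst measurableSet_ball]
  rw [hmeas, hmeas]
  rfl

end Long

/-! ### Block approximation of couplings -/

section Block

set_option linter.unusedSectionVars false

variable {X Y ι : Type*} [MeasurableSpace X] [MeasurableSpace Y] [MeasurableSpace ι]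
  [Countable ι] [MeasurableSingletonClass ι]

/-- The density of the block approximation on the cells `i`, `j`. -/
def blockDensity (α : Measure X) (β : Measure Y) (q : Measure (X × Y)) (T : X → ι) (S : Y → ι)
    (i j : ι) : ℝ≥0∞ :=
  q ((T ⁻¹' {i}) ×ˢ (S ⁻¹' {j})) * (α (T ⁻¹' {i}) * β (S ⁻¹' {j}))⁻¹

/-- The block approximation of `q`: the measure which on each product of cells is a multiple
of `α ⊗ β` and has the same mass as `q`. -/
def block (α : Measure X) (β : Measure Y) (q : Measure (X × Y)) (T : X → ι) (S : Y → ι) :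
    Measure (X × Y) :=
  (α.prod β).withDensity fun z => blockDensity α β q T S (T z.1) (S z.2)

variable {α : Measure X} {β : Measure Y} [IsFiniteMeasure α] [IsFiniteMeasure β]
  {q : Measure (X × Y)} {T : X → ι} {S : Y → ι}

lemma cell_le_fst (hq : q.map Prod.fst = α) (hT : Measurable T) (i j : ι) :
    q ((T ⁻¹' {i}) ×ˢ (S ⁻¹' {j})) ≤ α (T ⁻¹' {i}) := by
  rw [← hq, Measure.map_apply measurable_fst (hT (measurableSet_singleton i))]
  exact measure_mono fun z hz => hz.1

lemma cell_le_snd (hq : q.map Prod.snd = β) (hS : Measurable S) (i j : ι) :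
    q ((T ⁻¹' {i}) ×ˢ (S ⁻¹' {j})) ≤ β (S ⁻¹' {j}) := by
  rw [← hq, Measure.map_apply measurable_snd (hS (measurableSet_singleton j))]
  exact measure_mono fun z hz => hz.2

/-- If a cell is null then q does not charge the product of cells either, so the inverse of zero in
the definition is multiplied by zero. -/
lemma blockDensity_mul (hq₁ : q.map Prod.fst = α) (hq₂ : q.map Prod.snd = β)
    (hT : Measurable T) (hS : Measurable S) (i j : ι) :
    blockDensity α β q T S i j * (α (T ⁻¹' {i}) * β (S ⁻¹' {j}))
      = q ((T ⁻¹' {i}) ×ˢ (S ⁻¹' {j})) := by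
  have h1 := cell_le_fst (S := S) hq₁ hT i j
  have h2 := cell_le_snd (T := T) hq₂ hS i j
  rw [blockDensity]
  by_cases h : α (T ⁻¹' {i}) * β (S ⁻¹' {j}) = 0
  · have : q ((T ⁻¹' {i}) ×ˢ (S ⁻¹' {j})) = 0 := by
      rcases mul_eq_zero.1 h with h | h
      · exact le_antisymm (h1.trans h.le) zero_le
      · exact le_antisymm (h2.trans h.le) zero_le
    rw [this, zero_mul, zero_mul]
  · rw [mul_assoc, ENNReal.inv_mul_cancel h
      (ENNReal.mul_ne_top (measure_ne_top _ _) (measure_ne_top _ _)), mul_one]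

/-- The mass of q on the product is at most that of the second cell. The resulting bound depends on
the first cell only, which is what the entropy estimate integrates. -/
lemma blockDensity_le (hq₂ : q.map Prod.snd = β) (hS : Measurable S) (i j : ι) :
    blockDensity α β q T S i j ≤ (α (T ⁻¹' {i}))⁻¹ := by
  have h2 := cell_le_snd (T := T) hq₂ hS i j
  rw [blockDensity]
  by_cases h : β (S ⁻¹' {j}) = 0
  · have : q ((T ⁻¹' {i}) ×ˢ (S ⁻¹' {j})) = 0 := le_antisymm (h2.trans h.le) zero_le
    rw [this, zero_mul]
    exact zero_le
  · rw [ENNReal.mul_inv (Or.inr (measure_ne_top _ _)) (Or.inr h)]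
    calc _ ≤ β (S ⁻¹' {j}) * ((α (T ⁻¹' {i}))⁻¹ * (β (S ⁻¹' {j}))⁻¹) := by gcongr
      _ = (α (T ⁻¹' {i}))⁻¹ * (β (S ⁻¹' {j}) * (β (S ⁻¹' {j}))⁻¹) := by ring
      _ = _ := by rw [ENNReal.mul_inv_cancel h (measure_ne_top _ _), mul_one]

lemma blockDensity_eq_zero (hq₁ : q.map Prod.fst = α) (hT : Measurable T) {i j : ι}
    (hi : α (T ⁻¹' {i}) = 0) : blockDensity α β q T S i j = 0 := by
  have h1 := cell_le_fst (S := S) hq₁ hT i j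
  rw [blockDensity, le_antisymm (h1.trans hi.le) zero_le, zero_mul]

lemma measurable_blockDensity (hT : Measurable T) (hS : Measurable S) :
    Measurable fun z : X × Y => blockDensity α β q T S (T z.1) (S z.2) := by
  have : Measurable fun w : ι × ι => blockDensity α β q T S w.1 w.2 := measurable_of_countable _
  exact this.comp ((hT.comp measurable_fst).prodMk (hS.comp measurable_snd))

lemma ae_cell_ne_zero (hT : Measurable T) : ∀ᵐ x ∂α, α (T ⁻¹' {T x}) ≠ 0 := by
  have h : ∀ᵐ i ∂(α.map T), (α.map T) {i} ≠ 0 := by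
    rw [ae_iff_of_countable]
    exact fun i hi => hi
  have := ae_of_ae_map hT.aemeasurable h
  filter_upwards [this] with x hx
  rwa [Measure.map_apply hT (measurableSet_singleton _)] at hx

lemma lintegral_comp_countable (hT : Measurable T) (F : ι → ℝ≥0∞) :
    ∫⁻ x, F (T x) ∂α = ∑' i, F i * α (T ⁻¹' {i}) := by
  rw [← lintegral_map (measurable_of_countable F) hT, lintegral_countable']
  simp_rw [Measure.map_apply hT (measurableSet_singleton _)]

lemma lintegral_blockDensity (hq₁ : q.map Prod.fst = α) (hq₂ : q.map Prod.snd = β)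
    (hT : Measurable T) (hS : Measurable S) {i : ι} (hi : α (T ⁻¹' {i}) ≠ 0) :
    ∫⁻ y, blockDensity α β q T S i (S y) ∂β = 1 := by
  rw [lintegral_comp_countable hS fun j => blockDensity α β q T S i j]
  have h1 : ∀ j, blockDensity α β q T S i j * β (S ⁻¹' {j})
      = q ((T ⁻¹' {i}) ×ˢ (S ⁻¹' {j})) * (α (T ⁻¹' {i}))⁻¹ := by
    intro j
    rw [← blockDensity_mul hq₁ hq₂ hT hS, mul_assoc, mul_comm (α _) (β _), mul_assoc (β _),
      ENNReal.mul_inv_cancel hi (measure_ne_top _ _), mul_one]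
  simp_rw [h1]
  rw [ENNReal.tsum_mul_right, ← measure_iUnion]
  · have : ⋃ j, (T ⁻¹' {i}) ×ˢ (S ⁻¹' {j}) = Prod.fst ⁻¹' (T ⁻¹' {i}) := by
      ext z; simp
    rw [this, ← Measure.map_apply measurable_fst (hT (measurableSet_singleton i)), hq₁,
      ENNReal.mul_inv_cancel hi (measure_ne_top _ _)]
  · intro j j' hjj'
    refine Set.disjoint_left.2 fun z h1 h2 => hjj' ?_
    exact (h1.2 : S z.2 = j).symm.trans h2.2
  · exact fun j => (hT (measurableSet_singleton i)).prod (hS (measurableSet_singleton j))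

lemma block_map_fst (hq₁ : q.map Prod.fst = α) (hq₂ : q.map Prod.snd = β)
    (hT : Measurable T) (hS : Measurable S) : (block α β q T S).map Prod.fst = α := by
  refine Measure.ext_of_lintegral _ fun F hF => ?_
  have hk := measurable_blockDensity (α := α) (β := β) (q := q) hT hS
  rw [lintegral_map hF measurable_fst, block,
    lintegral_withDensity_eq_lintegral_mul _ hk
      (show Measurable fun z : X × Y => F z.1 from hF.comp measurable_fst)]
  simp only [Pi.mul_apply]
  have hm : Measurable fun z : X × Y => blockDensity α β q T S (T z.1) (S z.2) * F z.1 :=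
    hk.mul (hF.comp measurable_fst)
  rw [lintegral_prod _ hm.aemeasurable]
  refine lintegral_congr_ae ?_
  filter_upwards [ae_cell_ne_zero hT] with x hx
  rw [lintegral_mul_const _ (show Measurable fun y => blockDensity α β q T S (T x) (S y) from
      hk.comp measurable_prodMk_left),
    lintegral_blockDensity hq₁ hq₂ hT hS hx, one_mul]

lemma block_map_snd (hq₁ : q.map Prod.fst = α) (hq₂ : q.map Prod.snd = β)
    (hT : Measurable T) (hS : Measurable S) : (block α β q T S).map Prod.snd = β := by
  refine Measure.ext_of_lintegral _ fun F hF => ?_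
  have hk := measurable_blockDensity (α := α) (β := β) (q := q) hT hS
  rw [lintegral_map hF measurable_snd, block,
    lintegral_withDensity_eq_lintegral_mul _ hk
      (show Measurable fun z : X × Y => F z.2 from hF.comp measurable_snd)]
  simp only [Pi.mul_apply]
  have hm : Measurable fun z : X × Y => blockDensity α β q T S (T z.1) (S z.2) * F z.2 :=
    hk.mul (hF.comp measurable_snd)
  have hs₁ : (q.map Prod.swap).map Prod.fst = β := by
    rw [Measure.map_map measurable_fst measurable_swap]; exact hq₂
  have hs₂ : (q.map Prod.swap).map Prod.snd = α := by
    rw [Measure.map_map measurable_snd measurable_swap]; exact hq₁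
  have hswap : ∀ i j, blockDensity α β q T S i j = blockDensity β α (q.map Prod.swap) S T j i := by
    intro i j
    rw [blockDensity, blockDensity, Measure.map_apply measurable_swap
      ((hS (measurableSet_singleton j)).prod (hT (measurableSet_singleton i))),
      preimage_swap_prod, mul_comm (α _)]
  rw [lintegral_prod_symm _ hm.aemeasurable]
  refine lintegral_congr_ae ?_
  filter_upwards [ae_cell_ne_zero hS] with y hy
  rw [lintegral_mul_const _ (show Measurable fun x => blockDensity α β q T S (T x) (S y) from
      hk.comp measurable_prodMk_right)]
  simp_rw [hswap]
  rw [lintegral_blockDensity hs₁ hs₂ hS hT hy, one_mul]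

/-- Having the same law on pairs of cells is all that the cost comparison with q needs. -/
lemma block_map_cells (hq₁ : q.map Prod.fst = α) (hq₂ : q.map Prod.snd = β)
    (hT : Measurable T) (hS : Measurable S) :
    (block α β q T S).map (Prod.map T S) = q.map (Prod.map T S) := by
  refine Measure.ext_of_singleton fun ⟨i, j⟩ => ?_
  have hTS : Measurable (Prod.map T S) := hT.prodMap hS
  have hpre : Prod.map T S ⁻¹' {(i, j)} = (T ⁻¹' {i}) ×ˢ (S ⁻¹' {j}) := by
    ext z; simp [Prod.ext_iff]
  have hm : MeasurableSet ((T ⁻¹' {i}) ×ˢ (S ⁻¹' {j})) :=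
    (hT (measurableSet_singleton i)).prod (hS (measurableSet_singleton j))
  rw [Measure.map_apply hTS (measurableSet_singleton _),
    Measure.map_apply hTS (measurableSet_singleton _), hpre, block, withDensity_apply _ hm,
    setLIntegral_congr_fun (g := fun _ => blockDensity α β q T S i j) hm
      (fun z hz => by
        have h1 : T z.1 = i := hz.1
        have h2 : S z.2 = j := hz.2
        simp only [h1, h2]),
    setLIntegral_const, Measure.prod_prod, blockDensity_mul hq₁ hq₂ hT hS]

end Block

/-! ### The cubic grid -/

section Grid

variable {d : ℕ}

/-- The index of the cube of side `l` containing `x`. -/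
def cell (l : ℝ) (x : Pt d) : Fin d → ℤ := fun i => ⌊x i / l⌋

/-- The corner of the cube of side `l` with index `k`. -/
def corner (l : ℝ) (k : Fin d → ℤ) : Pt d := WithLp.toLp 2 fun i => l * k i

lemma measurable_cell (l : ℝ) : Measurable (cell (d := d) l) := by
  refine measurable_pi_iff.2 fun i => ?_
  exact Int.measurable_floor.comp (by fun_prop)

lemma norm_sub_corner_le {l : ℝ} (hl : 0 < l) (x : Pt d) :
    ‖x - corner l (cell l x)‖ ≤ Real.sqrt d * l := by
  rw [EuclideanSpace.norm_eq]
  have h : ∀ i, ‖(x - corner l (cell l x)) i‖ ^ 2 ≤ l ^ 2 := by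
    intro i
    have h1 : (x - corner l (cell l x)) i = l * Int.fract (x i / l) := by
      simp only [corner, cell, PiLp.sub_apply, Int.fract]
      field_simp
    rw [h1, norm_mul, Real.norm_of_nonneg hl.le, Real.norm_of_nonneg (Int.fract_nonneg _)]
    have := Int.fract_lt_one (x i / l)
    have := Int.fract_nonneg (x i / l)
    gcongr
    nlinarith
  calc Real.sqrt (∑ i, ‖(x - corner l (cell l x)) i‖ ^ 2)
      ≤ Real.sqrt (∑ _i : Fin d, l ^ 2) := Real.sqrt_le_sqrt (Finset.sum_le_sum fun i _ => h i)
    _ = Real.sqrt d * l := by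
        rw [Finset.sum_const, Finset.card_univ, Fintype.card_fin, nsmul_eq_mul,
          Real.sqrt_mul (by positivity), Real.sqrt_sq hl.le]

lemma sq_le_of_le_add {A B C δ : ℝ} (hδ : 0 < δ) (hA : 0 ≤ A) (h : A ≤ B + C) :
    A ^ 2 ≤ (1 + δ) * B ^ 2 + (1 + 1 / δ) * C ^ 2 := by
  have h1 : A ^ 2 ≤ (B + C) ^ 2 := by gcongr
  have h2 : 2 * B * C ≤ δ * B ^ 2 + 1 / δ * C ^ 2 := by
    have h3 : 0 ≤ (δ * B - C) ^ 2 / δ := by positivity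
    have h4 : (δ * B - C) ^ 2 / δ = δ * B ^ 2 - 2 * B * C + 1 / δ * C ^ 2 := by
      field_simp
      ring
    linarith
  nlinarith

lemma abs_norm_sub_corner_le {l : ℝ} (hl : 0 < l) (x y : Pt d) :
    |‖x - y‖ - ‖corner l (cell l x) - corner l (cell l y)‖| ≤ 2 * Real.sqrt d * l := by
  have h1 := norm_sub_corner_le hl x
  have h2 := norm_sub_corner_le hl y
  refine (abs_norm_sub_norm_le _ _).trans ?_
  have e : x - y - (corner l (cell l x) - corner l (cell l y))
      = (x - corner l (cell l x)) - (y - corner l (cell l y)) := by abel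
  rw [e]
  refine (norm_sub_le _ _).trans ?_
  linarith

/-- Compare both costs with the cost between cell corners, which has the same integral under q and
r. Each passage changes distances by at most 2√d l; Young's inequality, used twice, gives (1 + δ)² ≤
1 + 3δ. -/
lemma lintegral_cost_le {q r : Measure (Pt d × Pt d)} {l δ : ℝ} (hl : 0 < l) (hδ : 0 < δ)
    (hδ1 : δ ≤ 1) (h : r.map (Prod.map (cell l) (cell l)) = q.map (Prod.map (cell l) (cell l))) :
    ∫⁻ z, ‖z.1 - z.2‖ₑ ^ 2 ∂r ≤ ENNReal.ofReal (1 + 3 * δ) * ∫⁻ z, ‖z.1 - z.2‖ₑ ^ 2 ∂q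
      + ENNReal.ofReal (12 * d * (1 + 1 / δ) * l ^ 2) * q univ := by
  set T := Prod.map (cell (d := d) l) (cell (d := d) l) with hT
  have hTm : Measurable T := (measurable_cell l).prodMap (measurable_cell l)
  set G : (Fin d → ℤ) × (Fin d → ℤ) → ℝ≥0∞ := fun k =>
    ENNReal.ofReal ((1 + δ) * ‖corner (d := d) l k.1 - corner l k.2‖ ^ 2
      + (1 + 1 / δ) * (2 * Real.sqrt d * l) ^ 2) with hG
  have hGm : Measurable G := measurable_of_countable G
  have hcost : ∀ z : Pt d × Pt d, ‖z.1 - z.2‖ₑ ^ 2 = ENNReal.ofReal (‖z.1 - z.2‖ ^ 2) := fun z => by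
    rw [← ofReal_norm, ENNReal.ofReal_pow (norm_nonneg _)]
  calc ∫⁻ z, ‖z.1 - z.2‖ₑ ^ 2 ∂r ≤ ∫⁻ z, G (T z) ∂r := by
        refine lintegral_mono fun z => ?_
        rw [hcost]
        refine ENNReal.ofReal_le_ofReal (sq_le_of_le_add hδ (norm_nonneg _) ?_)
        have := (abs_le.1 (abs_norm_sub_corner_le hl z.1 z.2)).2
        simp only [hT, Prod.map_fst, Prod.map_snd]
        linarith
    _ = ∫⁻ z, G (T z) ∂q := by rw [← lintegral_map hGm hTm, h, lintegral_map hGm hTm]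
    _ ≤ ∫⁻ z, (ENNReal.ofReal (1 + 3 * δ) * ‖z.1 - z.2‖ₑ ^ 2
          + ENNReal.ofReal (12 * d * (1 + 1 / δ) * l ^ 2)) ∂q := by
        refine lintegral_mono fun z => ?_
        rw [hcost, ← ENNReal.ofReal_mul (by positivity), ← ENNReal.ofReal_add (by positivity)
          (by positivity)]
        apply ENNReal.ofReal_le_ofReal
        have h1 := (abs_le.1 (abs_norm_sub_corner_le hl z.1 z.2)).1
        have h2 := sq_le_of_le_add (A := ‖corner l (cell l z.1) - corner l (cell l z.2)‖)
          (B := ‖z.1 - z.2‖) (C := 2 * Real.sqrt d * l) hδ (norm_nonneg _) (by linarith)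
        simp only [hT, Prod.map_fst, Prod.map_snd]
        have h3 : (2 * Real.sqrt d * l) ^ 2 = 4 * d * l ^ 2 := by
          rw [mul_pow, mul_pow, Real.sq_sqrt (by positivity)]; norm_num
        rw [h3] at h2 ⊢
        have h4 : (1 + δ) * (1 + δ) ≤ 1 + 3 * δ := by nlinarith
        have h5 : 0 ≤ (1 + 1 / δ) * (4 * d * l ^ 2) := by positivity
        calc _ ≤ (1 + δ) * ((1 + δ) * ‖z.1 - z.2‖ ^ 2 + (1 + 1 / δ) * (4 * d * l ^ 2))
              + (1 + 1 / δ) * (4 * d * l ^ 2) := by gcongr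
          _ = (1 + δ) * (1 + δ) * ‖z.1 - z.2‖ ^ 2
              + (2 + δ) * ((1 + 1 / δ) * (4 * d * l ^ 2)) := by ring
          _ ≤ (1 + 3 * δ) * ‖z.1 - z.2‖ ^ 2 + 3 * ((1 + 1 / δ) * (4 * d * l ^ 2)) := by
              gcongr; linarith
          _ = _ := by ring
    _ = _ := by
        rw [lintegral_add_right _ measurable_const, lintegral_const_mul _ (by fun_prop),
          lintegral_const]

/-- Every charged cell contributes exactly its mass times the inverse mass, so the integral counts
charged cells, and there are O(l^{-d}) of these in a bounded ball. -/
lemma lintegral_inv_cell_le {α : Measure (Pt d)} [IsFiniteMeasure α] {l : ℝ} (hl : 0 < l)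
    (hl1 : l ≤ 1) (hα : α (Metric.ball 0 (11 / 4))ᶜ = 0) :
    ENNReal.ofReal (l ^ d) * ∫⁻ x, (α (cell l ⁻¹' {cell l x}))⁻¹ ∂α ≤ 9 ^ d := by
  -- Since 11/4 < 3, all charged indices lie in [-n, n]. Moreover l(2n + 1) ≤ 6 + 3l ≤ 9, which is
  -- the source of 9^d.
  set n : ℕ := ⌈3 / l⌉₊ with hn
  set F : Finset (Fin d → ℤ) := Fintype.piFinset fun _ => Finset.Icc (-(n : ℤ)) n with hF
  have hcard : F.card = (2 * n + 1) ^ d := by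
    rw [hF, Fintype.card_piFinset]
    simp only [Int.card_Icc, Finset.prod_const, Finset.card_univ, Fintype.card_fin]
    congr 1
    omega
  have hzero : ∀ k ∉ F, α (cell l ⁻¹' {k}) = 0 := by
    intro k hk
    refine measure_mono_null (fun x hx => ?_) hα
    intro hxb
    apply hk
    rw [hF, Fintype.mem_piFinset]
    intro i
    have hxk : cell l x = k := hx
    rw [Finset.mem_Icc, ← hxk]
    have h1 : ‖x‖ < 11 / 4 := by simpa using hxb
    have h2 : |x i| ≤ ‖x‖ := by simpa using PiLp.norm_apply_le x i
    have h3 := abs_le.1 h2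
    have h4 : 3 / l ≤ n := Nat.le_ceil _
    have h5 : x i / l ≤ 3 / l := by gcongr; linarith
    have h6 : -(3 / l) ≤ x i / l := by
      rw [← neg_div]; gcongr; linarith
    constructor
    · rw [cell, Int.le_floor]; push_cast; linarith
    · have : (⌊x i / l⌋ : ℝ) ≤ n := (Int.floor_le _).trans (h5.trans h4)
      exact_mod_cast this
  have hsum : ∫⁻ x, (α (cell l ⁻¹' {cell l x}))⁻¹ ∂α ≤ F.card := by
    rw [lintegral_comp_countable (measurable_cell l) fun k => (α (cell l ⁻¹' {k}))⁻¹,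
      tsum_eq_sum (s := F) (fun k hk => by rw [hzero k hk, mul_zero])]
    calc _ ≤ ∑ _k ∈ F, (1 : ℝ≥0∞) := Finset.sum_le_sum fun k _ => ENNReal.inv_mul_le_one _
      _ = F.card := by simp
  calc _ ≤ ENNReal.ofReal (l ^ d) * F.card := by gcongr
    _ = ENNReal.ofReal ((l * (2 * n + 1)) ^ d) := by
        rw [hcard, mul_pow, ENNReal.ofReal_mul (by positivity)]
        congr 1
        rw [← ENNReal.ofReal_natCast]
        push_cast
        rfl
    _ ≤ ENNReal.ofReal (9 ^ d) := by
        apply ENNReal.ofReal_le_ofReal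
        gcongr
        have h1 : (n : ℝ) < 3 / l + 1 := Nat.ceil_lt_add_one (by positivity)
        have h2 : l * n ≤ 3 + l := by
          calc l * n ≤ l * (3 / l + 1) := by gcongr
            _ = 3 + l := by field_simp
        linarith
    _ = 9 ^ d := by rw [ENNReal.ofReal_pow (by norm_num)]; norm_num

end Grid

/-! ### Entropy bounds -/

section Entropy

variable {d : ℕ}

/-- Again the tangent of t log t, now at w: Gibbs' inequality before integration. -/
lemma mul_log_ge {u w : ℝ} (hu : 0 ≤ u) (hw : 0 < w) : u * Real.log w + u - w ≤ u * Real.log u := by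
  rcases hu.eq_or_lt with rfl | hu
  · simp [hw.le]
  · have h := Real.log_le_sub_one_of_pos (div_pos hw hu)
    rw [Real.log_div hw.ne' hu.ne'] at h
    have h2 := mul_le_mul_of_nonneg_left h hu.le
    have h3 : u * (w / u - 1) = w - u := by field_simp
    rw [h3] at h2
    linarith

lemma neg_one_le_mul_log {u : ℝ} (hu : 0 ≤ u) : -1 ≤ u * Real.log u := by
  have := mul_log_ge hu one_pos
  rw [Real.log_one] at this
  linarith

/-- The product of the balls of radius `11/4`. -/
def bigBox (d : ℕ) : Set (Pt d × Pt d) := Metric.ball 0 (11 / 4) ×ˢ Metric.ball 0 (11 / 4)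

lemma measurableSet_bigBox : MeasurableSet (bigBox d) := measurableSet_ball.prod measurableSet_ball

/-- The block measure is defined through α ⊗ β but its entropy is needed relative to λ ⊗ μ. As α ≤ λ
and β ≤ μ, the density relative to the larger measure is still at most the inverse mass of the first
cell. -/
lemma exists_block_density {lam mu α β : Measure (Pt d)} [IsFiniteMeasure lam] [IsFiniteMeasure mu]
    [IsFiniteMeasure α] [IsFiniteMeasure β] (hαl : α ≤ lam) (hβm : β ≤ mu)
    (hα : α (Metric.ball 0 (11 / 4))ᶜ = 0) (hβ : β (Metric.ball 0 (11 / 4))ᶜ = 0)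
    {q : Measure (Pt d × Pt d)} (hq₁ : q.map Prod.fst = α) (hq₂ : q.map Prod.snd = β)
    {l : ℝ} (hl : 0 < l) (hl1 : l ≤ 1) :
    ∃ b : Pt d × Pt d → ℝ, Measurable b ∧ (∀ z, 0 ≤ b z) ∧ (∀ z ∉ bigBox d, b z = 0) ∧
      Integrable b (lam.prod mu) ∧ den (lam.prod mu) b = block α β q (cell l) (cell l) ∧
      Integrable (fun z => b z * Real.log (b z)) (lam.prod mu) ∧
      ∫ z, b z * Real.log (b z) ∂(lam.prod mu)
        ≤ (-Real.log (l ^ d) - 1) * α.real univ + 9 ^ d := by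
  set ν := lam.prod mu with hν
  have hT := measurable_cell (d := d) l
  set r := block α β q (cell l) (cell l) with hr
  set k : Pt d × Pt d → ℝ≥0∞ :=
    fun z => blockDensity α β q (cell l) (cell l) (cell l z.1) (cell l z.2) with hk
  have hkm : Measurable k := measurable_blockDensity hT hT
  have hr₁ : r.map Prod.fst = α := block_map_fst hq₁ hq₂ hT hT
  have hr₂ : r.map Prod.snd = β := block_map_snd hq₁ hq₂ hT hT
  have hrfin : IsFiniteMeasure r := by
    constructor
    have h1 : r univ = α univ := by
      rw [← hr₁, Measure.map_apply measurable_fst MeasurableSet.univ, preimage_univ]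
    rw [h1]
    exact measure_lt_top _ _
  have hprod : α.prod β ≤ ν := Measure.prod_mono hαl hβm
  have hrac : r ≪ ν := (withDensity_absolutelyContinuous _ _).trans hprod.absolutelyContinuous
  set D := r.rnDeriv ν with hD
  have hDm : Measurable D := Measure.measurable_rnDeriv _ _
  have hDν : ν.withDensity D = r := Measure.withDensity_rnDeriv_eq r ν hrac
  have hDk : D ≤ᵐ[ν] k := by
    refine ae_le_of_forall_setLIntegral_le_of_sigmaFinite hDm fun S hS _ => ?_
    rw [← withDensity_apply _ hS, hDν, hr, block, withDensity_apply _ hS]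
    exact lintegral_mono' (Measure.restrict_mono le_rfl hprod) le_rfl
  have hrQ : r (bigBox d)ᶜ = 0 := by
    have h1 : r (Prod.fst ⁻¹' (Metric.ball 0 (11 / 4))ᶜ) = 0 := by
      rw [← Measure.map_apply measurable_fst measurableSet_ball.compl, hr₁, hα]
    have h2 : r (Prod.snd ⁻¹' (Metric.ball 0 (11 / 4))ᶜ) = 0 := by
      rw [← Measure.map_apply measurable_snd measurableSet_ball.compl, hr₂, hβ]
    refine measure_mono_null (fun z hz => ?_) (measure_union_null h1 h2)
    by_contra hcon
    simp only [mem_union, mem_preimage, mem_compl_iff, not_or, not_not] at hcon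
    exact hz hcon
  have hDQ : ∀ᵐ z ∂ν, z ∉ bigBox d → D z = 0 := by
    have h1 : ∫⁻ z in (bigBox d)ᶜ, D z ∂ν = 0 := by
      rw [← withDensity_apply _ measurableSet_bigBox.compl, hDν, hrQ]
    rw [lintegral_eq_zero_iff hDm, Filter.EventuallyEq,
      ae_restrict_iff' measurableSet_bigBox.compl] at h1
    exact h1
  have hkα : ∀ z, k z ≤ (α (cell l ⁻¹' {cell l z.1}))⁻¹ := fun z => blockDensity_le hq₂ hT _ _
  have hk0 : ∀ z, α (cell l ⁻¹' {cell l z.1}) = 0 → k z = 0 := fun z hz =>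
    blockDensity_eq_zero hq₁ hT hz
  have hktop : ∀ z, k z ≠ ∞ := fun z hz => by
    by_cases h : α (cell l ⁻¹' {cell l z.1}) = 0
    · rw [hk0 z h] at hz
      exact ENNReal.zero_ne_top hz
    · have := hkα z
      rw [hz, top_le_iff, ENNReal.inv_eq_top] at this
      exact h this
  -- The minimum and the indicator change the Radon–Nikodym derivative on a null set only, and make
  -- the bounds hold at every point.
  set b : Pt d × Pt d → ℝ := (bigBox d).indicator fun z => (min (D z) (k z)).toReal with hb
  have hbm : Measurable b := ((hDm.min hkm).ennreal_toReal).indicator measurableSet_bigBox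
  have hb0 : ∀ z, 0 ≤ b z := fun z => indicator_nonneg (fun z _ => ENNReal.toReal_nonneg) z
  have hbQ : ∀ z ∉ bigBox d, b z = 0 := fun z hz => indicator_of_notMem hz _
  have hbk : ∀ z, b z ≤ (k z).toReal := fun z => by
    by_cases hz : z ∈ bigBox d
    · rw [hb, indicator_of_mem hz]
      exact ENNReal.toReal_mono (hktop z) (min_le_right _ _)
    · rw [hbQ z hz]
      exact ENNReal.toReal_nonneg
  have hbr : den ν b = r := by
    rw [den, ← hDν]
    refine withDensity_congr_ae ?_
    filter_upwards [hDk, hDQ] with z h1 h2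
    by_cases hz : z ∈ bigBox d
    · rw [hb, indicator_of_mem hz, min_eq_left h1,
        ENNReal.ofReal_toReal (ne_top_of_le_ne_top (hktop z) h1)]
    · rw [hbQ z hz, h2 hz, ENNReal.ofReal_zero]
  have hbi : Integrable b ν := by
    have := (integrable_den hbm hb0 (fun _ => 1)).1 (by rw [hbr]; exact integrable_const _)
    simpa using this
  -- With w the volume of a cube, log(w/α(cell)) ≤ w/α(cell) - 1. So the logarithm of the density is
  -- -log w plus a term whose integral is controlled by the number of cells.
  set w := l ^ d with hw
  have hw0 : 0 < w := by positivity
  set g : Pt d → ℝ := fun x => w / α.real (cell l ⁻¹' {cell l x}) with hg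
  have hgm : Measurable g := by
    have : Measurable fun i : Fin d → ℤ => w / α.real (cell l ⁻¹' {i}) := measurable_of_countable _
    exact this.comp hT
  have hg0 : ∀ x, 0 ≤ g x := fun x => by positivity
  have hglint : ∫⁻ x, ENNReal.ofReal (g x) ∂α ≤ 9 ^ d := by
    refine le_trans ?_ (lintegral_inv_cell_le hl hl1 hα)
    rw [← lintegral_const_mul' _ _ ENNReal.ofReal_ne_top]
    refine lintegral_mono fun x => ?_
    simp only [hg]
    by_cases hx : α (cell l ⁻¹' {cell l x}) = 0
    · simp [measureReal_def, hx]
    · have hpos : 0 < α.real (cell l ⁻¹' {cell l x}) :=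
        ENNReal.toReal_pos hx (measure_ne_top _ _)
      rw [ENNReal.ofReal_div_of_pos hpos, ofReal_measureReal]
      exact le_rfl
  have hgi : Integrable g α := by
    refine ⟨hgm.aestronglyMeasurable, ?_⟩
    rw [hasFiniteIntegral_iff_ofReal (ae_of_all _ hg0)]
    exact hglint.trans_lt (by simp)
  have hgint : ∫ x, g x ∂α ≤ 9 ^ d := by
    rw [integral_eq_lintegral_of_nonneg_ae (ae_of_all _ hg0) hgm.aestronglyMeasurable]
    refine ENNReal.toReal_le_of_le_ofReal (by positivity) (hglint.trans (le_of_eq ?_))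
    rw [ENNReal.ofReal_pow (by norm_num)]
    norm_num
  have hgmap : Integrable g (r.map Prod.fst) := by rw [hr₁]; exact hgi
  have hgb : Integrable (fun z => g z.1 * b z) ν := by
    rw [← integrable_den hbm hb0 (fun z => g z.1), hbr]
    exact (integrable_map_measure hgm.aestronglyMeasurable measurable_fst.aemeasurable).1 hgmap
  have hgbint : ∫ z, g z.1 * b z ∂ν = ∫ x, g x ∂α := by
    rw [← integral_comp_den hbm hb0 measurable_fst hgm, hbr, hr₁]
  have hbint : ∫ z, b z ∂ν = α.real univ := by
    have h1 := integral_comp_den (ν := ν) hbm hb0 measurable_fst (F := fun _ => (1 : ℝ))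
      measurable_const
    rw [hbr, hr₁] at h1
    simpa using h1.symm
  have hup : ∀ z, b z * Real.log (b z) ≤ (-Real.log w - 1) * b z + g z.1 * b z := by
    intro z
    rcases (hb0 z).eq_or_lt with h | h
    · simp [← h]
    have hα0 : α (cell l ⁻¹' {cell l z.1}) ≠ 0 := fun h0 => by
      have := hbk z
      rw [hk0 z h0, ENNReal.toReal_zero] at this
      linarith
    have hpos : 0 < α.real (cell l ⁻¹' {cell l z.1}) := ENNReal.toReal_pos hα0 (measure_ne_top _ _)
    have h1 : b z ≤ (α.real (cell l ⁻¹' {cell l z.1}))⁻¹ := by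
      refine (hbk z).trans ?_
      rw [measureReal_def, ← ENNReal.toReal_inv]
      exact ENNReal.toReal_mono (ENNReal.inv_ne_top.2 hα0) (hkα z)
    have h2 := Real.log_le_log h h1
    rw [Real.log_inv] at h2
    have h3 := Real.log_le_sub_one_of_pos (div_pos hw0 hpos)
    rw [Real.log_div hw0.ne' hpos.ne'] at h3
    have h4 : Real.log (b z) ≤ -Real.log w - 1 + g z.1 := by
      simp only [hg]; linarith
    calc b z * Real.log (b z) ≤ b z * (-Real.log w - 1 + g z.1) := by gcongr
      _ = _ := by ring
  have hdom : Integrable (fun z => (-Real.log w - 1) * b z + g z.1 * b z) ν :=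
    (hbi.const_mul _).add hgb
  have hφi : Integrable (fun z => b z * Real.log (b z)) ν := by
    refine (hdom.norm.add (integrable_const (1 : ℝ))).mono' (by fun_prop) (ae_of_all _ fun z => ?_)
    simp only [Pi.add_apply]
    rw [Real.norm_eq_abs, Real.norm_eq_abs, abs_le]
    have h1 := neg_one_le_mul_log (hb0 z)
    have h2 := le_abs_self ((-Real.log w - 1) * b z + g z.1 * b z)
    have h3 := abs_nonneg ((-Real.log w - 1) * b z + g z.1 * b z)
    have h4 := hup z
    constructor <;> linarith
  refine ⟨b, hbm, hb0, hbQ, hbi, hbr, hφi, ?_⟩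
  have := integral_mono hφi hdom hup
  rw [integral_add (hbi.const_mul _) hgb, integral_const_mul, hbint, hgbint] at this
  linarith

/-- The heat kernel, up to normalisation. -/
def heat (σ : ℝ) (z : Pt d × Pt d) : ℝ := (σ ^ d)⁻¹ * Real.exp (-(1 / σ ^ 2) * ‖z.1 - z.2‖ ^ 2)

lemma heat_pos {σ : ℝ} (hσ : 0 < σ) (z : Pt d × Pt d) : 0 < heat σ z := by
  unfold heat; positivity

@[fun_prop]
lemma measurable_heat (σ : ℝ) : Measurable (heat (d := d) σ) := by unfold heat; fun_prop

lemma heat_swap (σ : ℝ) (x y : Pt d) : heat σ (x, y) = heat σ (y, x) := by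
  simp only [heat]; rw [norm_sub_rev]

lemma lintegral_heat {σ : ℝ} (hσ : 0 < σ) (y : Pt d) :
    ∫⁻ x, ENNReal.ofReal (heat σ (x, y)) = ENNReal.ofReal (Real.pi ^ ((d : ℝ) / 2)) := by
  have h1 := GaussianFourier.integral_rexp_neg_mul_sq_norm (V := Pt d)
    (b := 1 / σ ^ 2) (by positivity)
  have h2 : (Real.pi / (1 / σ ^ 2)) ^ ((Module.finrank ℝ (Pt d) : ℝ) / 2)
      = Real.pi ^ ((d : ℝ) / 2) * σ ^ d := by
    rw [finrank_euclideanSpace_fin, div_div_eq_mul_div, div_one,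
      Real.mul_rpow Real.pi_pos.le (by positivity)]
    congr 1
    rw [← Real.rpow_natCast, ← Real.rpow_mul hσ.le, ← Real.rpow_natCast]
    congr 1
    push_cast; ring
  rw [h2] at h1
  -- Integrability is read off from the value: the integral of a non-integrable function is zero by
  -- convention.
  have h3 : Integrable fun v : Pt d => Real.exp (-(1 / σ ^ 2) * ‖v‖ ^ 2) := by
    by_contra hcon
    rw [integral_undef hcon] at h1
    have : 0 < Real.pi ^ ((d : ℝ) / 2) * σ ^ d := by positivity
    linarith
  simp only [heat]
  rw [lintegral_sub_right_eq_self
    (fun v : Pt d => ENNReal.ofReal ((σ ^ d)⁻¹ * Real.exp (-(1 / σ ^ 2) * ‖v‖ ^ 2))) y,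
    ← ofReal_integral_eq_lintegral_ofReal (h3.const_mul _) (ae_of_all _ fun v => by positivity),
    integral_const_mul, h1]
  congr 1
  field_simp

lemma setLIntegral_heat_le {lam : Measure (Pt d)}
    (hlam : ∀ S ⊆ Metric.ball (0 : Pt d) 1, MeasurableSet S → lam S ≤ 2 * volume S)
    {σ : ℝ} (hσ : 0 < σ) (y : Pt d) :
    ∫⁻ x in Metric.ball 0 1, ENNReal.ofReal (heat σ (x, y)) ∂lam
      ≤ 2 * ENNReal.ofReal (Real.pi ^ ((d : ℝ) / 2)) := by
  have hle : lam.restrict (Metric.ball 0 1) ≤ (2 : ℝ≥0∞) • (volume : Measure (Pt d)) := by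
    refine Measure.le_iff.2 fun S hS => ?_
    rw [Measure.restrict_apply hS, Measure.smul_apply, smul_eq_mul]
    refine (hlam _ inter_subset_right (hS.inter measurableSet_ball)).trans ?_
    gcongr
    exact inter_subset_left
  refine (lintegral_mono' hle le_rfl).trans ?_
  rw [lintegral_smul_measure, lintegral_heat hσ, smul_eq_mul]

/-- On each half of the set one coordinate lies in B_1, where the measure is dominated by Lebesgue
measure; that coordinate is integrated first. The other one contributes the mass of B_{11/4}, so no
density bound is needed beyond B_1. -/
lemma lintegral_pset_heat_le {lam mu : Measure (Pt d)} [IsFiniteMeasure lam] [IsFiniteMeasure mu]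
    (hlam : ∀ S ⊆ Metric.ball (0 : Pt d) 1, MeasurableSet S → lam S ≤ 2 * volume S)
    (hmu : ∀ S ⊆ Metric.ball (0 : Pt d) 1, MeasurableSet S → mu S ≤ 2 * volume S)
    {σ : ℝ} (hσ : 0 < σ) :
    ∫⁻ z in pset d (11 / 4) 1, ENNReal.ofReal (heat σ z) ∂(lam.prod mu)
      ≤ 2 * ENNReal.ofReal (Real.pi ^ ((d : ℝ) / 2))
        * (lam (Metric.ball 0 (11 / 4)) + mu (Metric.ball 0 (11 / 4))) := by
  set G := 2 * ENNReal.ofReal (Real.pi ^ ((d : ℝ) / 2)) with hG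
  have hm : Measurable fun z : Pt d × Pt d => ENNReal.ofReal (heat σ z) := by fun_prop
  rw [pset, mul_one]
  refine (lintegral_union_le _ _ _).trans ?_
  rw [mul_add, add_comm]
  refine add_le_add ?_ ?_
  · rw [← Measure.prod_restrict, lintegral_prod _ hm.aemeasurable]
    calc _ ≤ ∫⁻ _x in Metric.ball 0 (11 / 4), G ∂lam := by
          refine lintegral_mono fun x => ?_
          simp_rw [heat_swap σ x]
          exact setLIntegral_heat_le hmu hσ x
      _ = _ := by rw [setLIntegral_const]
  · rw [← Measure.prod_restrict, lintegral_prod_symm _ hm.aemeasurable]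
    calc _ ≤ ∫⁻ _y in Metric.ball 0 (11 / 4), G ∂mu :=
          lintegral_mono fun y => setLIntegral_heat_le hlam hσ y
      _ = _ := by rw [setLIntegral_const]

end Entropy

/-! ### Comparison with the block approximation -/

section Compare

variable {d : ℕ}

/-- Take the tangent at (u + v)/2 for both summands. -/
lemma add_mul_log_le {u v : ℝ} (hu : 0 ≤ u) (hv : 0 ≤ v) :
    (u + v) * Real.log (u + v)
      ≤ u * Real.log u + v * Real.log v + Real.log 2 * (u + v) := by
  rcases (add_nonneg hu hv).eq_or_lt with h | h
  · have hu' : u = 0 := by linarith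
    have hv' : v = 0 := by linarith
    simp [hu', hv']
  · have h1 := mul_log_ge hu (half_pos h)
    have h2 := mul_log_ge hv (half_pos h)
    rw [Real.log_div h.ne' two_ne_zero] at h1 h2
    nlinarith

lemma pset_subset_bigBox : pset d (11 / 4) 1 ⊆ bigBox d := by
  have h : Metric.ball (0 : Pt d) 1 ⊆ Metric.ball 0 (11 / 4) :=
    Metric.ball_subset_ball (by norm_num)
  rintro z (hz | hz)
  · exact ⟨h hz.1, by simpa using hz.2⟩
  · exact ⟨by simpa using hz.1, h hz.2⟩

lemma norm_le_of_mem_bigBox {z : Pt d × Pt d} (hz : z ∈ bigBox d) : ‖z‖ ≤ 11 / 4 := by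
  have h1 : ‖z.1‖ < 11 / 4 := by simpa using hz.1
  have h2 : ‖z.2‖ < 11 / 4 := by simpa using hz.2
  exact max_le h1.le h2.le

lemma isFiniteMeasure_of_map_fst {lam : Measure (Pt d)} [IsFiniteMeasure lam]
    {p : Measure (Pt d × Pt d)} (h : p.map Prod.fst = lam) : IsFiniteMeasure p := by
  constructor
  have h1 : p univ = lam univ := by
    rw [← h, Measure.map_apply measurable_fst MeasurableSet.univ, preimage_univ]
  rw [h1]
  exact measure_lt_top _ _

lemma log_heat {σ : ℝ} (hσ : 0 < σ) (z : Pt d × Pt d) :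
    Real.log (heat σ z) = -Real.log (σ ^ d) - 1 / σ ^ 2 * ‖z.1 - z.2‖ ^ 2 := by
  rw [heat, Real.log_mul (by positivity) (Real.exp_pos _).ne', Real.log_inv, Real.log_exp]
  ring

lemma restrict_den {X : Type*} [MeasurableSpace X] (ν : Measure X) (ρ : X → ℝ) {S : Set X}
    (hS : MeasurableSet S) : (den ν ρ).restrict S = den ν (S.indicator ρ) := by
  rw [den, den, restrict_withDensity hS, ← withDensity_indicator hS]
  congr 1
  ext z
  by_cases hz : z ∈ S <;> simp [hz]

lemma lintegral_cost_eq {ν : Measure (Pt d × Pt d)} {a : Pt d × Pt d → ℝ} (ha : Measurable a)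
    (ha0 : ∀ z, 0 ≤ a z) (hi : Integrable (fun z => ‖z.1 - z.2‖ ^ 2 * a z) ν) :
    ∫⁻ z, ‖z.1 - z.2‖ₑ ^ 2 ∂(den ν a)
      = ENNReal.ofReal (∫ z, ‖z.1 - z.2‖ ^ 2 * a z ∂ν) := by
  rw [lintegral_den ha (by fun_prop), ofReal_integral_eq_lintegral_ofReal hi
    (ae_of_all _ fun z => mul_nonneg (by positivity) (ha0 z))]
  refine lintegral_congr fun z => ?_
  rw [ENNReal.ofReal_mul (by positivity), ENNReal.ofReal_pow (norm_nonneg _), ofReal_norm]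

/-- The constant in the comparison with the block approximation. -/
def blockConst (d : ℕ) (δ : ℝ) : ℝ :=
  12 * d * (1 + 1 / δ) - d / 2 * Real.log δ + 4 * Real.pi ^ ((d : ℝ) / 2) + 2 * Real.log 2

/-- Lower bound of the entropy on `P_1`. -/
lemma neg_entropy_pset_le {lam mu : Measure (Pt d)} [IsFiniteMeasure lam] [IsFiniteMeasure mu]
    {a : Pt d × Pt d → ℝ} (ha0 : ∀ z, 0 ≤ a z)
    (haP : ∀ z ∉ pset d (11 / 4) 1, a z = 0) (hai : Integrable a (lam.prod mu))
    (hφa : Integrable (fun z => a z * Real.log (a z)) (lam.prod mu)) {M₀ : ℝ} (hM₀ : 0 ≤ M₀)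
    (hl₀ : lam (Metric.ball 0 (11 / 4)) ≤ ENNReal.ofReal M₀)
    (hm₀ : mu (Metric.ball 0 (11 / 4)) ≤ ENNReal.ofReal M₀)
    (hlam : ∀ S ⊆ Metric.ball (0 : Pt d) 1, MeasurableSet S → lam S ≤ 2 * volume S)
    (hmu : ∀ S ⊆ Metric.ball (0 : Pt d) 1, MeasurableSet S → mu S ≤ 2 * volume S)
    {σ : ℝ} (hσ : 0 < σ) :
    -∫ z, a z * Real.log (a z) ∂(lam.prod mu)
      ≤ Real.log (σ ^ d) * ∫ z, a z ∂(lam.prod mu)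
        + 1 / σ ^ 2 * ∫ z, ‖z.1 - z.2‖ ^ 2 * a z ∂(lam.prod mu)
        - ∫ z, a z ∂(lam.prod mu) + 4 * Real.pi ^ ((d : ℝ) / 2) * M₀ := by
  set ν := lam.prod mu with hν
  have hPm := measurableSet_pset (d := d) (11 / 4) 1
  have hca : Integrable (fun z => ‖z.1 - z.2‖ ^ 2 * a z) ν :=
    integrable_mul_of_bounded_support (r := 11 / 4) hai
      (fun z hz => haP z fun h =>
        absurd (norm_le_of_mem_bigBox (pset_subset_bigBox h)) (not_le.2 hz)) (by fun_prop)
  set w := (pset d (11 / 4) 1).indicator (heat (d := d) σ) with hw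
  have hw0 : ∀ z, 0 ≤ w z := fun z => indicator_nonneg (fun z _ => (heat_pos hσ z).le) z
  have hwm : Measurable w := (measurable_heat σ).indicator hPm
  have hwl : ∫⁻ z, ENNReal.ofReal (w z) ∂ν
      ≤ ENNReal.ofReal (4 * Real.pi ^ ((d : ℝ) / 2) * M₀) := by
    have h1 : ∀ z, ENNReal.ofReal (w z)
        = (pset d (11 / 4) 1).indicator (fun z => ENNReal.ofReal (heat σ z)) z := fun z => by
      by_cases hz : z ∈ pset d (11 / 4) 1 <;> simp [hw, hz]
    simp_rw [h1]
    rw [lintegral_indicator hPm]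
    refine (lintegral_pset_heat_le hlam hmu hσ).trans ?_
    calc _ ≤ 2 * ENNReal.ofReal (Real.pi ^ ((d : ℝ) / 2))
          * (ENNReal.ofReal M₀ + ENNReal.ofReal M₀) := by gcongr
      _ = _ := by
        rw [← ENNReal.ofReal_add hM₀ hM₀, ENNReal.ofReal_mul (by positivity),
          ENNReal.ofReal_mul (by norm_num)]
        rw [show M₀ + M₀ = 2 * M₀ by ring, ENNReal.ofReal_mul (by norm_num)]
        rw [show (4 : ℝ) = 2 * 2 by norm_num, ENNReal.ofReal_mul (by norm_num)]
        simp only [ENNReal.ofReal_ofNat]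
        ring
  have hwi : Integrable w ν := by
    refine ⟨hwm.aestronglyMeasurable, ?_⟩
    rw [hasFiniteIntegral_iff_ofReal (ae_of_all _ hw0)]
    exact hwl.trans_lt ENNReal.ofReal_lt_top
  have hwint : ∫ z, w z ∂ν ≤ 4 * Real.pi ^ ((d : ℝ) / 2) * M₀ := by
    rw [integral_eq_lintegral_of_nonneg_ae (ae_of_all _ hw0) hwm.aestronglyMeasurable]
    exact ENNReal.toReal_le_of_le_ofReal (by positivity) hwl
  -- Gibbs' inequality against the heat kernel on P_1; the logarithm of the kernel produces the
  -- transport cost.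
  have hpt : ∀ z, -(a z * Real.log (a z)) ≤ Real.log (σ ^ d) * a z
      + 1 / σ ^ 2 * (‖z.1 - z.2‖ ^ 2 * a z) - a z + w z := by
    intro z
    by_cases hz : z ∈ pset d (11 / 4) 1
    · have h1 := mul_log_ge (ha0 z) (heat_pos hσ z)
      rw [log_heat hσ] at h1
      simp only [hw, indicator_of_mem hz]
      linarith
    · rw [haP z hz]
      simpa using hw0 z
  have hi1 : Integrable (fun z => Real.log (σ ^ d) * a z) ν := hai.const_mul _
  have hi2 : Integrable (fun z => 1 / σ ^ 2 * (‖z.1 - z.2‖ ^ 2 * a z)) ν := hca.const_mul _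
  have hi12 : Integrable (fun z => Real.log (σ ^ d) * a z
      + 1 / σ ^ 2 * (‖z.1 - z.2‖ ^ 2 * a z)) ν := hi1.add hi2
  have hi123 : Integrable (fun z => Real.log (σ ^ d) * a z
      + 1 / σ ^ 2 * (‖z.1 - z.2‖ ^ 2 * a z) - a z) ν := hi12.sub hai
  have hfin := integral_mono hφa.neg (hi123.add hwi) hpt
  simp only [Pi.neg_apply, Pi.add_apply] at hfin
  rw [integral_neg, integral_add hi123 hwi, integral_sub hi12 hai, integral_add hi1 hi2,
    integral_const_mul, integral_const_mul] at hfin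
  linarith

/-- The competitor removes ρ on P_1 and inserts the block approximation of q. The upper bound for
the inserted entropy and the lower bound for the removed one share the term -log(l^d) times the
mass, so their difference is free of log h. -/
lemma LocMin.block_bound {h δ : ℝ} (hh : 0 < h) (hh1 : h ≤ 1) (hδ : 0 < δ) (hδ1 : δ ≤ 1)
    {lam mu : Measure (Pt d)} [IsFiniteMeasure lam] [IsFiniteMeasure mu] {ρ : Pt d × Pt d → ℝ}
    (H : LocMin h lam mu ρ) (hmem : den (lam.prod mu) ρ ∈ couplings lam mu)
    (hlam : ∀ S ⊆ Metric.ball (0 : Pt d) 1, MeasurableSet S → lam S ≤ 2 * volume S)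
    (hmu : ∀ S ⊆ Metric.ball (0 : Pt d) 1, MeasurableSet S → mu S ≤ 2 * volume S)
    {q : Measure (Pt d × Pt d)}
    (hq₁ : q.map Prod.fst = ((den (lam.prod mu) ρ).restrict (pset d (11 / 4) 1)).map Prod.fst)
    (hq₂ : q.map Prod.snd = ((den (lam.prod mu) ρ).restrict (pset d (11 / 4) 1)).map Prod.snd) :
    ∫⁻ z in pset d (11 / 4) 1, ‖z.1 - z.2‖ₑ ^ 2 ∂(den (lam.prod mu) ρ)
      ≤ ENNReal.ofReal (1 + 3 * δ) * ∫⁻ z, ‖z.1 - z.2‖ₑ ^ 2 ∂q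
        + ENNReal.ofReal δ
          * ∫⁻ z in pset d (11 / 4) 1, ‖z.1 - z.2‖ₑ ^ 2 ∂(den (lam.prod mu) ρ)
        + ENNReal.ofReal (h * (blockConst d δ * (den (lam.prod mu) ρ).real (cross d (11 / 4))
          + 9 ^ d)) := by
  set ν := lam.prod mu with hν
  set p := den ν ρ with hp
  set P := pset d (11 / 4) 1 with hP
  have hPm : MeasurableSet P := measurableSet_pset _ _
  have hpfin : IsFiniteMeasure p := isFiniteMeasure_of_map_fst hmem.1
  have hρm := H.meas
  set a := P.indicator ρ with ha
  have ham : Measurable a := hρm.indicator hPm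
  have ha0 : ∀ z, 0 ≤ a z := fun z => indicator_nonneg (fun z _ => H.nonneg z) z
  have haρ : ∀ z, a z ≤ ρ z := fun z => indicator_le_self' (fun z _ => H.nonneg z) z
  have haP : ∀ z ∉ P, a z = 0 := fun z hz => indicator_of_notMem hz _
  have hai : Integrable a ν := H.integrable.indicator hPm
  have hpa : p.restrict P = den ν a := restrict_den ν ρ hPm
  set α := (p.restrict P).map Prod.fst with hα
  set β := (p.restrict P).map Prod.snd with hβ
  have hαl : α ≤ lam := by
    rw [← hmem.1]; exact Measure.map_mono Measure.restrict_le_self measurable_fst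
  have hβm : β ≤ mu := by
    rw [← hmem.2]; exact Measure.map_mono Measure.restrict_le_self measurable_snd
  have hα0 : α (Metric.ball 0 (11 / 4))ᶜ = 0 := by
    rw [hα, Measure.map_apply measurable_fst measurableSet_ball.compl,
      Measure.restrict_apply (measurable_fst measurableSet_ball.compl)]
    convert measure_empty (μ := p)
    ext z
    simp only [mem_inter_iff, mem_preimage, mem_compl_iff, mem_empty_iff_false, iff_false, not_and]
    exact fun h1 h2 => h1 (pset_subset_bigBox h2).1
  have hβ0 : β (Metric.ball 0 (11 / 4))ᶜ = 0 := by
    rw [hβ, Measure.map_apply measurable_snd measurableSet_ball.compl,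
      Measure.restrict_apply (measurable_snd measurableSet_ball.compl)]
    convert measure_empty (μ := p)
    ext z
    simp only [mem_inter_iff, mem_preimage, mem_compl_iff, mem_empty_iff_false, iff_false, not_and]
    exact fun h1 h2 => h1 (pset_subset_bigBox h2).2
  -- Cubes of side ε = √h: the discretisation error l² then has the size of the entropic weight h.
  set l := Real.sqrt h with hl
  have hl0 : 0 < l := Real.sqrt_pos.2 hh
  have hl1 : l ≤ 1 := Real.sqrt_le_one.2 hh1
  have hl2 : l ^ 2 = h := Real.sq_sqrt hh.le
  obtain ⟨b, hbm, hb0, hbQ, hbi, hbr, hφb, hφbint⟩ :=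
    exists_block_density hαl hβm hα0 hβ0 hq₁ hq₂ hl0 hl1
  rw [← hν] at hbi hbr hφb hφbint
  have hT := measurable_cell (d := d) l
  set M := α.real univ with hM
  set M₀ := p.real (cross d (11 / 4)) with hM₀
  have hM₀0 : 0 ≤ M₀ := measureReal_nonneg
  have hM₀e : ENNReal.ofReal M₀ = p (cross d (11 / 4)) := ofReal_measureReal
  have hMP : M = p.real P := by
    rw [hM, hα, measureReal_def, Measure.map_apply measurable_fst MeasurableSet.univ,
      preimage_univ, Measure.restrict_apply_univ]
    rfl
  have hbox : bigBox d ⊆ cross d (11 / 4) := fun z hz => Or.inl ⟨hz.1, mem_univ _⟩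
  have hMM₀ : M ≤ M₀ := by
    rw [hMP]; exact measureReal_mono (pset_subset_bigBox.trans hbox)
  have hl₀ : lam (Metric.ball 0 (11 / 4)) ≤ ENNReal.ofReal M₀ := by
    rw [hM₀e, ← hmem.1, Measure.map_apply measurable_fst measurableSet_ball]
    exact measure_mono fun z hz => Or.inl ⟨hz, mem_univ _⟩
  have hm₀ : mu (Metric.ball 0 (11 / 4)) ≤ ENNReal.ofReal M₀ := by
    rw [hM₀e, ← hmem.2, Measure.map_apply measurable_snd measurableSet_ball]
    exact measure_mono fun z hz => Or.inr ⟨mem_univ _, hz⟩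
  have hsupp : ∀ z : Pt d × Pt d, 11 / 4 < ‖z‖ → a z = 0 ∧ b z = 0 := fun z hz =>
    ⟨haP z fun h => absurd (norm_le_of_mem_bigBox (pset_subset_bigBox h)) (not_le.2 hz),
      hbQ z fun h => absurd (norm_le_of_mem_bigBox h) (not_le.2 hz)⟩
  have hφa_eq : ∀ z, a z * Real.log (a z) = P.indicator (fun z => ρ z * Real.log (ρ z)) z := by
    intro z
    by_cases hz : z ∈ P <;> simp [ha, hz]
  have hφa : Integrable (fun z => a z * Real.log (a z)) ν := by
    simp_rw [hφa_eq]
    exact H.entropy.indicator hPm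
  set D : Pt d × Pt d → ℝ := fun z => (ρ z - a z + b z) * Real.log (ρ z - a z + b z)
    - ρ z * Real.log (ρ z) with hD
  -- Where a is nonzero it equals ρ, so removing it costs exactly its entropy. But b may also charge
  -- the box outside P_1, where ρ is kept, and this overlap costs log 2 times the mass.
  set U : Pt d × Pt d → ℝ := fun z => -(a z * Real.log (a z)) + b z * Real.log (b z)
    + Real.log 2 * ((bigBox d).indicator ρ z + b z) with hU
  have hlog2 : 0 ≤ Real.log 2 := Real.log_nonneg (by norm_num)
  have hDU : ∀ z, D z ≤ U z := by
    intro z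
    have h1 : (ρ z - a z) * Real.log (ρ z - a z) - ρ z * Real.log (ρ z)
        = -(a z * Real.log (a z)) := by
      by_cases hz : z ∈ P <;> simp [ha, hz]
    have h2 : 0 ≤ (bigBox d).indicator ρ z := indicator_nonneg (fun z _ => H.nonneg z) z
    simp only [hD, hU]
    by_cases hb : b z = 0
    · have h3 := mul_nonneg hlog2 h2
      simp only [hb, add_zero, Real.log_zero, mul_zero]
      linarith
    · have hzQ : z ∈ bigBox d := by
        by_contra hcon; exact hb (hbQ z hcon)
      have h3 := add_mul_log_le (sub_nonneg.2 (haρ z)) (hb0 z)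
      have h4 : ρ z - a z ≤ (bigBox d).indicator ρ z := by
        rw [indicator_of_mem hzQ]; linarith [ha0 z]
      have h5 : Real.log 2 * (ρ z - a z + b z)
          ≤ Real.log 2 * ((bigBox d).indicator ρ z + b z) := by gcongr
      linarith
  have hρQ : Integrable ((bigBox d).indicator ρ) ν := H.integrable.indicator measurableSet_bigBox
  have hφan : Integrable (fun z => -(a z * Real.log (a z))) ν := hφa.neg
  have hUi1 : Integrable (fun z => -(a z * Real.log (a z)) + b z * Real.log (b z)) ν :=
    hφan.add hφb
  have hUi2 : Integrable (fun z => Real.log 2 * ((bigBox d).indicator ρ z + b z)) ν :=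
    (hρQ.add hbi).const_mul _
  have hUi : Integrable U ν := hUi1.add hUi2
  have hDi : Integrable D ν := by
    refine ((hUi.norm.add H.entropy.norm).add (integrable_const (1 : ℝ))).mono'
      (by rw [hD]; fun_prop) (ae_of_all _ fun z => ?_)
    simp only [Pi.add_apply, Real.norm_eq_abs]
    have h1 := neg_one_le_mul_log (add_nonneg (sub_nonneg.2 (haρ z)) (hb0 z))
    have h2 := hDU z
    have h3 := le_abs_self (U z)
    have h4 := abs_nonneg (U z)
    have h5 := le_abs_self (ρ z * Real.log (ρ z))
    have h6 := abs_nonneg (ρ z * Real.log (ρ z))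
    rw [abs_le]
    constructor
    · simp only [hD]; linarith
    · linarith
  have hbi₁ : (den ν b).map Prod.fst = α := by rw [hbr]; exact block_map_fst hq₁ hq₂ hT hT
  have hbi₂ : (den ν b).map Prod.snd = β := by rw [hbr]; exact block_map_snd hq₁ hq₂ hT hT
  have main := H.le a b ham hbm ha0 haρ hb0 ⟨11 / 4, hsupp⟩ hbi
    (by rw [← hν, ← hpa, hbi₁]) (by rw [← hν, ← hpa, hbi₂]) hDi
  rw [← hν] at main
  have hca : Integrable (fun z => ‖z.1 - z.2‖ ^ 2 * a z) ν :=
    integrable_mul_of_bounded_support hai (fun z hz => (hsupp z hz).1) (by fun_prop)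
  have hcb : Integrable (fun z => ‖z.1 - z.2‖ ^ 2 * b z) ν :=
    integrable_mul_of_bounded_support hbi (fun z hz => (hsupp z hz).2) (by fun_prop)
  simp_rw [mul_sub (‖_‖ ^ 2)] at main
  rw [integral_sub hcb hca] at main
  have haint : ∫ z, a z ∂ν = M := by
    have h1 := integral_comp_den (ν := ν) ham ha0 measurable_fst (F := fun _ => (1 : ℝ))
      measurable_const
    rw [← hpa, ← hα] at h1
    simpa using h1.symm
  have hbint : ∫ z, b z ∂ν = M := by
    have h1 := integral_comp_den (ν := ν) hbm hb0 measurable_fst (F := fun _ => (1 : ℝ))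
      measurable_const
    rw [hbi₁] at h1
    simpa using h1.symm
  have hQint : ∫ z, (bigBox d).indicator ρ z ∂ν ≤ M₀ := by
    have h1 := integral_den (ν := ν) (a := (bigBox d).indicator ρ)
      (hρm.indicator measurableSet_bigBox)
      (fun z => indicator_nonneg (fun z _ => H.nonneg z) z) (fun _ => (1 : ℝ))
    rw [← restrict_den ν ρ measurableSet_bigBox] at h1
    simp only [one_mul] at h1
    rw [← h1]
    simpa using measureReal_mono hbox
  have hUint : ∫ z, U z ∂ν = -∫ z, a z * Real.log (a z) ∂ν + ∫ z, b z * Real.log (b z) ∂ν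
      + Real.log 2 * (∫ z, (bigBox d).indicator ρ z ∂ν + M) := by
    simp only [hU]
    rw [integral_add hUi1 hUi2, integral_const_mul, integral_add hρQ hbi, hbint,
      integral_add hφan hφb, integral_neg]
  have hDint : ∫ z, D z ∂ν ≤ ∫ z, U z ∂ν := integral_mono hDi hUi hDU
  set W := ∫ z, ‖z.1 - z.2‖ ^ 2 * a z ∂ν with hW
  have hW0 : 0 ≤ W := integral_nonneg fun z => mul_nonneg (by positivity) (ha0 z)
  -- This width makes h/σ² = δ, so the transport term of the entropy bound is δ times the cost on
  -- P_1; the price is (d/2)|log δ|.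
  set σ := l / Real.sqrt δ with hσ
  have hsδ : 0 < Real.sqrt δ := Real.sqrt_pos.2 hδ
  have hσ0 : 0 < σ := by positivity
  have hσ2 : 1 / σ ^ 2 = δ / h := by
    rw [hσ, div_pow, hl2, Real.sq_sqrt hδ.le, one_div_div]
  have hlogσ : Real.log (σ ^ d) = Real.log (l ^ d) - d / 2 * Real.log δ := by
    rw [Real.log_pow, Real.log_pow, hσ, Real.log_div hl0.ne' hsδ.ne', Real.log_sqrt hδ.le]
    ring
  have hent := neg_entropy_pset_le ha0 haP hai hφa hM₀0 hl₀ hm₀ hlam hmu hσ0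
  rw [← hν, haint, hσ2, hlogσ, ← hW] at hent
  have hM0 : 0 ≤ M := measureReal_nonneg
  have hlogδ : Real.log δ ≤ 0 := Real.log_nonpos hδ.le hδ1
  have hDfin : ∫ z, D z ∂ν ≤ δ / h * W + (-(d / 2 * Real.log δ) * M₀
      + 4 * Real.pi ^ ((d : ℝ) / 2) * M₀ + 9 ^ d + 2 * Real.log 2 * M₀) := by
    have h1 : -(d / 2 * Real.log δ) * M ≤ -(d / 2 * Real.log δ) * M₀ := by
      apply mul_le_mul_of_nonneg_left hMM₀
      rw [neg_nonneg]
      exact mul_nonpos_of_nonneg_of_nonpos (by positivity) hlogδ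
    have h2 : Real.log 2 * (∫ z, (bigBox d).indicator ρ z ∂ν + M) ≤ Real.log 2 * (M₀ + M₀) := by
      gcongr
    linarith
  have hmain2 : W ≤ ∫ z, ‖z.1 - z.2‖ ^ 2 * b z ∂ν + (δ * W + h * (-(d / 2 * Real.log δ) * M₀
      + 4 * Real.pi ^ ((d : ℝ) / 2) * M₀ + 9 ^ d + 2 * Real.log 2 * M₀)) := by
    have h1 := mul_le_mul_of_nonneg_left hDfin hh.le
    have h2 : h * (δ / h * W) = δ * W := by field_simp
    rw [mul_add, h2] at h1
    linarith
  have hcost := lintegral_cost_le (δ := δ) hl0 hδ hδ1 (block_map_cells hq₁ hq₂ hT hT)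
  rw [← hbr, lintegral_cost_eq hbm hb0 hcb, hl2] at hcost
  have hquniv : q univ ≤ ENNReal.ofReal M₀ := by
    have h1 : q univ = α univ := by
      rw [← hq₁, Measure.map_apply measurable_fst MeasurableSet.univ, preimage_univ]
    rw [h1, ← ofReal_measureReal (μ := α) (s := univ)]
    exact ENNReal.ofReal_le_ofReal hMM₀
  rw [hpa, lintegral_cost_eq ham ha0 hca, ← hW]
  have hrest : 0 ≤ -(d / 2 * Real.log δ) * M₀
      + 4 * Real.pi ^ ((d : ℝ) / 2) * M₀ + 9 ^ d + 2 * Real.log 2 * M₀ := by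
    have h1 : 0 ≤ -(d / 2 * Real.log δ) * M₀ := by
      apply mul_nonneg _ hM₀0
      rw [neg_nonneg]
      exact mul_nonpos_of_nonneg_of_nonpos (by positivity) hlogδ
    positivity
  calc ENNReal.ofReal W
      ≤ ENNReal.ofReal (∫ z, ‖z.1 - z.2‖ ^ 2 * b z ∂ν) + (ENNReal.ofReal (δ * W)
        + ENNReal.ofReal (h * (-(d / 2 * Real.log δ) * M₀
          + 4 * Real.pi ^ ((d : ℝ) / 2) * M₀ + 9 ^ d + 2 * Real.log 2 * M₀))) := by
        refine (ENNReal.ofReal_le_ofReal hmain2).trans ?_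
        refine ENNReal.ofReal_add_le.trans ?_
        gcongr
        exact ENNReal.ofReal_add_le
    _ ≤ (ENNReal.ofReal (1 + 3 * δ) * ∫⁻ z, ‖z.1 - z.2‖ₑ ^ 2 ∂q
          + ENNReal.ofReal (12 * d * (1 + 1 / δ) * h) * ENNReal.ofReal M₀)
        + (ENNReal.ofReal (δ * W)
        + ENNReal.ofReal (h * (-(d / 2 * Real.log δ) * M₀
          + 4 * Real.pi ^ ((d : ℝ) / 2) * M₀ + 9 ^ d + 2 * Real.log 2 * M₀))) := by
        gcongr
        exact hcost.trans (by gcongr)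
    _ = ENNReal.ofReal (1 + 3 * δ) * ∫⁻ z, ‖z.1 - z.2‖ₑ ^ 2 ∂q
          + ENNReal.ofReal (δ * W)
          + (ENNReal.ofReal (12 * d * (1 + 1 / δ) * h * M₀)
        + ENNReal.ofReal (h * (-(d / 2 * Real.log δ) * M₀
          + 4 * Real.pi ^ ((d : ℝ) / 2) * M₀ + 9 ^ d + 2 * Real.log 2 * M₀))) := by
        rw [← ENNReal.ofReal_mul (by positivity)]
        ring
    _ = _ := by
        rw [← ENNReal.ofReal_add (by positivity) (mul_nonneg hh.le hrest),
          ENNReal.ofReal_mul hδ.le]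
        congr 2
        rw [blockConst]
        ring

end Compare

/-! ### Almost quasi-minimality at unit scale -/

section Unit

variable {d : ℕ}

lemma blockConst_nonneg {δ : ℝ} (hδ : 0 < δ) (hδ1 : δ ≤ 1) : 0 ≤ blockConst d δ := by
  have h1 : d / 2 * Real.log δ ≤ 0 :=
    mul_nonpos_of_nonneg_of_nonpos (by positivity) (Real.log_nonpos hδ.le hδ1)
  have h2 : 0 ≤ Real.log 2 := Real.log_nonneg (by norm_num)
  have h3 : 0 ≤ 12 * (d : ℝ) * (1 + 1 / δ) := by positivity
  have h4 : 0 ≤ 4 * Real.pi ^ ((d : ℝ) / 2) := by positivity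
  unfold blockConst
  linarith

lemma cross_subset : cross d 1 ⊆ pset d (11 / 4) 1 ∪ (longSet d ∪ Prod.swap ⁻¹' longSet d) := by
  rintro z (hz | hz)
  · by_cases h : z.2 ∈ Metric.ball (0 : Pt d) (11 / 4)
    · exact Or.inl (Or.inl ⟨hz.1, by simpa using h⟩)
    · exact Or.inr (Or.inl ⟨hz.1, h⟩)
  · by_cases h : z.1 ∈ Metric.ball (0 : Pt d) (11 / 4)
    · exact Or.inl (Or.inr ⟨by simpa using h, hz.2⟩)
    · exact Or.inr (Or.inr ⟨hz.2, h⟩)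

lemma den_swap (lam mu : Measure (Pt d)) [IsFiniteMeasure lam] [IsFiniteMeasure mu]
    (ρ : Pt d × Pt d → ℝ) :
    den (mu.prod lam) (fun z => ρ z.swap) = (den (lam.prod mu) ρ).map Prod.swap := by
  have h := withDensity_map_measurableEquiv (lam.prod mu) MeasurableEquiv.prodComm
    (fun z : Pt d × Pt d => ENNReal.ofReal (ρ z.swap))
  have e : ((MeasurableEquiv.prodComm : Pt d × Pt d ≃ᵐ Pt d × Pt d) : Pt d × Pt d → Pt d × Pt d)
      = Prod.swap := rfl
  rw [e, Measure.prod_swap] at h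
  exact h

/-- With this symmetry, pairs that are long in the other direction need no separate argument. -/
lemma exchange_swap {h : ℝ} {lam mu : Measure (Pt d)} [IsFiniteMeasure lam]
    [IsFiniteMeasure mu] {ρ : Pt d × Pt d → ℝ}
    (hex : ∀ᵐ w ∂((lam.prod mu).prod (lam.prod mu)), ρ w.1 * ρ w.2
      ≤ ρ (exch w).1 * ρ (exch w).2
        * Real.exp (2 * inner ℝ (w.1.1 - w.2.1) (w.1.2 - w.2.2) / h)) :
    ∀ᵐ w ∂((mu.prod lam).prod (mu.prod lam)), ρ w.1.swap * ρ w.2.swap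
      ≤ ρ (exch w).1.swap * ρ (exch w).2.swap
        * Real.exp (2 * inner ℝ (w.1.1 - w.2.1) (w.1.2 - w.2.2) / h) := by
  have hs : MeasurePreserving (Prod.swap : Pt d × Pt d → Pt d × Pt d) (mu.prod lam)
      (lam.prod mu) := Measure.measurePreserving_swap
  have := (hs.prod hs).quasiMeasurePreserving.ae hex
  filter_upwards [this] with w hw
  simp only [Prod.map_fst, Prod.map_snd, exch, Prod.fst_swap, Prod.snd_swap] at hw ⊢
  rw [real_inner_comm]
  refine hw.trans (le_of_eq ?_)
  simp only [Prod.swap]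
  ring

lemma crossCost_swap (p : Measure (Pt d × Pt d)) (R : ℝ) :
    crossCost (p.map Prod.swap) R = crossCost p R := by
  rw [crossCost, crossCost, setLIntegral_map (measurableSet_cross R) (by fun_prop) measurable_swap]
  have h1 : Prod.swap ⁻¹' cross d R = cross d R := by
    ext z
    simp only [cross, mem_preimage, mem_union, mem_prod, mem_univ, and_true, true_and,
      Prod.fst_swap, Prod.snd_swap]
    exact or_comm
  rw [h1]
  refine lintegral_congr fun z => ?_
  rw [Prod.fst_swap, Prod.snd_swap, ← ofReal_norm, norm_sub_rev, ofReal_norm]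

/-- On subsets of `B_θ`, the measure is comparable to Lebesgue measure up to a factor two. -/
def NearLebesgue (θ : ℝ) (lam : Measure (Pt d)) : Prop :=
  ∀ S ⊆ Metric.ball (0 : Pt d) θ, MeasurableSet S → volume S ≤ 2 * lam S ∧ lam S ≤ 2 * volume S

/-- In the product of ball masses, the mass of B_1 is at most that of the cross and the mass of B_θ
is bounded by volume. One of the two factors h is discarded since h ≤ 1. -/
lemma longSet_cost_le {h : ℝ} (hh : 0 < h) (hh1 : h ≤ 1) {lam mu : Measure (Pt d)}
    [IsFiniteMeasure lam] [IsFiniteMeasure mu] {ρ : Pt d × Pt d → ℝ} (hρ : Measurable ρ)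
    (hρ0 : ∀ z, 0 ≤ ρ z)
    (hex : ∀ᵐ w ∂((lam.prod mu).prod (lam.prod mu)), ρ w.1 * ρ w.2
      ≤ ρ (exch w).1 * ρ (exch w).2
        * Real.exp (2 * inner ℝ (w.1.1 - w.2.1) (w.1.2 - w.2.2) / h))
    {s θ : ℝ} (hs : 0 < s) (hs' : s ≤ 1 / 2) (hθ : 1 + 2 * s ≤ θ)
    (hfst : (den (lam.prod mu) ρ).map Prod.fst = lam) (hlam : NearLebesgue θ lam)
    (hE : ENNReal.ofReal (100 / s ^ 2) * crossCost (den (lam.prod mu) ρ) θ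
      ≤ volume (Metric.ball (0 : Pt d) (s / 10)) / 4) :
    ∫⁻ z in longSet d, ‖z.1 - z.2‖ₑ ^ 2 ∂(den (lam.prod mu) ρ)
      ≤ ENNReal.ofReal (16 / s ^ 2 * (volume.real (Metric.ball (0 : Pt d) θ)
          / volume.real (Metric.ball (0 : Pt d) (s / 10))) * h)
        * den (lam.prod mu) ρ (cross d (11 / 4)) := by
  have main := lintegral_longSet_le hh hρ hρ0 hex hs hs' hθ hfst
    (fun S h1 h2 => (hlam S h1 h2).1) hE
  set v := volume.real (Metric.ball (0 : Pt d) (s / 10)) with hv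
  set V := volume.real (Metric.ball (0 : Pt d) θ) with hV
  have hv0 : 0 < v := ENNReal.toReal_pos (Metric.measure_ball_pos _ _ (by positivity)).ne'
    measure_ball_lt_top.ne
  have hve : volume (Metric.ball (0 : Pt d) (s / 10)) / 4 = ENNReal.ofReal (v / 4) := by
    rw [ENNReal.ofReal_div_of_pos (by norm_num), hv, ofReal_measureReal measure_ball_lt_top.ne,
      ENNReal.ofReal_ofNat]
  have h1 : lam (Metric.ball 0 θ) ≤ ENNReal.ofReal (2 * V) := by
    refine (hlam _ Subset.rfl measurableSet_ball).2.trans (le_of_eq ?_)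
    rw [ENNReal.ofReal_mul (by norm_num), hV, ofReal_measureReal measure_ball_lt_top.ne,
      ENNReal.ofReal_ofNat]
  have h2 : lam (Metric.ball 0 1) ≤ den (lam.prod mu) ρ (cross d (11 / 4)) := by
    conv_lhs => rw [← hfst]
    rw [Measure.map_apply measurable_fst measurableSet_ball]
    refine measure_mono fun z hz => Or.inl ⟨?_, mem_univ _⟩
    exact Metric.ball_subset_ball (by norm_num) hz
  rw [hve] at main
  have hvpos : 0 < v / 4 := by positivity
  have h3 := ENNReal.le_div_iff_mul_le (b := ENNReal.ofReal (v / 4))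
    (Or.inl (by simpa using hvpos)) (Or.inl ENNReal.ofReal_ne_top) |>.2 main
  refine h3.trans ?_
  rw [ENNReal.div_eq_inv_mul, ← ENNReal.ofReal_inv_of_pos hvpos]
  calc ENNReal.ofReal (v / 4)⁻¹ * (ENNReal.ofReal (2 * (h / s) ^ 2)
        * (lam (Metric.ball 0 1) * lam (Metric.ball 0 θ)))
      ≤ ENNReal.ofReal (v / 4)⁻¹ * (ENNReal.ofReal (2 * (h / s) ^ 2)
        * (den (lam.prod mu) ρ (cross d (11 / 4)) * ENNReal.ofReal (2 * V))) := by gcongr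
    _ = ENNReal.ofReal ((v / 4)⁻¹ * (2 * (h / s) ^ 2) * (2 * V))
        * den (lam.prod mu) ρ (cross d (11 / 4)) := by
        rw [ENNReal.ofReal_mul (p := (v / 4)⁻¹ * (2 * (h / s) ^ 2)) (by positivity),
          ENNReal.ofReal_mul (p := (v / 4)⁻¹) (by positivity)]
        ring
    _ ≤ _ := by
        gcongr ENNReal.ofReal ?_ * _
        have : (v / 4)⁻¹ * (2 * (h / s) ^ 2) * (2 * V) = 16 / s ^ 2 * (V / v) * (h * h) := by
          field_simp
          ring
        rw [this]
        have hV0 : 0 ≤ V := measureReal_nonneg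
        gcongr
        nlinarith

/-- Optimising the block comparison over q turns its cost into the optimal transport cost; the
excess factor 1 + 3δ/4 and the remaining δ/4 are absorbed into the δ-term. -/
lemma pset_cost_le {ε δ : ℝ} (hε : 0 < ε) (hε1 : ε ≤ 1) (hδ : 0 < δ) (hδ1 : δ < 1)
    {lam mu : Measure (Pt d)} [IsFiniteMeasure lam] [IsFiniteMeasure mu] {ρ : Pt d × Pt d → ℝ}
    (H : LocMin (ε ^ 2) lam mu ρ) (hmem : den (lam.prod mu) ρ ∈ couplings lam mu)
    (hlam : ∀ S ⊆ Metric.ball (0 : Pt d) 1, MeasurableSet S → lam S ≤ 2 * volume S)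
    (hmu : ∀ S ⊆ Metric.ball (0 : Pt d) 1, MeasurableSet S → mu S ≤ 2 * volume S)
    (hvol : volume (Metric.ball (0 : Pt d) 1) ≤ 2 * lam (Metric.ball 0 1)) :
    ∫⁻ z in pset d (11 / 4) 1, ‖z.1 - z.2‖ₑ ^ 2 ∂(den (lam.prod mu) ρ)
      ≤ den (lam.prod mu) ρ (pset d (11 / 4) 1)
          * OT (normFst (den (lam.prod mu) ρ) (pset d (11 / 4) 1))
            (normSnd (den (lam.prod mu) ρ) (pset d (11 / 4) 1))
        + (ENNReal.ofReal ((blockConst d (δ / 4)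
            + 2 * 9 ^ d / volume.real (Metric.ball (0 : Pt d) 1)) * ε ^ 2)
          * den (lam.prod mu) ρ (cross d (11 / 4))
        + ENNReal.ofReal δ * crossCost (den (lam.prod mu) ρ) 2) := by
  set p := den (lam.prod mu) ρ with hp
  have hpfin : IsFiniteMeasure p := isFiniteMeasure_of_map_fst hmem.1
  set P := pset d (11 / 4) 1 with hP
  set W := ∫⁻ z in P, ‖z.1 - z.2‖ₑ ^ 2 ∂p with hW
  -- Here the normalised marginals degenerate, but the left side vanishes.
  by_cases hp0 : p P = 0
  · have : W = 0 := by
      rw [hW, Measure.restrict_eq_zero.2 hp0, lintegral_zero_measure]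
    rw [this]
    exact zero_le
  have hptop : p P ≠ ∞ := measure_ne_top _ _
  have hPcross : P ⊆ cross d 2 := by
    have hb : Metric.ball (0 : Pt d) 1 ⊆ Metric.ball 0 2 := Metric.ball_subset_ball (by norm_num)
    rintro z (hz | hz)
    · exact Or.inl ⟨hb hz.1, mem_univ _⟩
    · exact Or.inr ⟨mem_univ _, hb hz.2⟩
  have hWcross : W ≤ crossCost p 2 := lintegral_mono_set hPcross
  set v := volume.real (Metric.ball (0 : Pt d) 1) with hv
  have hv0 : 0 < v := ENNReal.toReal_pos (Metric.measure_ball_pos _ _ (by positivity)).ne'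
    measure_ball_lt_top.ne
  set M₀ := p.real (cross d (11 / 4)) with hM₀
  have hM₀e : ENNReal.ofReal M₀ = p (cross d (11 / 4)) := ofReal_measureReal
  -- The cross has mass at least half the volume of B_1, so the additive constant 9^d can be charged
  -- to its mass.
  have hvM₀ : v ≤ 2 * M₀ := by
    have h1 : lam (Metric.ball 0 1) ≤ p (cross d (11 / 4)) := by
      rw [← hmem.1, Measure.map_apply measurable_fst measurableSet_ball]
      refine measure_mono fun z hz => Or.inl ⟨?_, mem_univ _⟩
      exact Metric.ball_subset_ball (by norm_num) hz
    have h2 := ENNReal.toReal_mono (by finiteness) (hvol.trans (mul_le_mul_right h1 2))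
    simpa [ENNReal.toReal_mul, hv, hM₀, measureReal_def] using h2
  set C := blockConst d (δ / 4) + 2 * 9 ^ d / v with hC
  have hbound : ENNReal.ofReal (ε ^ 2 * (blockConst d (δ / 4) * M₀ + 9 ^ d))
      ≤ ENNReal.ofReal (C * ε ^ 2) * p (cross d (11 / 4)) := by
    have hC0 : 0 ≤ C := add_nonneg (blockConst_nonneg (by positivity) (by linarith)) (by positivity)
    rw [← hM₀e, ← ENNReal.ofReal_mul (by positivity)]
    apply ENNReal.ofReal_le_ofReal
    have h1 : (9 : ℝ) ^ d ≤ 2 * 9 ^ d / v * M₀ := by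
      rw [div_mul_eq_mul_div, le_div_iff₀ hv0]
      calc (9 : ℝ) ^ d * v ≤ 9 ^ d * (2 * M₀) := by gcongr
        _ = _ := by ring
    calc ε ^ 2 * (blockConst d (δ / 4) * M₀ + 9 ^ d)
        ≤ ε ^ 2 * (blockConst d (δ / 4) * M₀ + 2 * 9 ^ d / v * M₀) := by gcongr
      _ = _ := by rw [hC]; ring
  set Y := ENNReal.ofReal (C * ε ^ 2) * p (cross d (11 / 4))
    + ENNReal.ofReal δ * crossCost p 2 with hY
  have key : ∀ q ∈ couplings (normFst p P) (normSnd p P),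
      W ≤ p P * ∫⁻ z, ‖z.1 - z.2‖ₑ ^ 2 ∂q + Y := by
    intro q hq
    have hq₁ : (p P • q).map Prod.fst = (p.restrict P).map Prod.fst := by
      rw [Measure.map_smul, hq.1, normFst, smul_smul, ENNReal.mul_inv_cancel hp0 hptop, one_smul]
    have hq₂ : (p P • q).map Prod.snd = (p.restrict P).map Prod.snd := by
      rw [Measure.map_smul, hq.2, normSnd, smul_smul, ENNReal.mul_inv_cancel hp0 hptop, one_smul]
    have hb := H.block_bound (h := ε ^ 2) (δ := δ / 4) (by positivity)
      (pow_le_one₀ hε.le hε1) (by positivity) (by linarith) hmem hlam hmu hq₁ hq₂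
    rw [← hp, ← hP, ← hW, lintegral_smul_measure, smul_eq_mul] at hb
    set X := p P * ∫⁻ z, ‖z.1 - z.2‖ₑ ^ 2 ∂q with hX
    -- If the competitor costs more than W there is nothing to prove; otherwise its surplus 3(δ/4)X
    -- is at most 3(δ/4)W, and with (δ/4)W this makes δW.
    rcases le_total W X with hWX | hXW
    · exact hWX.trans le_self_add
    · calc W ≤ ENNReal.ofReal (1 + 3 * (δ / 4)) * X + ENNReal.ofReal (δ / 4) * W
            + ENNReal.ofReal (ε ^ 2 * (blockConst d (δ / 4) * M₀ + 9 ^ d)) := hb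
        _ ≤ X + (ENNReal.ofReal (3 * (δ / 4)) * W + ENNReal.ofReal (δ / 4) * W)
            + ENNReal.ofReal (C * ε ^ 2) * p (cross d (11 / 4)) := by
          rw [ENNReal.ofReal_add (by norm_num) (by positivity), ENNReal.ofReal_one, add_mul,
            one_mul, add_assoc X]
          gcongr
        _ = X + (ENNReal.ofReal (C * ε ^ 2) * p (cross d (11 / 4)) + ENNReal.ofReal δ * W) := by
          rw [← add_mul, ← ENNReal.ofReal_add (by positivity) (by positivity),
            show 3 * (δ / 4) + δ / 4 = δ by ring]
          ring
        _ ≤ X + Y := by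
          rw [hY]
          gcongr
  rw [OT, ENNReal.mul_iInf_of_ne hp0 hptop, ENNReal.iInf_add]
  refine le_iInf fun q => ?_
  rw [ENNReal.mul_iInf_of_ne hp0 hptop, ENNReal.iInf_add]
  exact le_iInf fun hq => key q hq

theorem quasiMinBound_unit (d : ℕ) {θ : ℝ} (hθ : 1 < θ) :
    ∃ η : ℝ, 0 < η ∧ ∀ δ : ℝ, 0 < δ → δ < 1 → ∃ C : ℝ, 0 ≤ C ∧ ∀ ε : ℝ, 0 < ε → ε ≤ 1 →
      ∀ (lam mu : Measure (Pt d)) [IsFiniteMeasure lam] [IsFiniteMeasure mu]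
        (ρ : Pt d × Pt d → ℝ), LocMin (ε ^ 2) lam mu ρ →
        den (lam.prod mu) ρ ∈ couplings lam mu → NearLebesgue θ lam → NearLebesgue θ mu →
        crossCost (den (lam.prod mu) ρ) θ ≤ ENNReal.ofReal η →
        QuasiMinBound (11 / 4) C ε δ 1 (den (lam.prod mu) ρ) := by
  -- The room between 1 and θ must contain the intermediate points and their small balls; s ≤ 1/2 is
  -- needed for the inner product estimate.
  set s := min ((θ - 1) / 2) (1 / 2) with hs
  have hs0 : 0 < s := lt_min (by linarith) (by norm_num)
  have hs1 : s ≤ 1 / 2 := min_le_right _ _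
  have hsθ : 1 + 2 * s ≤ θ := by
    have : s ≤ (θ - 1) / 2 := min_le_left _ _
    linarith
  set v := volume.real (Metric.ball (0 : Pt d) (s / 10)) with hv
  have hv0 : 0 < v := ENNReal.toReal_pos (Metric.measure_ball_pos _ _ (by positivity)).ne'
    measure_ball_lt_top.ne
  have hve : volume (Metric.ball (0 : Pt d) (s / 10)) / 4 = ENNReal.ofReal (v / 4) := by
    rw [ENNReal.ofReal_div_of_pos (by norm_num), hv, ofReal_measureReal measure_ball_lt_top.ne,
      ENNReal.ofReal_ofNat]
  set CL := 16 / s ^ 2 * (volume.real (Metric.ball (0 : Pt d) θ) / v) with hCL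
  have hCL0 : 0 ≤ CL := by positivity
  -- The Chebyshev threshold: 100/s² times this value is v/4.
  refine ⟨v * s ^ 2 / 400, by positivity, fun δ hδ hδ1 => ?_⟩
  set CB := blockConst d (δ / 4) + 2 * 9 ^ d / volume.real (Metric.ball (0 : Pt d) 1) with hCB
  have hCB0 : 0 ≤ CB :=
    add_nonneg (blockConst_nonneg (by positivity) (by linarith)) (by positivity)
  refine ⟨CB + (CL + CL), by positivity, ?_⟩
  intro ε hε hε1 lam mu _ _ ρ H hmem hlam hmu hE
  have hE' : ENNReal.ofReal (100 / s ^ 2) * crossCost (den (lam.prod mu) ρ) θ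
      ≤ volume (Metric.ball (0 : Pt d) (s / 10)) / 4 := by
    calc _ ≤ ENNReal.ofReal (100 / s ^ 2) * ENNReal.ofReal (v * s ^ 2 / 400) := by gcongr
      _ = _ := by
        rw [← ENNReal.ofReal_mul (by positivity), hve]
        congr 1
        field_simp
        norm_num
  have hh : 0 < ε ^ 2 := by positivity
  have hh1 : ε ^ 2 ≤ 1 := pow_le_one₀ hε.le hε1
  have hex := H.exchange hh
  have hL1 := longSet_cost_le hh hh1 H.meas H.nonneg hex hs0 hs1 hsθ hmem.1 hlam hE'
  have hsw := den_swap lam mu ρ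
  have hL2 := longSet_cost_le (lam := mu) (mu := lam) (ρ := fun z => ρ z.swap) hh hh1
    (H.meas.comp measurable_swap) (fun z => H.nonneg _) (exchange_swap hex) hs0 hs1 hsθ
    (by rw [hsw, Measure.map_map measurable_fst measurable_swap]; exact hmem.2) hmu
    (by rw [hsw, crossCost_swap]; exact hE')
  set p := den (lam.prod mu) ρ with hp
  have hL2' : ∫⁻ z in Prod.swap ⁻¹' longSet d, ‖z.1 - z.2‖ₑ ^ 2 ∂p
      ≤ ENNReal.ofReal (CL * ε ^ 2) * p (cross d (11 / 4)) := by
    rw [hsw, setLIntegral_map measurableSet_longSet (by fun_prop) measurable_swap,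
      Measure.map_apply measurable_swap (measurableSet_cross _)] at hL2
    have h1 : Prod.swap ⁻¹' cross d (11 / 4) = cross d (11 / 4) := by
      ext z
      simp only [cross, mem_preimage, mem_union, mem_prod, mem_univ, and_true, true_and,
        Prod.fst_swap, Prod.snd_swap]
      exact or_comm
    rw [h1] at hL2
    refine le_trans (le_of_eq ?_) hL2
    refine lintegral_congr fun z => ?_
    rw [Prod.fst_swap, Prod.snd_swap, ← ofReal_norm, norm_sub_rev, ofReal_norm]
  have hball : Metric.ball (0 : Pt d) 1 ⊆ Metric.ball 0 θ := Metric.ball_subset_ball hθ.le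
  have hW := pset_cost_le hε hε1 hδ hδ1 H hmem
    (fun S h1 h2 => (hlam S (h1.trans hball) h2).2) (fun S h1 h2 => (hmu S (h1.trans hball) h2).2)
    (hlam _ hball measurableSet_ball).1
  rw [← hp] at hW
  unfold QuasiMinBound
  rw [mul_one, mul_one]
  calc crossCost p 1
      ≤ ∫⁻ z in pset d (11 / 4) 1 ∪ (longSet d ∪ Prod.swap ⁻¹' longSet d),
          ‖z.1 - z.2‖ₑ ^ 2 ∂p := lintegral_mono_set cross_subset
    _ ≤ ∫⁻ z in pset d (11 / 4) 1, ‖z.1 - z.2‖ₑ ^ 2 ∂p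
        + (∫⁻ z in longSet d, ‖z.1 - z.2‖ₑ ^ 2 ∂p
          + ∫⁻ z in Prod.swap ⁻¹' longSet d, ‖z.1 - z.2‖ₑ ^ 2 ∂p) := by
        refine (lintegral_union_le _ _ _).trans ?_
        gcongr
        exact lintegral_union_le _ _ _
    _ ≤ (p (pset d (11 / 4) 1) * OT (normFst p (pset d (11 / 4) 1)) (normSnd p (pset d (11 / 4) 1))
        + (ENNReal.ofReal (CB * ε ^ 2) * p (cross d (11 / 4))
          + ENNReal.ofReal δ * crossCost p 2))
        + (ENNReal.ofReal (CL * ε ^ 2) * p (cross d (11 / 4))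
          + ENNReal.ofReal (CL * ε ^ 2) * p (cross d (11 / 4))) := by
        gcongr
    _ = _ := by
        rw [add_mul CB, add_mul CL, ENNReal.ofReal_add (by positivity) (by positivity),
          ENNReal.ofReal_add (by positivity) (by positivity)]
        ring

end Unit

/-! ### Dilations -/

section Dilation

variable {d : ℕ}

/-- The dilation `x ↦ R⁻¹ x`. -/
def dilation (d : ℕ) {R : ℝ} (hR : 0 < R) : Pt d ≃ₜ Pt d :=
  Homeomorph.smulOfNeZero R⁻¹ (inv_ne_zero hR.ne')

@[simp]
lemma dilation_apply {R : ℝ} (hR : 0 < R) (x : Pt d) : dilation d hR x = R⁻¹ • x := rfl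

lemma dilation_mem_ball {R : ℝ} (hR : 0 < R) (x : Pt d) (r : ℝ) :
    dilation d hR x ∈ Metric.ball (0 : Pt d) r ↔ x ∈ Metric.ball (0 : Pt d) (r * R) := by
  rw [mem_ball_zero_iff, mem_ball_zero_iff, dilation_apply, norm_smul,
    Real.norm_of_nonneg (by positivity), inv_mul_lt_iff₀ hR, mul_comm]

lemma enorm_dilation_sub_sq {R : ℝ} (hR : 0 < R) (x y : Pt d) :
    ‖dilation d hR x - dilation d hR y‖ₑ ^ 2 = ENNReal.ofReal (R⁻¹ ^ 2) * ‖x - y‖ₑ ^ 2 := by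
  rw [dilation_apply, dilation_apply, ← smul_sub, enorm_smul, mul_pow,
    ENNReal.ofReal_pow (by positivity), Real.enorm_of_nonneg (by positivity)]

lemma measurable_prodMap_dilation {R : ℝ} (hR : 0 < R) :
    Measurable (Prod.map (dilation d hR) (dilation d hR)) :=
  (dilation d hR).measurable.prodMap (dilation d hR).measurable

lemma preimage_dilation_cross {R : ℝ} (hR : 0 < R) (r : ℝ) :
    Prod.map (dilation d hR) (dilation d hR) ⁻¹' cross d r = cross d (r * R) := by
  ext z
  simp only [cross, mem_preimage, mem_union, mem_prod, mem_univ, and_true, true_and,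
    Prod.map_fst, Prod.map_snd, dilation_mem_ball]

lemma preimage_dilation_pset {R : ℝ} (hR : 0 < R) (L : ℝ) :
    Prod.map (dilation d hR) (dilation d hR) ⁻¹' pset d L 1 = pset d L R := by
  ext z
  simp only [pset, mem_preimage, mem_union, mem_prod, Prod.map_fst, Prod.map_snd,
    dilation_mem_ball, one_mul, mul_one]

lemma crossCost_dilation {R : ℝ} (hR : 0 < R) (p : Measure (Pt d × Pt d)) (c : ℝ≥0∞) (r : ℝ) :
    crossCost (c • p.map (Prod.map (dilation d hR) (dilation d hR))) r
      = c * ENNReal.ofReal (R⁻¹ ^ 2) * crossCost p (r * R) := by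
  rw [crossCost, Measure.restrict_smul, lintegral_smul_measure,
    setLIntegral_map (measurableSet_cross r) (by fun_prop) (measurable_prodMap_dilation hR),
    preimage_dilation_cross, crossCost, smul_eq_mul, mul_assoc]
  simp only [Prod.map_fst, Prod.map_snd, enorm_dilation_sub_sq]
  rw [lintegral_const_mul _ (by fun_prop)]

lemma OT_map_dilation_le {R : ℝ} (hR : 0 < R) (lam mu : Measure (Pt d)) :
    OT (lam.map (dilation d hR)) (mu.map (dilation d hR))
      ≤ ENNReal.ofReal (R⁻¹ ^ 2) * OT lam mu := by
  have hm := (dilation d hR).measurable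
  have h0 : ENNReal.ofReal (R⁻¹ ^ 2) ≠ 0 := by simpa using by positivity
  rw [OT, OT, ENNReal.mul_iInf_of_ne h0 ENNReal.ofReal_ne_top]
  refine le_iInf fun q => ?_
  rw [ENNReal.mul_iInf_of_ne h0 ENNReal.ofReal_ne_top]
  refine le_iInf fun hq => ?_
  have hq' : q.map (Prod.map (dilation d hR) (dilation d hR))
      ∈ couplings (lam.map (dilation d hR)) (mu.map (dilation d hR)) := by
    rw [← hq.1, ← hq.2]
    constructor
    · rw [Measure.map_map measurable_fst (measurable_prodMap_dilation hR),
        Measure.map_map hm measurable_fst]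
      rfl
    · rw [Measure.map_map measurable_snd (measurable_prodMap_dilation hR),
        Measure.map_map hm measurable_snd]
      rfl
  refine (iInf₂_le _ hq').trans ?_
  rw [lintegral_map (by fun_prop) (measurable_prodMap_dilation hR),
    ← lintegral_const_mul _ (by fun_prop)]
  simp only [Prod.map_fst, Prod.map_snd, enorm_dilation_sub_sq]
  exact le_rfl

lemma normalised_map_dilation {R : ℝ} (hR : 0 < R) (p : Measure (Pt d × Pt d)) {c : ℝ≥0∞}
    (hc : c ≠ 0) (hc' : c ≠ ∞) (L : ℝ) {T : Pt d × Pt d → Pt d} (hT : Measurable T)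
    (h : T ∘ Prod.map (dilation d hR) (dilation d hR) = dilation d hR ∘ T) :
    ((c • p.map (Prod.map (dilation d hR) (dilation d hR))) (pset d L 1))⁻¹ •
        ((c • p.map (Prod.map (dilation d hR) (dilation d hR))).restrict (pset d L 1)).map T
      = ((p (pset d L R))⁻¹ • (p.restrict (pset d L R)).map T).map (dilation d hR) := by
  have hm := measurable_prodMap_dilation (d := d) hR
  rw [Measure.smul_apply, Measure.map_apply hm (measurableSet_pset L 1), preimage_dilation_pset,
    Measure.restrict_smul, Measure.restrict_map hm (measurableSet_pset L 1),
    preimage_dilation_pset, Measure.map_smul, Measure.map_map hT hm, h,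
    ← Measure.map_map (dilation d hR).measurable hT, Measure.map_smul, smul_smul, smul_eq_mul,
    ENNReal.mul_inv (Or.inl hc) (Or.inl hc'), mul_right_comm, ENNReal.inv_mul_cancel hc hc',
    one_mul]

/-- All terms scale by c R⁻², with ε replaced by ε/R. For the transport cost only one inequality is
needed. -/
lemma QuasiMinBound.of_dilation {R : ℝ} (hR : 0 < R) {p : Measure (Pt d × Pt d)} {c : ℝ≥0∞}
    (hc : c ≠ 0) (hc' : c ≠ ∞) {L C ε δ : ℝ} (h : QuasiMinBound L C (ε / R) δ 1
      (c • p.map (Prod.map (dilation d hR) (dilation d hR)))) :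
    QuasiMinBound L C ε δ R p := by
  have hm := measurable_prodMap_dilation (d := d) hR
  unfold QuasiMinBound at h ⊢
  have h0 : ENNReal.ofReal (R⁻¹ ^ 2) ≠ 0 := by simpa using by positivity
  have h1 : c * ENNReal.ofReal (R⁻¹ ^ 2) ≠ 0 := mul_ne_zero hc h0
  have h2 : c * ENNReal.ofReal (R⁻¹ ^ 2) ≠ ∞ := ENNReal.mul_ne_top hc' ENNReal.ofReal_ne_top
  rw [crossCost_dilation, crossCost_dilation, normFst, normSnd,
    normalised_map_dilation hR p hc hc' L measurable_fst rfl,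
    normalised_map_dilation hR p hc hc' L measurable_snd rfl, Measure.smul_apply,
    Measure.map_apply hm (measurableSet_pset L 1), preimage_dilation_pset, Measure.smul_apply,
    Measure.map_apply hm (measurableSet_cross _), preimage_dilation_cross, one_mul, mul_one,
    smul_eq_mul, smul_eq_mul] at h
  rw [← ENNReal.mul_le_mul_iff_right h1 h2]
  refine h.trans ?_
  have h3 : C * (ε / R) ^ 2 = R⁻¹ ^ 2 * (C * ε ^ 2) := by field_simp
  rw [h3, ENNReal.ofReal_mul (by positivity)]
  refine (add_le_add_left (add_le_add_left (mul_le_mul_right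
    (OT_map_dilation_le hR _ _) _) _) _).trans (le_of_eq ?_)
  rw [normFst, normSnd]
  ring_nf

/-- After the dilation and the division of mass by m R^d, the density becomes f(Rx)/m, which lies
between 1/2 and 2. -/
lemma nearLebesgue_dilation {R θ m : ℝ} (hR : 0 < R) (hm : 0 < m) {f : Pt d → ℝ}
    (hf : ∀ x ∈ Metric.ball (0 : Pt d) (θ * R), m / 2 ≤ f x ∧ f x ≤ 2 * m) :
    NearLebesgue θ (ENNReal.ofReal (m * R ^ d)⁻¹ •
      (volume.withDensity fun x => ENNReal.ofReal (f x)).map (dilation d hR)) := by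
  intro S hS hSm
  have hpre : MeasurableSet (dilation d hR ⁻¹' S) := (dilation d hR).measurable hSm
  have hsub : ∀ x ∈ dilation d hR ⁻¹' S, x ∈ Metric.ball (0 : Pt d) (θ * R) := fun x hx =>
    (dilation_mem_ball hR x θ).1 (hS hx)
  have hvol : volume (dilation d hR ⁻¹' S) = ENNReal.ofReal (R ^ d) * volume S := by
    have h := Measure.addHaar_preimage_smul (volume : Measure (Pt d)) (inv_ne_zero hR.ne') S
    rw [finrank_euclideanSpace_fin, inv_pow, inv_inv, abs_of_pos (by positivity)] at h
    exact h
  have hlow : ENNReal.ofReal (m / 2) * volume (dilation d hR ⁻¹' S)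
      ≤ ∫⁻ x in dilation d hR ⁻¹' S, ENNReal.ofReal (f x) := by
    rw [← setLIntegral_const]
    exact setLIntegral_mono' hpre fun x hx => ENNReal.ofReal_le_ofReal (hf x (hsub x hx)).1
  have hup : ∫⁻ x in dilation d hR ⁻¹' S, ENNReal.ofReal (f x)
      ≤ ENNReal.ofReal (2 * m) * volume (dilation d hR ⁻¹' S) := by
    rw [← setLIntegral_const]
    exact setLIntegral_mono' hpre fun x hx => ENNReal.ofReal_le_ofReal (hf x (hsub x hx)).2
  rw [Measure.smul_apply, Measure.map_apply (dilation d hR).measurable hSm,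
    withDensity_apply _ hpre, smul_eq_mul]
  constructor
  · calc volume S = ENNReal.ofReal (2 * ((m * R ^ d)⁻¹ * (m / 2 * R ^ d))) * volume S := by
          rw [show 2 * ((m * R ^ d)⁻¹ * (m / 2 * R ^ d)) = 1 by field_simp, ENNReal.ofReal_one,
            one_mul]
      _ = 2 * (ENNReal.ofReal (m * R ^ d)⁻¹
            * (ENNReal.ofReal (m / 2) * volume (dilation d hR ⁻¹' S))) := by
          rw [hvol, ENNReal.ofReal_mul (by norm_num), ENNReal.ofReal_mul (by positivity),
            ENNReal.ofReal_mul (by positivity), ENNReal.ofReal_ofNat]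
          ring
      _ ≤ _ := by gcongr
  · calc _ ≤ ENNReal.ofReal (m * R ^ d)⁻¹
            * (ENNReal.ofReal (2 * m) * volume (dilation d hR ⁻¹' S)) := by gcongr
      _ = ENNReal.ofReal ((m * R ^ d)⁻¹ * (2 * m * R ^ d)) * volume S := by
          rw [hvol, ENNReal.ofReal_mul (q := 2 * m * R ^ d) (by positivity),
            ENNReal.ofReal_mul (p := 2 * m) (by positivity)]
          ring
      _ = _ := by
          rw [show (m * R ^ d)⁻¹ * (2 * m * R ^ d) = 2 by field_simp, ENNReal.ofReal_ofNat]

/-- Dilation and mass normalisation remove R and m from the hypotheses, so C is the unit-scale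
constant; m survives only in the threshold for the cost. -/
theorem quasiMinBound_ball (d : ℕ) {θ : ℝ} (hθ : 1 < θ) :
    ∃ η : ℝ, 0 < η ∧ ∀ δ : ℝ, 0 < δ → δ < 1 → ∃ C : ℝ, 0 ≤ C ∧ ∀ ε R m : ℝ, 0 < ε → ε ≤ R →
      0 < m → ∀ (lam mu : Measure (Pt d)) [IsFiniteMeasure lam] [IsFiniteMeasure mu]
        (f g : Pt d → ℝ) (ρ : Pt d × Pt d → ℝ),
        lam = volume.withDensity (fun x => ENNReal.ofReal (f x)) →
        mu = volume.withDensity (fun x => ENNReal.ofReal (g x)) →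
        (∀ x ∈ Metric.ball (0 : Pt d) (θ * R), m / 2 ≤ f x ∧ f x ≤ 2 * m) →
        (∀ x ∈ Metric.ball (0 : Pt d) (θ * R), m / 2 ≤ g x ∧ g x ≤ 2 * m) →
        LocMin (ε ^ 2) lam mu ρ → den (lam.prod mu) ρ ∈ couplings lam mu →
        crossCost (den (lam.prod mu) ρ) (θ * R) ≤ ENNReal.ofReal (η * m * R ^ (d + 2)) →
        QuasiMinBound (11 / 4) C ε δ R (den (lam.prod mu) ρ) := by
  obtain ⟨η, hη, hunit⟩ := quasiMinBound_unit d hθ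
  refine ⟨η, hη, fun δ hδ hδ1 => ?_⟩
  obtain ⟨C, hC, hb⟩ := hunit δ hδ hδ1
  refine ⟨C, hC, ?_⟩
  intro ε R m hε hεR hm lam mu _ _ f g ρ hlam hmu hf hg H hmem hcost
  have hR : 0 < R := hε.trans_le hεR
  have hc : 0 < (m * R ^ d)⁻¹ := by positivity
  set c := (m * R ^ d)⁻¹ with hcdef
  have H' := H.map (dilation d hR) (dilation d hR) hc (τ := R ^ 2) (by positivity)
    (U := fun _ => 0) (V := fun _ => 0) continuous_const continuous_const (fun x y => by
      rw [dilation_apply, dilation_apply, ← smul_sub, norm_smul,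
        Real.norm_of_nonneg (by positivity)]
      simp only [add_zero, mul_pow]
      field_simp)
  rw [← div_pow] at H'
  set ρ' : Pt d × Pt d → ℝ :=
    fun z => c⁻¹ * ρ ((dilation d hR).symm z.1, (dilation d hR).symm z.2) with hρ'
  have hden : den ((ENNReal.ofReal c • lam.map (dilation d hR)).prod
      (ENNReal.ofReal c • mu.map (dilation d hR))) ρ'
      = ENNReal.ofReal c • (den (lam.prod mu) ρ).map
        (Prod.map (dilation d hR) (dilation d hR)) := by
    rw [prod_smul_map lam mu _ _ hc]
    exact den_smul_map (lam.prod mu)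
      ((dilation d hR).prodCongr (dilation d hR)).toMeasurableEquiv hc H.meas
  have hc0 : ENNReal.ofReal c ≠ 0 := by simpa using hc
  refine QuasiMinBound.of_dilation hR hc0 ENNReal.ofReal_ne_top (c := ENNReal.ofReal c) ?_
  rw [← hden]
  have : IsFiniteMeasure (ENNReal.ofReal c • lam.map (dilation d hR)) :=
    Measure.smul_finite _ ENNReal.ofReal_ne_top
  have : IsFiniteMeasure (ENNReal.ofReal c • mu.map (dilation d hR)) :=
    Measure.smul_finite _ ENNReal.ofReal_ne_top
  refine hb (ε / R) (by positivity) ((div_le_one hR).2 hεR) _ _ ρ' H' ?_ ?_ ?_ ?_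
  · rw [hden]
    have hmm := measurable_prodMap_dilation (d := d) hR
    constructor
    · conv_rhs => rw [← hmem.1]
      rw [Measure.map_smul, Measure.map_map measurable_fst hmm,
        Measure.map_map (dilation d hR).measurable measurable_fst]
      rfl
    · conv_rhs => rw [← hmem.2]
      rw [Measure.map_smul, Measure.map_map measurable_snd hmm,
        Measure.map_map (dilation d hR).measurable measurable_snd]
      rfl
  · rw [hlam]
    exact nearLebesgue_dilation hR hm hf
  · rw [hmu]
    exact nearLebesgue_dilation hR hm hg
  · rw [hden, crossCost_dilation]
    calc _ ≤ ENNReal.ofReal c * ENNReal.ofReal (R⁻¹ ^ 2)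
          * ENNReal.ofReal (η * m * R ^ (d + 2)) := by gcongr
      _ = ENNReal.ofReal η := by
        rw [← ENNReal.ofReal_mul hc.le, ← ENNReal.ofReal_mul (by positivity)]
        congr 1
        rw [hcdef]
        field_simp
        ring

end Dilation

/-! ### Affine rescalings and Hölder densities -/

section Rescaling

variable {d : ℕ}

namespace Rescaling

/-- `Q₁` as a homeomorphism. -/
def fstHomeo (s : Rescaling d) (hA : s.A.PosDef) : Pt d ≃ₜ Pt d where
  toFun := s.Q₁
  invFun := Matrix.toEuclideanCLM (𝕜 := ℝ) s.A
  left_inv x := toEuclideanCLM_cancel (Matrix.mul_nonsing_inv _ hA.det_pos.ne'.isUnit) x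
  right_inv x := toEuclideanCLM_cancel (Matrix.nonsing_inv_mul _ hA.det_pos.ne'.isUnit) x
  continuous_toFun := by unfold Q₁; fun_prop
  continuous_invFun := by fun_prop

/-- `Q₂` as a homeomorphism. -/
def sndHomeo (s : Rescaling d) (hA : s.A.PosDef) (hγ : 0 < s.γ) : Pt d ≃ₜ Pt d where
  toFun := s.Q₂
  invFun y := s.γ⁻¹ • Matrix.toEuclideanCLM (𝕜 := ℝ) s.A⁻¹ y + s.b
  left_inv y := by
    simp only [Q₂, map_smul]
    rw [toEuclideanCLM_cancel (Matrix.nonsing_inv_mul _ hA.det_pos.ne'.isUnit), smul_smul,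
      inv_mul_cancel₀ hγ.ne', one_smul, sub_add_cancel]
  right_inv y := by
    simp only [Q₂, add_sub_cancel_right, map_smul]
    rw [toEuclideanCLM_cancel (Matrix.mul_nonsing_inv _ hA.det_pos.ne'.isUnit), smul_smul,
      mul_inv_cancel₀ hγ.ne', one_smul]
  continuous_toFun := by unfold Q₂; fun_prop
  continuous_invFun := by fun_prop

lemma inner_Q₁_toEuclideanCLM (s : Rescaling d) (hA : s.A.PosDef) (x z : Pt d) :
    inner ℝ (s.Q₁ x) (Matrix.toEuclideanCLM (𝕜 := ℝ) s.A z) = inner ℝ x z := by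
  have h : ContinuousLinearMap.adjoint (Matrix.toEuclideanCLM (n := Fin d) (𝕜 := ℝ) s.A)
      = Matrix.toEuclideanCLM (n := Fin d) (𝕜 := ℝ) s.A := by
    rw [← ContinuousLinearMap.star_eq_adjoint, ← map_star, Matrix.star_eq_conjTranspose,
      hA.isHermitian.eq]
  rw [← ContinuousLinearMap.adjoint_inner_left, h, Q₁,
    toEuclideanCLM_cancel (Matrix.mul_nonsing_inv _ hA.det_pos.ne'.isUnit)]

/-- As A is symmetric, ⟨A⁻¹x, Az⟩ = ⟨x, z⟩. The mixed term is therefore kept up to the factor γ, and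
the shift b contributes a function of x alone. -/
lemma norm_sub_sq_eq (s : Rescaling d) (hA : s.A.PosDef) (hγ : 0 < s.γ) (x y : Pt d) :
    ‖x - y‖ ^ 2 = s.γ⁻¹ * ‖s.Q₁ x - s.Q₂ y‖ ^ 2
      + (‖x‖ ^ 2 - 2 * inner ℝ x s.b - s.γ⁻¹ * ‖s.Q₁ x‖ ^ 2)
      + (‖y‖ ^ 2 - s.γ⁻¹ * ‖s.Q₂ y‖ ^ 2) := by
  have h : inner ℝ (s.Q₁ x) (s.Q₂ y) = s.γ * (inner ℝ x y - inner ℝ x s.b) := by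
    rw [Q₂, inner_smul_right, inner_Q₁_toEuclideanCLM s hA, inner_sub_right]
  rw [norm_sub_sq_real, norm_sub_sq_real, h]
  field_simp
  ring

end Rescaling

lemma LocMin.rescale {h : ℝ} {lam mu : Measure (Pt d)} [IsFiniteMeasure lam]
    [IsFiniteMeasure mu] {ρ : Pt d × Pt d → ℝ} (H : LocMin h lam mu ρ) (s : Rescaling d)
    (hA : s.A.PosDef) (hγ : 0 < s.γ) (hκ : 0 < s.κ) :
    ∃ ρ', LocMin (s.γ * h) (s.fstMeasure lam) (s.sndMeasure mu) ρ' ∧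
      s.plan (den (lam.prod mu) ρ) = den ((s.fstMeasure lam).prod (s.sndMeasure mu)) ρ' := by
  have h1 : Continuous s.Q₁ := (s.fstHomeo hA).continuous
  have h2 : Continuous s.Q₂ := (s.sndHomeo hA hγ).continuous
  have H' := H.map (s.fstHomeo hA) (s.sndHomeo hA hγ) hκ (inv_pos.2 hγ)
    (U := fun x => ‖x‖ ^ 2 - 2 * inner ℝ x s.b - s.γ⁻¹ * ‖s.Q₁ x‖ ^ 2)
    (V := fun y => ‖y‖ ^ 2 - s.γ⁻¹ * ‖s.Q₂ y‖ ^ 2) (by fun_prop) (by fun_prop)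
    (s.norm_sub_sq_eq hA hγ)
  rw [div_inv_eq_mul, mul_comm] at H'
  refine ⟨_, H', ?_⟩
  have hden := den_smul_map (lam.prod mu)
    ((s.fstHomeo hA).prodCongr (s.sndHomeo hA hγ)).toMeasurableEquiv hκ H.meas
  rw [← prod_smul_map lam mu _ _ hκ] at hden
  exact hden.symm

/-- The finite right side excludes an infinite seminorm, after which the Hölder estimate is applied
between x and the centre. -/
lemma sq_sub_le_of_holderSeminorm {α : ℝ≥0} {f : Pt d → ℝ} {r t : ℝ} (hr : 0 < r) (ht : 0 ≤ t)
    (h : ENNReal.ofReal (r ^ (2 * (α : ℝ))) * holderSeminorm α f r ^ 2 ≤ ENNReal.ofReal t)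
    {x : Pt d} (hx : x ∈ Metric.ball (0 : Pt d) r) : (f x - f 0) ^ 2 ≤ t := by
  have hr' : ENNReal.ofReal (r ^ (2 * (α : ℝ))) ≠ 0 := by
    simpa using Real.rpow_pos_of_pos hr _
  have htop : holderSeminorm α f r ≠ ∞ := by
    intro htop
    rw [htop, ENNReal.top_pow two_ne_zero, ENNReal.mul_top hr'] at h
    exact ENNReal.ofReal_ne_top (top_le_iff.1 h)
  have hmem := eHolderNorm_ne_top.1 htop
  have hedist := hmem.holderWith ⟨x, hx⟩ ⟨0, Metric.mem_ball_self hr⟩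
  rw [hmem.coe_nnHolderNorm_eq_eHolderNorm] at hedist
  have hxr : edist (⟨x, hx⟩ : Metric.ball (0 : Pt d) r) ⟨0, Metric.mem_ball_self hr⟩
      ≤ ENNReal.ofReal r := by
    rw [Subtype.edist_mk_mk, edist_dist]
    exact ENNReal.ofReal_le_ofReal (Metric.mem_ball.1 hx).le
  have hpow : (ENNReal.ofReal r ^ (α : ℝ)) ^ 2 = ENNReal.ofReal (r ^ (2 * (α : ℝ))) := by
    rw [← ENNReal.rpow_natCast, ← ENNReal.rpow_mul, ENNReal.ofReal_rpow_of_pos hr]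
    norm_num [mul_comm]
  have hsq : edist (f x) (f 0) ^ 2 ≤ ENNReal.ofReal t := by
    calc edist (f x) (f 0) ^ 2
        ≤ (holderSeminorm α f r * ENNReal.ofReal r ^ (α : ℝ)) ^ 2 := by
          refine pow_le_pow_left' (hedist.trans ?_) 2
          exact mul_le_mul_right (ENNReal.rpow_le_rpow hxr α.2) _
      _ = ENNReal.ofReal (r ^ (2 * (α : ℝ))) * holderSeminorm α f r ^ 2 := by
          rw [mul_pow, hpow, mul_comm]
      _ ≤ _ := h
  rw [edist_dist, ← ENNReal.ofReal_pow dist_nonneg, Real.dist_eq, sq_abs] at hsq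
  exact (ENNReal.ofReal_le_ofReal_iff ht).1 hsq

/-- Each of the oscillation of f, the oscillation of g and the gap |f(0) - g(0)| is at most f(0)/4,
so f stays within a quarter and g within a half of f(0). -/
lemma density_bounds_of_dataD {α : ℝ≥0} {f g : Pt d → ℝ} {r t : ℝ} (hr : 0 < r) (ht : 0 ≤ t)
    (hf : 0 < f 0) (htf : t ≤ f 0 ^ 2 / 16) (h : dataD α f g r ≤ ENNReal.ofReal t) :
    ∀ x ∈ Metric.ball (0 : Pt d) r,
      (f 0 / 2 ≤ f x ∧ f x ≤ 2 * f 0) ∧ (f 0 / 2 ≤ g x ∧ g x ≤ 2 * f 0) := by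
  intro x hx
  have habs : ∀ u : ℝ, u ^ 2 ≤ t → |u| ≤ f 0 / 4 := fun u hu =>
    abs_le_of_sq_le_sq (by linarith [show (f 0 / 4) ^ 2 = f 0 ^ 2 / 16 by ring]) (by positivity)
  have h1 := le_self_add.trans h
  have h2 := le_add_self.trans h
  rw [mul_add] at h1
  have hfx := habs _ (sq_sub_le_of_holderSeminorm hr ht (le_self_add.trans h1) hx)
  have hgx := habs _ (sq_sub_le_of_holderSeminorm hr ht (le_add_self.trans h1) hx)
  rw [sq_abs] at h2
  have h0 := habs _ ((ENNReal.ofReal_le_ofReal_iff ht).1 h2)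
  rw [abs_le] at hfx hgx h0
  refine ⟨⟨?_, ?_⟩, ?_, ?_⟩ <;> linarith [hfx.1, hfx.2, hgx.1, hgx.2, h0.1, h0.2]

lemma crossCost_le_of_energy_le {p : Measure (Pt d × Pt d)} {r t : ℝ} (hr : 0 < r)
    (h : energy p r ≤ ENNReal.ofReal t) : crossCost p r ≤ ENNReal.ofReal (r ^ (d + 2) * t) := by
  have h0 : ENNReal.ofReal (r ^ (d + 2)) ≠ 0 := by simpa using by positivity
  rw [energy, ENNReal.inv_mul_le_iff h0 ENNReal.ofReal_ne_top,
    ← ENNReal.ofReal_mul (by positivity)] at h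
  exact h

/-- Only a lower bound m for f(0) is needed: the mass is normalised by f(0) itself, and a larger
f(0) relaxes both smallness conditions. -/
theorem quasiMinBound_of_smallness (d : ℕ) {θ : ℝ} (hθ : 1 < θ) :
    ∃ η : ℝ, 0 < η ∧ ∀ δ : ℝ, 0 < δ → δ < 1 → ∃ C : ℝ, 0 ≤ C ∧ ∀ ε R m t : ℝ, 0 < ε → ε ≤ R →
      0 < m → 0 ≤ t → t ≤ m ^ 2 / 16 → t ≤ η * m →
      ∀ (lam mu : Measure (Pt d)) [IsFiniteMeasure lam] [IsFiniteMeasure mu] (α : ℝ≥0)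
        (f g : Pt d → ℝ) (ρ : Pt d × Pt d → ℝ),
        lam = volume.withDensity (fun x => ENNReal.ofReal (f x)) →
        mu = volume.withDensity (fun x => ENNReal.ofReal (g x)) → m ≤ f 0 →
        LocMin (ε ^ 2) lam mu ρ → den (lam.prod mu) ρ ∈ couplings lam mu →
        energy (den (lam.prod mu) ρ) (θ * R) + dataD α f g (θ * R) ≤ ENNReal.ofReal t →
        QuasiMinBound (11 / 4) C ε δ R (den (lam.prod mu) ρ) := by
  obtain ⟨η, hη, hball⟩ := quasiMinBound_ball d hθ
  have hθ0 : 0 < θ := by linarith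
  refine ⟨η / θ ^ (d + 2), by positivity, fun δ hδ hδ1 => ?_⟩
  obtain ⟨C, hC, hb⟩ := hball δ hδ hδ1
  refine ⟨C, hC, ?_⟩
  intro ε R m t hε hεR hm ht ht1 ht2 lam mu _ _ α f g ρ hlam hmu hmf H hmem hsmall
  have hR : 0 < R := hε.trans_le hεR
  have hθR : 0 < θ * R := by positivity
  have hf0 : 0 < f 0 := hm.trans_le hmf
  have hbds := density_bounds_of_dataD hθR ht hf0 (ht1.trans (by gcongr))
    (le_add_self.trans hsmall)
  refine hb ε R (f 0) hε hεR hf0 lam mu f g ρ hlam hmu (fun x hx => (hbds x hx).1)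
    (fun x hx => (hbds x hx).2) H hmem ?_
  refine (crossCost_le_of_energy_le hθR (le_self_add.trans hsmall)).trans
    (ENNReal.ofReal_le_ofReal ?_)
  calc (θ * R) ^ (d + 2) * t ≤ (θ * R) ^ (d + 2) * (η / θ ^ (d + 2) * f 0) := by
        gcongr
        exact ht2.trans (by gcongr)
    _ = _ := by
        rw [mul_pow]
        field_simp

lemma IsHolderDensity.measurable {α : ℝ≥0} (hα : 0 < α) {f : Pt d → ℝ} {lam : Measure (Pt d)}
    (hf : IsHolderDensity α f lam) : Measurable f := by
  refine Continuous.measurable (continuous_iff_continuousAt.2 fun x => ?_)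
  obtain ⟨C, hC⟩ := hf.holder (‖x‖ + 1)
  exact (hC.continuousOn hα).continuousAt (Metric.isOpen_ball.mem_nhds (by simp))

lemma QuasiMinBound.of_const_le {C C' ε ε' δ R L : ℝ} {p : Measure (Pt d × Pt d)}
    (h : QuasiMinBound L C ε δ R p) (hC : C * ε ^ 2 ≤ C' * ε' ^ 2) :
    QuasiMinBound L C' ε' δ R p := by
  unfold QuasiMinBound at h ⊢
  refine h.trans ?_
  gcongr

end Rescaling

end EntropicOT

end

/-! ### Choice of the constants, uniformly over admissible rescalings -/

theorem proposition7 (d : ℕ) (α : ℝ≥0) (hα₀ : 0 < α) (hα₁ : α < 1)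
    (θ : ℝ) (hθ : 1 < θ)
    (K G : Set ℝ) (hK : IsCompact K) (hKpos : K ⊆ Set.Ioi 0)
    (hG : IsCompact G) (hGpos : G ⊆ Set.Ioi 0) :
    ∃ C₁ : ℝ → ℝ → ℝ → ℝ → ℝ,
      (∀ δ l₀ m₀ : ℝ, StrictMonoOn (fun R => C₁ δ R l₀ m₀) (Set.Ioi 0)) ∧
      ∀ (c₀ a : ℝ), 0 < c₀ → 0 < a → ∃ η : ℝ, 0 < η ∧
      ∀ (ε R : ℝ), 0 < ε → 0 < R → ε ≤ η * R →
      ∀ (lam mu : Measure (EntropicOT.Pt d)) [IsFiniteMeasure lam] [IsFiniteMeasure mu]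
        (f g : EntropicOT.Pt d → ℝ),
        EntropicOT.IsHolderDensity α f lam → EntropicOT.IsHolderDensity α g mu →
        (∀ x ∈ Metric.ball (0 : EntropicOT.Pt d) R, c₀ ≤ f x ∧ c₀ ≤ g x) →
      ∀ p : Measure (EntropicOT.Pt d × EntropicOT.Pt d),
        EntropicOT.IsEntropicMinimiser ε lam mu p →
        (EntropicOT.energy p (θ * R) + EntropicOT.dataD α f g (θ * R) ≤ ENNReal.ofReal η →
          ∀ δ : ℝ, 0 < δ → δ < 1 →
            EntropicOT.QuasiMinBound (11 / 4) (C₁ δ R (f 0) (g 0)) ε δ R p) ∧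
        ∀ s ∈ EntropicOT.admissible d a K G,
          EntropicOT.energy (s.plan p) (θ * R)
              + EntropicOT.dataD α (s.fstDensity f) (s.sndDensity g) (θ * R)
            ≤ ENNReal.ofReal η →
          ∀ δ : ℝ, 0 < δ → δ < 1 →
            EntropicOT.QuasiMinBound (11 / 4) (C₁ δ R (f 0) (g 0)) ε δ R (s.plan p) := by
  obtain ⟨η₀, hη₀, hmain⟩ := EntropicOT.quasiMinBound_of_smallness d hθ
  choose C hC hmain using hmain
  obtain ⟨Γ, hΓ1, hΓ⟩ : ∃ Γ : ℝ, 1 ≤ Γ ∧ ∀ γ ∈ G, γ ≤ Γ := by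
    obtain ⟨Γ, hΓ⟩ := hG.bddAbove
    exact ⟨max Γ 1, le_max_right _ _, fun γ hγ => (hΓ hγ).trans (le_max_left _ _)⟩
  obtain ⟨k, hk0, hk⟩ : ∃ k : ℝ, 0 < k ∧ ∀ κ ∈ K, k ≤ κ := by
    rcases K.eq_empty_or_nonempty with rfl | hne
    · exact ⟨1, one_pos, by simp⟩
    · obtain ⟨k, hkK, hk⟩ := hK.exists_isLeast hne
      exact ⟨k, hKpos hkK, fun κ hκ => hk hκ⟩
  classical
  -- Γ bounds γ and converts γε² back to ε². The summand R only serves strict monotonicity, and the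
  -- value 0 for δ outside (0,1) is arbitrary.
  refine ⟨fun δ R _ _ => (if h : 0 < δ ∧ δ < 1 then C δ h.1 h.2 else 0) * Γ + R,
    fun δ l₀ m₀ x _ y _ hxy => by simpa using hxy, fun c₀ a hc₀ ha => ?_⟩
  -- Lower bounds at the origin for the original first density and the rescaled one: A fixes 0, so
  -- the latter is κ det A f(0) ≥ k a c₀.
  set m := min c₀ (k * a * c₀) with hm
  have hm0 : 0 < m := lt_min hc₀ (by positivity)
  have hΓ0 : 0 < Γ := by linarith
  -- The three entries control the oscillation of the densities, the energy after mass
  -- normalisation, and the rescaled scale: √γ ε ≤ Γε ≤ R.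
  set η := min (min (m ^ 2 / 16) (η₀ * m)) Γ⁻¹ with hη
  have hη0 : 0 < η := by positivity
  have hη1 : η ≤ m ^ 2 / 16 := (min_le_left _ _).trans (min_le_left _ _)
  have hη2 : η ≤ η₀ * m := (min_le_left _ _).trans (min_le_right _ _)
  have hη3 : Γ * η ≤ 1 := by
    calc Γ * η ≤ Γ * Γ⁻¹ := by gcongr; exact min_le_right _ _
      _ = 1 := mul_inv_cancel₀ hΓ0.ne'
  refine ⟨η, hη0, ?_⟩
  intro ε R hε hR hεR lam mu _ _ f g hf hg hfg p hp
  obtain ⟨ρ, H, hpρ⟩ := hp.exists_locMin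
  have hΓε : Γ * ε ≤ R := by
    calc Γ * ε ≤ Γ * (η * R) := by gcongr
      _ = Γ * η * R := by ring
      _ ≤ 1 * R := by gcongr
      _ = R := one_mul R
  have hf0 : c₀ ≤ f 0 := (hfg 0 (Metric.mem_ball_self hR)).1
  constructor
  · intro hsmall δ hδ hδ1
    have hb := hmain δ hδ hδ1 ε R m η hε ((le_mul_of_one_le_left hε.le hΓ1).trans hΓε) hm0
      hη0.le hη1 hη2 lam mu α f g ρ hf.eq_withDensity hg.eq_withDensity
      ((min_le_left _ _).trans hf0) H (hpρ ▸ hp.mem) (hpρ ▸ hsmall)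
    rw [← hpρ] at hb
    refine hb.of_const_le ?_
    simp only [dif_pos (And.intro hδ hδ1)]
    gcongr
    exact (le_mul_of_one_le_right (hC δ hδ hδ1) hΓ1).trans (le_add_of_nonneg_right hR.le)
  · rintro s ⟨hA, hdet, hsγ, hsκ⟩ hsmall δ hδ hδ1
    have hγ : 0 < s.γ := hGpos hsγ
    have hκ : 0 < s.κ := hKpos hsκ
    obtain ⟨ρ', H', hplan⟩ := H.rescale s hA hγ hκ
    rw [← hpρ] at hplan
    -- The rescaled plan is a local minimiser with weight γε², that is, at scale √γ ε.
    rw [← Real.sq_sqrt hγ.le, ← mul_pow] at H'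
    have hγΓ : √s.γ ≤ Γ := by
      calc √s.γ ≤ √(Γ ^ 2) := Real.sqrt_le_sqrt ((hΓ _ hsγ).trans (by nlinarith))
        _ = Γ := Real.sqrt_sq hΓ0.le
    have : IsFiniteMeasure (s.fstMeasure lam) := Measure.smul_finite _ ENNReal.ofReal_ne_top
    have : IsFiniteMeasure (s.sndMeasure mu) := Measure.smul_finite _ ENNReal.ofReal_ne_top
    have hms : m ≤ s.fstDensity f 0 := by
      refine (min_le_right _ _).trans ?_
      rw [EntropicOT.Rescaling.fstDensity, map_zero]
      exact mul_le_mul (mul_le_mul (hk _ hsκ) hdet ha.le hκ.le) hf0 hc₀.le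
        (mul_nonneg hκ.le hA.det_pos.le)
    have hb := hmain δ hδ hδ1 (√s.γ * ε) R m η (by positivity)
      (le_trans (by gcongr) hΓε) hm0 hη0.le hη1 hη2 (s.fstMeasure lam) (s.sndMeasure mu) α
      (s.fstDensity f) (s.sndDensity g) ρ'
      (by
        conv_lhs => rw [hf.eq_withDensity]
        exact s.fstMeasure_eq_withDensity hA hκ.le (hf.measurable hα₀))
      (by
        conv_lhs => rw [hg.eq_withDensity]
        exact s.sndMeasure_eq_withDensity hA hγ hκ.le (hg.measurable hα₀))
      hms H' (hplan ▸ s.plan_mem_couplings hp.mem) (hplan ▸ hsmall)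
    rw [← hplan] at hb
    refine hb.of_const_le ?_
    simp only [dif_pos (And.intro hδ hδ1)]
    rw [mul_pow, Real.sq_sqrt hγ.le, ← mul_assoc]
    gcongr
    exact (mul_le_mul_of_nonneg_left (hΓ _ hsγ) (hC δ hδ hδ1)).trans
      (le_add_of_nonneg_right hR.le)
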